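/- **Setup.** Let $M$ be a loopless matroid on a finite ground set $E$. A set $I\subseteq E$ *spans* a flat $F$ if $I\subseteq F$ and $\operatorname{rk}_M(I)=\operatorname{rk}_M(F)$. Let $\widehat{\mathcal L}(M)$ be the set of proper non-empty flats of $M$. An *order filter* of $M$ is a subset $\mathcal P\subseteq\widehat{\mathcal L}(M)$ such that $F\in\mathcal P$, $G\in\widehat{\mathcal L}(M)$ and $F\subseteq G$ imply $G\in\mathcal P$. The cones of the *Bergman fan* $\Sigma_{M,\mathcal P}$ in $\mathbb R^E/\mathbb R(1,\dots,1)$ are the cones $\sigma_{I<\mathcal F}$ spanned by $e_i$ $(i\in I)$ and $e_F=\sum_{j\in F}e_j$ $(F\in\mathcal F)$, where $\mathcal F\subseteq\mathcal P$ is a chain, $I\subseteq E$ is contained in every element of $\mathcal F$, and $I$ spans no element of $\mathcal P\cup\{E\}$. Its Stanley–Reisner ring $\mathbb C[\Sigma_{M,\mathcal P}]$ is the polynomial ring in the indeterminates $x_i$, $x_F$ corresponding to the rays $\sigma_{\{i\}<\emptyset}$, $\sigma_{\emptyset<\{F\}}$, modulo the ideal generated by the products of indeterminates whose rays do not span a cone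 of the fan; put $\delta_ix_i=x_i$ if $\sigma_{\{i\}<\emptyset}$ is a cone of the fan and $\delta_ix_i=0$ otherwise. Write $\Sigma_M=\Sigma_{M,\widehat{\mathcal L}(M)}$. Let $S_M=\mathbb C[x_i:i\in E]$, let $S_M^\circ\subseteq S_M$ be the subring generated over $\mathbb C$ by the differences $x_i-x_j$ ($i,j\in E$), and let $L$ be the space of its elements of degree one. The map $x_i\mapsto\delta_ix_i+\sum_{F\in\mathcal P,\,i\in F}x_F$ makes $\mathbb C[\Sigma_{M,\mathcal P}]$ an $S_M$-algebra and an $S_M^\circ$-algebra. Let $\operatorname{Tor}_t^{S_M^\circ}(\mathbb C[\Sigma_{M,\mathcal P}])_s$ be the bigraded piece of $\operatorname{Tor}^{S_M^\circ}_t(\mathbb C[\Sigma_{M,\mathcal P}],\mathbb C)$ computed by the Koszul complex, i.e. the space of homology classes of the cycles lying in $\mathbb C[\Sigma_{M,\mathcal P}]_s\otimes\bigwedge^tL$ (so the differential lowers $t$ by one and raises $s$ by one). A *matroidal flip* $\Sigma_{M,\mathcal P_-}\rightsquigarrow\Sigma_{M,\mathcal P_+}$ with *center* $Z$ consists of two order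 filters of $M$ such that $Z\notin\mathcal P_-$ and $\mathcal P_+=\mathcal P_-\cup\{Z\}$. Let $M^Z$ be the restriction of $M$ to $Z$ and $M_Z$ the contraction of $M$ by $Z$ (on the ground set $E\setminus Z$), and for integers $t,s\ge0$ put $$E^Z_{t,s}=\bigoplus_{\substack{t_1+t_2=t,\ s_1+s_2=s\\ t_1+s_1>0}}\operatorname{Tor}^{S^\circ_{M^Z}}_{t_1}(\mathbb C[\Sigma_{M^Z,\emptyset}])_{s_1}\otimes_{\mathbb C}\operatorname{Tor}^{S^\circ_{M_Z}}_{t_2}(\mathbb C[\Sigma_{M_Z}])_{s_2};$$ all bigraded pieces with a negative index are $0$. **Theorem.** Let $\Sigma_{M,\mathcal P_-}\rightsquigarrow\Sigma_{M,\mathcal P_+}$ be a matroidal flip with center $Z$. There is a homomorphism of $S_M$-algebras $\iota\colon\mathbb C[\Sigma_{M,\mathcal P_-}]\to\mathbb C[\Sigma_{M,\mathcal P_+}]$ with $\iota(x_i)=\delta_ix_i+x_Z$ for $i\in Z$ (where $\delta_i x_i$ is taken in $\mathbb C[\Sigma_{M,\mathcal P_+}]$) and $\iota(x)=x$ for every other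 indeterminate, and there is a long exact sequence of $\mathbb C$-vector spaces, for all $t,s$, $$\cdots\to E^Z_{t+1,s-1}\to\operatorname{Tor}_t^{S_M^\circ}(\mathbb C[\Sigma_{M,\mathcal P_-}])_s\xrightarrow{\ \iota_*\ }\operatorname{Tor}_t^{S_M^\circ}(\mathbb C[\Sigma_{M,\mathcal P_+}])_s\to E^Z_{t,s}\to\operatorname{Tor}_{t-1}^{S_M^\circ}(\mathbb C[\Sigma_{M,\mathcal P_-}])_{s+1}\to\cdots$$ in which $\iota_*$ is the map induced by $\iota$. In particular $\iota_*$ is injective for $s=0$, and $\operatorname{Tor}_0^{S_M^\circ}(\mathbb C[\Sigma_{M,\mathcal P_+}])_s\to E^Z_{0,s}$ is surjective. -/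

import Mathlib

open scoped TensorProduct DirectSum

noncomputable section

/-! ### Stanley--Reisner rings -/

/-- The Stanley--Reisner ideal of a simplicial complex (a set of faces `Δ`) with vertices among
the elements of `V`: it is generated by the products of the indeterminates over the finite sets
that are not faces.  In particular `x_v` is in the ideal when `{v}` is not a face. -/
def stanleyReisnerIdeal {V : Type*} (Δ : Set (Finset V)) : Ideal (MvPolynomial V ℂ) :=
  Ideal.span {p | ∃ s : Finset V, s ∉ Δ ∧ p = ∏ v ∈ s, MvPolynomial.X v}

/-- The Stanley--Reisner ring `ℂ[Δ]`.  Elements `v` of `V` which are not vertices of `Δ` contribute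
the class `x_v = 0`, so this is the usual quotient of the polynomial ring on the vertices. -/
abbrev StanleyReisner {V : Type*} (Δ : Set (Finset V)) : Type _ :=
  MvPolynomial V ℂ ⧸ stanleyReisnerIdeal Δ

/-- The class in `ℂ[Δ]` of the indeterminate `x_v`. -/
def StanleyReisner.x {V : Type*} (Δ : Set (Finset V)) (v : V) : StanleyReisner Δ :=
  Ideal.Quotient.mk (stanleyReisnerIdeal Δ) (MvPolynomial.X v)

/-- The homogeneous part of degree `s` of the graded ring `ℂ[Δ]`. -/
def StanleyReisner.degree {V : Type*} (Δ : Set (Finset V)) (s : ℕ) :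
    Submodule ℂ (StanleyReisner Δ) :=
  (MvPolynomial.homogeneousSubmodule V ℂ s).map
    (Ideal.Quotient.mkₐ ℂ (stanleyReisnerIdeal Δ)).toLinearMap

/-! ### The Koszul complex and bigraded Tor -/

section Koszul

variable {k : Type*} [CommRing k] {L : Type*} [AddCommGroup L] [Module k L]
  {A : Type*} [AddCommGroup A] [Module k A] (μ : L →ₗ[k] Module.End k A)

/-- The Koszul chains `A ⊗ ⋀ᵗ L` of a module `A` on which the elements of `L` act through `μ`. -/
abbrev KoszulChains (_μ : L →ₗ[k] Module.End k A) (t : ℕ) : Type _ :=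
  A ⊗[k] (⋀[k]^t L)

/-- The expression `ℓ a ⊗ (ℓ₁ ∧ ⋯ ∧ ℓₜ)`, as a function of `ℓ`, of `ℓ₁, …, ℓₜ` and of `a`. -/
def koszulAux (t : ℕ) : L →ₗ[k] L [⋀^Fin t]→ₗ[k] (A →ₗ[k] KoszulChains μ t) where
  toFun ℓ :=
    ((LinearMap.lcomp k (KoszulChains μ t) (μ ℓ)).comp
      (TensorProduct.mk k A (⋀[k]^t L)).flip).compAlternatingMap (exteriorPower.ιMulti k t)
  map_add' ℓ ℓ' := by
    ext v a
    simp
  map_smul' c ℓ := by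
    ext v a
    simp [TensorProduct.smul_tmul']

/-- The Koszul differential `A ⊗ ⋀ᵗ⁺¹ L → A ⊗ ⋀ᵗ L`. -/
def koszulD (t : ℕ) : KoszulChains μ (t + 1) →ₗ[k] KoszulChains μ t :=
  TensorProduct.lift
    (LinearMap.flip (exteriorPower.alternatingMapLinearEquiv (N := A →ₗ[k] KoszulChains μ t)
      (AlternatingMap.alternatizeUncurryFin (koszulAux μ t))))

/-- The formula for the Koszul differential (the numbering starts at `0`). -/
theorem koszulD_tmul (t : ℕ) (a : A) (ℓ : Fin (t + 1) → L) :
    koszulD μ t (a ⊗ₜ exteriorPower.ιMulti k (t + 1) ℓ) =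
      ∑ i : Fin (t + 1), (-1) ^ (i : ℕ) •
        (μ (ℓ i) a ⊗ₜ[k] exteriorPower.ιMulti k t (i.removeNth ℓ)) := by
  simp only [koszulD, TensorProduct.lift.tmul, LinearMap.flip_apply,
    exteriorPower.alternatingMapLinearEquiv_apply_ιMulti,
    AlternatingMap.alternatizeUncurryFin_apply, LinearMap.sum_apply, LinearMap.smul_apply]
  rfl

/-- The Koszul cycles in Tor degree `t`. -/
def koszulCycles : (t : ℕ) → Submodule k (KoszulChains μ t)
  | 0 => ⊤
  | t + 1 => LinearMap.ker (koszulD μ t)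

/-- The Koszul boundaries, as a subspace of the cycles. -/
def koszulBoundaries (t : ℕ) : Submodule k (koszulCycles μ t) :=
  (LinearMap.range (koszulD μ t)).submoduleOf (koszulCycles μ t)

/-- The homology of the Koszul complex in Tor degree `t`. -/
def KoszulHomology (t : ℕ) : Type _ :=
  koszulCycles μ t ⧸ koszulBoundaries μ t

instance (t : ℕ) : AddCommGroup (KoszulHomology μ t) :=
  inferInstanceAs (AddCommGroup (koszulCycles μ t ⧸ koszulBoundaries μ t))

instance (t : ℕ) : Module k (KoszulHomology μ t) :=
  inferInstanceAs (Module k (koszulCycles μ t ⧸ koszulBoundaries μ t))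

/-- The homology class of a Koszul cycle. -/
def KoszulHomology.mk (t : ℕ) : koszulCycles μ t →ₗ[k] KoszulHomology μ t :=
  (koszulBoundaries μ t).mkQ

/-- The subspace `A_s ⊗ ⋀ᵗ L` of the Koszul chains, for a family `𝒜` of subspaces of `A`. -/
def koszulDegree (𝒜 : ℕ → Submodule k A) (t s : ℕ) : Submodule k (KoszulChains μ t) :=
  LinearMap.range (LinearMap.rTensor (⋀[k]^t L) (𝒜 s).subtype)

/-- The part of degree `s` of the Koszul homology in Tor degree `t`: the classes of the cycles in
`A_s ⊗ ⋀ᵗ L`. -/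
def koszulHomologyDegree (𝒜 : ℕ → Submodule k A) (t s : ℕ) : Submodule k (KoszulHomology μ t) :=
  ((koszulDegree μ 𝒜 t s).submoduleOf (koszulCycles μ t)).map (KoszulHomology.mk μ t)

end Koszul

/-- The space of degree one elements of a subring `S` of a polynomial ring. -/
def linearForms {σ : Type*} (S : Subalgebra ℂ (MvPolynomial σ ℂ)) :
    Submodule ℂ (MvPolynomial σ ℂ) :=
  Subalgebra.toSubmodule S ⊓ MvPolynomial.homogeneousSubmodule σ ℂ 1

/-- The action of the linear forms of `S` on an `S`-algebra `A` with structure map `φ`. -/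
def linearFormsAction {σ A : Type*} [CommRing A] [Algebra ℂ A]
    (S : Subalgebra ℂ (MvPolynomial σ ℂ)) (φ : S →ₐ[ℂ] A) :
    linearForms S →ₗ[ℂ] Module.End ℂ A :=
  (LinearMap.mul ℂ A).comp (φ.toLinearMap.comp
    (Submodule.inclusion (inf_le_left : linearForms S ≤ Subalgebra.toSubmodule S)))

/-- `Torₜ^S(A, ℂ)`, for a polynomial ring `S ⊆ ℂ[x_i : i ∈ σ]` generated by linear forms and an
`S`-algebra `A` with structure map `φ`: the homology of the complex obtained by tensoring the Koszul
resolution of `ℂ` over `S` with `A`. -/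
abbrev KoszulTor {σ A : Type*} [CommRing A] [Algebra ℂ A]
    (S : Subalgebra ℂ (MvPolynomial σ ℂ)) (φ : S →ₐ[ℂ] A) (t : ℕ) : Type _ :=
  KoszulHomology (linearFormsAction S φ) t

/-! ### Matroids, order filters and Bergman fans -/

section Matroids

variable {α : Type*}

/-- `I` spans the flat `F`: it is contained in `F` and has the same rank. -/
def SpansFlat (M : Matroid α) (I F : Set α) : Prop :=
  I ⊆ F ∧ M.eRk I = M.eRk F

/-- The set of proper non-empty flats of a matroid. -/
def properFlats (M : Matroid α) : Set (Set α) :=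
  {F | M.IsFlat F ∧ F.Nonempty ∧ F ≠ M.E}

/-- An order filter: a set of proper non-empty flats which is closed under upward inclusion. -/
def IsOrderFilter (M : Matroid α) (P : Set (Set α)) : Prop :=
  P ⊆ properFlats M ∧ ∀ F ∈ P, ∀ G ∈ properFlats M, F ⊆ G → G ∈ P

/-- `Pm` and `Pp` are order filters and `Pp` is obtained from `Pm` by adding one flat `Z`. -/
def IsMatroidalFlip (M : Matroid α) (Pm Pp : Set (Set α)) (Z : Set α) : Prop :=
  IsOrderFilter M Pm ∧ IsOrderFilter M Pp ∧ Z ∉ Pm ∧ Pp = insert Z Pm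

/-- The Bergman fan `Σ_{M,P}`, as an abstract simplicial complex.  The element `Sum.inl i` stands
for the ray of `e_i`, and `Sum.inr F` for the ray of `e_F`; each cone `σ_{I < 𝓕}` is simplicial and is
recorded by the set of its rays `e_i` for `i ∈ I` and `e_F` for `F ∈ 𝓕`. -/
def bergmanFan (M : Matroid α) (P : Set (Set α)) : Set (Finset (α ⊕ Set α)) :=
  {τ | ∃ (I : Finset α) (𝓕 : Finset (Set α)),
    τ = I.disjSum 𝓕 ∧
    (I : Set α) ⊆ M.E ∧
    (𝓕 : Set (Set α)) ⊆ P ∧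
    IsChain (· ⊆ ·) (𝓕 : Set (Set α)) ∧
    (∀ F ∈ 𝓕, (I : Set α) ⊆ F) ∧
    ∀ F ∈ insert M.E P, ¬ SpansFlat M I F}

/-- The ring `S°_M`: the subring generated by the differences `x_i - x_j` with `i` and `j` in the
ground set of `M`. -/
def sCirc (M : Matroid α) : Subalgebra ℂ (MvPolynomial α ℂ) :=
  Algebra.adjoin ℂ
    {p | ∃ i ∈ M.E, ∃ j ∈ M.E, p = MvPolynomial.X i - MvPolynomial.X j}

variable [Fintype α]

open Classical in
/-- The map `x_i ↦ δ_i x_i + ∑_{F ∈ P, i ∈ F} x_F` to `ℂ[Σ_{M,P}]`.  (The class `x_i` is zero when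
`e_i` does not give a ray of the fan, which accounts for `δ_i`.) -/
def structureMap (M : Matroid α) (P : Set (Set α)) :
    MvPolynomial α ℂ →ₐ[ℂ] StanleyReisner (bergmanFan M P) :=
  MvPolynomial.aeval fun i =>
    StanleyReisner.x (bergmanFan M P) (Sum.inl i) +
      ∑ F : Set α with F ∈ P ∧ i ∈ F, StanleyReisner.x (bergmanFan M P) (Sum.inr F)

/-- The structure map of the `S°_M`-algebra `ℂ[Σ_{M,P}]`. -/
def sCircMap (M : Matroid α) (P : Set (Set α)) :
    sCirc M →ₐ[ℂ] StanleyReisner (bergmanFan M P) :=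
  (structureMap M P).comp (sCirc M).val

/-- The action of the linear forms of `S°_M` on `ℂ[Σ_{M,P}]`. -/
abbrev bergmanAction (M : Matroid α) (P : Set (Set α)) :
    linearForms (sCirc M) →ₗ[ℂ] Module.End ℂ (StanleyReisner (bergmanFan M P)) :=
  linearFormsAction (sCirc M) (sCircMap M P)

/-- `Torₜ(ℂ[Σ_{M,P}])_s`, where `Tor` is taken over `S°_M` and the second argument is `ℂ`. -/
abbrev bergmanTor (M : Matroid α) (P : Set (Set α)) (t s : ℕ) :
    Submodule ℂ (KoszulTor (sCirc M) (sCircMap M P) t) :=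
  koszulHomologyDegree (bergmanAction M P) (StanleyReisner.degree (bergmanFan M P)) t s

/-- The indices `((t₁, s₁), (t₂, s₂))` with `t₁ + t₂ = t`, `s₁ + s₂ = s` and `t₁ + s₁ > 0`. -/
abbrev ExcIndex (t s : ℕ) : Type :=
  {p : (ℕ × ℕ) × (ℕ × ℕ) // p.1.1 + p.2.1 = t ∧ p.1.2 + p.2.2 = s ∧ 0 < p.1.1 + p.1.2}

/-- The bigraded space `E^Z`, built from the restriction `M^Z` of `M` to `Z` with the empty order
filter, and from the contraction `M_Z` of `M` by `Z` with the order filter of all proper non-empty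
flats. -/
abbrev excTerm (M : Matroid α) (Z : Set α) (t s : ℕ) : Type _ :=
  ⨁ p : ExcIndex t s,
    (bergmanTor (M.restrict Z) ∅ p.1.1.1 p.1.1.2) ⊗[ℂ]
      (bergmanTor (M.contract Z) (properFlats (M.contract Z)) p.1.2.1 p.1.2.2)

end Matroids

end

noncomputable section

/-! ### Eigenspaces -/

section Eigen

variable {k V W ι : Type*} [Field k] [AddCommGroup V] [Module k V] [AddCommGroup W] [Module k W]

/-! Write A₋ → A₊ for ι : ℂ[Σ₋] → ℂ[Σ₊]. Inside Σ₋ lies the subcomplex `lowerStar`, the join of the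
full simplex on Z with the complex of chains of proper flats strictly above Z. Inside Σ₊ lies
`upperStar`, the closed star of e_Z: the join of Σ_{M^Z,∅}, the vertex Z and the same complex of
chains. Outside the two stars the faces agree (`IsMatroidalFlip.diff_eq`), and a monomial supported
on such a face contains a variable that is annihilated by x_Z, so ι leaves it unchanged. Hence, if
B₋ and B₊ are the rings of the stars, ι identifies the kernels of A₋ → B₋ and A₊ → B₊. Equivalently,
0 → A₋ → A₊ ⊕ B₋ → B₊ → 0 is exact. It stays exact after tensoring with ⋀L, and Koszul homology gets
a Mayer–Vietoris triangle (`DiffHomology.exists_connecting`,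
`DiffHomology.exists_map_eq_of_map_eq`).

The homology of the stars is explicit. Fix i₀ ∈ Z and j₀ ∉ Z in the ground set, and let K =
ℂ[Σ_{M^Z,∅}] and Q = ℂ[Σ_{M_Z}]. Then B₊ = (K ⊗ Q)[x_Z] and B₋ = (S ⊗ Q)[x_{i₀}], where S is the
polynomial ring on the differences x_i - x_{i₀}, i ∈ Z. In both rings the linear form x_{i₀} -
x_{j₀} acts as y - r, with y the last indeterminate, so it is regular and dividing by it leaves S ⊗
Q and K ⊗ Q (`koszulTotal_kill`). The remaining linear forms are those of M^Z and M_Z acting on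
separate factors, so the Künneth formula applies (`exists_koszul_kuenneth`). Since S is S°_{M^Z}
itself, its Koszul homology is ℂ (`koszulTotal_acyclic`). Thus H(B₋) → H(B₊) becomes y ↦ u ⊗ y from
H(Q) to H(K) ⊗ H(Q), with u the class of 1. It is injective because the augmentation of K shows u ≠
0.

Injectivity of H(B₋) → H(B₊) turns the Mayer–Vietoris triangle into an exact triangle H(A₋) → H(A₊)
→ (H(K) ⊗ H(Q)) / (u ⊗ H(Q)) → H(A₋). The piece of H(K) of bidegree (0,0) is spanned by u, so this
quotient is the sum of all E^Z_{t,s}: the condition t₁ + s₁ > 0 removes exactly u ⊗ H(Q).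

Gradings are handled through one diagonalizable operator. The homology of the whole complex A ⊗ ⋀L
is formed without grading, and Tor_t(A)_s is recovered as the eigenspace for the eigenvalue 2^t 3^s
(`range_koszulPieceIncl`). The differential and the connecting map have bidegree (-1, 1), so they
commute with the operator up to the factor 3/2. An exact triangle of maps with such commutation
rules splits into long exact sequences (`exists_long_exact_sequence`). At the two ends exactness
becomes injectivity and surjectivity, because 2^(t+1) 3^(-1) and 2^(-1) 3^(s+1) are not eigenvalues.
-/

theorem eigenvectors_eq_zero_of_sum_eq_zero (f : Module.End k V) (w : ι → k)
    (hw : Function.Injective w) (s : Finset ι) (a : ι → V)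
    (ha : ∀ i ∈ s, a i ∈ f.eigenspace (w i)) (h : ∑ i ∈ s, a i = 0) : ∀ i ∈ s, a i = 0 :=
  (iSupIndep_iff_finsetSum_eq_zero_imp_eq_zero _).1 ((f.eigenspaces_iSupIndep).comp hw) s a ha h

/-- If a vector is the image of an element under a map that intertwines two operators up to a
scalar, and the first operator is diagonalizable, then an eigenvector in the image is the image of
an eigenvector. -/
theorem exists_eigenvector_preimage {f : Module.End k V} {g : Module.End k W}
    (hf : ⨆ μ, f.eigenspace μ = ⊤) (F : V →ₗ[k] W) {c : k} (hc : c ≠ 0)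
    (hF : ∀ v, g (F v) = c • F (f v)) {β : k} {v : V} (hv : F v ∈ g.eigenspace β) :
    ∃ v' ∈ f.eigenspace (c⁻¹ * β), F v' = F v := by
  classical
  have hv' : v ∈ ⨆ μ, f.eigenspace μ := hf ▸ Submodule.mem_top
  obtain ⟨a, ha, rfl⟩ := (Submodule.mem_iSup_iff_exists_finsupp _ _).1 hv'
  refine ⟨a (c⁻¹ * β), ha _, ?_⟩
  -- The weight c⁻¹β is inserted because the component of v there may vanish.
  set s := insert (c⁻¹ * β) a.support with hs
  have hsum : (a.sum fun _ x => x) = ∑ μ ∈ s, a μ :=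
    Finset.sum_subset (Finset.subset_insert _ _) (by simp +contextual)
  -- The vectors F (a μ) have weight cμ under g, and F v has weight β = c(c⁻¹β). Subtracting F v at
  -- the index c⁻¹β gives a vanishing sum of eigenvectors with distinct weights, so the term at that
  -- index vanishes.
  have key := eigenvectors_eq_zero_of_sum_eq_zero g (fun μ => c * μ)
    (mul_right_injective₀ hc) s
    (fun μ => F (a μ) - if μ = c⁻¹ * β then F (a.sum fun _ x => x) else 0) ?_ ?_
    (c⁻¹ * β) (Finset.mem_insert_self _ _)
  · simpa [sub_eq_zero] using key
  · intro μ _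
    refine Submodule.sub_mem _ ?_ ?_
    · have := ha μ
      rw [Module.End.mem_eigenspace_iff] at this ⊢
      rw [hF, this, map_smul, smul_smul]
    · split_ifs with h
      · rwa [h, mul_inv_cancel_left₀ hc]
      · exact Submodule.zero_mem _
  · rw [Finset.sum_sub_distrib, Finset.sum_ite_eq' s, if_pos (Finset.mem_insert_self _ _),
      ← map_sum, ← hsum, sub_self]

theorem iSup_eigenspace_eq_top_of_family {f : Module.End k V} {w : ι → k}
    (h : ⨆ i, f.eigenspace (w i) = ⊤) : ⨆ μ, f.eigenspace μ = ⊤ :=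
  top_le_iff.1 (h ▸ iSup_le fun i => le_iSup f.eigenspace (w i))

/-- The eigenspace for μ is independent of the sum of the others, which is already everything. This
is what closes the two ends of the long exact sequence, where the weight that would be needed does
not occur. -/
theorem eigenspace_eq_bot_of_family {f : Module.End k V} {w : ι → k}
    (h : ⨆ i, f.eigenspace (w i) = ⊤) {μ : k} (hμ : ∀ i, w i ≠ μ) : f.eigenspace μ = ⊥ := by
  have h1 := f.eigenspaces_iSupIndep μ
  have h2 : ⨆ (j) (_ : j ≠ μ), f.eigenspace j = ⊤ :=
    top_le_iff.1 (h ▸ iSup_le fun i => le_iSup₂ (f := fun j (_ : j ≠ μ) => f.eigenspace j)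
      (w i) (hμ i))
  rw [h2] at h1
  exact disjoint_top.1 h1

/-- Subspaces of eigenspaces which span everything are the eigenspaces. -/
theorem eq_eigenspace_of_le {f : Module.End k V} {w : ι → k} (hw : Function.Injective w)
    {G : ι → Submodule k V} (hG : ∀ i, G i ≤ f.eigenspace (w i)) (h : ⨆ i, G i = ⊤) (i : ι) :
    G i = f.eigenspace (w i) := by
  classical
  refine le_antisymm (hG i) fun x hx => ?_
  have hx' : x ∈ ⨆ i, G i := h ▸ Submodule.mem_top
  obtain ⟨a, ha, hax⟩ := (Submodule.mem_iSup_iff_exists_finsupp _ _).1 hx'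
  set s := insert i a.support with hs
  have hsum : x = ∑ j ∈ s, a j := by
    rw [← hax]
    exact Finset.sum_subset (Finset.subset_insert _ _) (by simp +contextual)
  have key := eigenvectors_eq_zero_of_sum_eq_zero f w hw s
    (fun j => a j - if j = i then x else 0) ?_ ?_ i (Finset.mem_insert_self _ _)
  · have : a i = x := by simpa [sub_eq_zero] using key
    exact this ▸ ha i
  · intro j _
    refine Submodule.sub_mem _ (hG j (ha j)) ?_
    split_ifs with h
    · exact h ▸ hx
    · exact Submodule.zero_mem _
  · rw [Finset.sum_sub_distrib, Finset.sum_ite_eq' s, if_pos (Finset.mem_insert_self _ _),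
      ← hsum, sub_self]

end Eigen

/-! ### Homology of differential modules -/

section DiffHomology

variable {k : Type*} [Field k]
  {V : Type*} [AddCommGroup V] [Module k V] {V' : Type*} [AddCommGroup V'] [Module k V']
  {W : Type*} [AddCommGroup W] [Module k W] {W' : Type*} [AddCommGroup W'] [Module k W']

/-- The homology of a differential module. -/
def DiffHomology (d : Module.End k V) : Type _ :=
  LinearMap.ker d ⧸ (LinearMap.range d).submoduleOf (LinearMap.ker d)

instance (d : Module.End k V) : AddCommGroup (DiffHomology d) :=
  inferInstanceAs (AddCommGroup (LinearMap.ker d ⧸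
  (LinearMap.range d).submoduleOf (LinearMap.ker d)))

instance (d : Module.End k V) : Module k (DiffHomology d) :=
  inferInstanceAs (Module k (LinearMap.ker d ⧸ (LinearMap.range d).submoduleOf (LinearMap.ker d)))

namespace DiffHomology

/-- The class of a cycle. -/
def mk (d : Module.End k V) : LinearMap.ker d →ₗ[k] DiffHomology d :=
  ((LinearMap.range d).submoduleOf (LinearMap.ker d)).mkQ

theorem mk_surjective (d : Module.End k V) : Function.Surjective (mk d) :=
  Submodule.mkQ_surjective _

theorem mk_eq_zero {d : Module.End k V} {z : LinearMap.ker d} : mk d z = 0 ↔ ∃ u, d u = z.1 :=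
  Submodule.Quotient.mk_eq_zero _

theorem mk_eq_mk {d : Module.End k V} {z z' : LinearMap.ker d} :
    mk d z = mk d z' ↔ ∃ u, d u = z.1 - z'.1 := by
  rw [← sub_eq_zero, ← map_sub, mk_eq_zero]
  rfl

/-- A linear map which preserves cycles and boundaries. -/
structure Preserves (d : Module.End k V) (d' : Module.End k W) (f : V →ₗ[k] W) : Prop where
  cycle : ∀ z, d z = 0 → d' (f z) = 0
  boundary : ∀ u, ∃ u', d' u' = f (d u)

/-- Grading operators commute with a Koszul differential only up to a nonzero scalar, and this is
enough for a map on homology. -/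
theorem Preserves.of_smul {d : Module.End k V} {d' : Module.End k W} {f : V →ₗ[k] W} (c : k)
    (h : ∀ v, d' (f v) = c • f (d v)) (hc : c ≠ 0) : Preserves d d' f :=
  ⟨fun z hz => by rw [h, hz, map_zero, smul_zero],
    fun u => ⟨c⁻¹ • f u, by rw [map_smul, h, smul_smul, inv_mul_cancel₀ hc, one_smul]⟩⟩

theorem Preserves.of_comm {d : Module.End k V} {d' : Module.End k W} {f : V →ₗ[k] W}
    (h : ∀ v, d' (f v) = f (d v)) : Preserves d d' f :=
  .of_smul 1 (by simpa using h) one_ne_zero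

/-- The map induced on homology. -/
def map {d : Module.End k V} {d' : Module.End k W} (f : V →ₗ[k] W) (h : Preserves d d' f) :
    DiffHomology d →ₗ[k] DiffHomology d' :=
  Submodule.mapQ _ _ (f.restrict (p := LinearMap.ker d) (q := LinearMap.ker d') h.cycle) (by
    rintro ⟨_, hz⟩ ⟨u, rfl⟩
    obtain ⟨u', hu'⟩ := h.boundary u
    exact ⟨u', hu'⟩)

@[simp]
theorem map_mk {d : Module.End k V} {d' : Module.End k W} (f : V →ₗ[k] W) (h : Preserves d d' f)
    (z : LinearMap.ker d) : map f h (mk d z) = mk d' ⟨f z.1, h.cycle _ z.2⟩ := rfl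

/-- The connecting homomorphism of a commutative square whose vertical maps are surjective with
isomorphic kernels. -/
theorem exists_connecting {d : Module.End k V} {e : Module.End k W} {d' : Module.End k V'}
    {e' : Module.End k W'} (he : e ∘ₗ e = 0)
    (f : V →ₗ[k] W) (p : V →ₗ[k] V') (q : W →ₗ[k] W') (f' : V' →ₗ[k] W')
    (hf : ∀ v, e (f v) = f (d v)) (hp : ∀ v, d' (p v) = p (d v)) (hq : ∀ v, e' (q v) = q (e v))
    (hf' : ∀ v, e' (f' v) = f' (d' v)) (hsq : ∀ v, q (f v) = f' (p v))
    (hps : Function.Surjective p) (hqs : Function.Surjective q)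
    (hinj : ∀ v, p v = 0 → f v = 0 → v = 0) (hsurj : ∀ w, q w = 0 → ∃ v, p v = 0 ∧ f v = w)
    (hHf' : Function.Injective (map f' (.of_comm hf'))) :
    ∃ Δ : DiffHomology e' →ₗ[k] DiffHomology d,
      (∀ c, Δ c = 0 ↔ ∃ a b, map q (.of_comm hq) a + map f' (.of_comm hf') b = c) ∧
      (∀ a, map f (.of_comm hf) a = 0 ↔ ∃ c, Δ c = a) ∧
      ∀ (c : LinearMap.ker e') (b : W) (a : LinearMap.ker d), q b = c → e b = f a → p a = 0 →
        Δ (mk _ c) = mk _ a := by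
  -- A linear section makes the usual zigzag linear already on cycles: lift c by σ, apply e, and
  -- pull the result back along the isomorphism ker p ≅ ker q.
  obtain ⟨σ, hσ⟩ := LinearMap.exists_rightInverse_of_surjective q (LinearMap.range_eq_top.2 hqs)
  replace hσ : ∀ c, q (σ c) = c := fun c => LinearMap.congr_fun hσ c
  have hee : ∀ w, e (e w) = 0 := fun w => LinearMap.congr_fun he w
  let F : LinearMap.ker p →ₗ[k] LinearMap.ker q :=
    f.restrict (p := LinearMap.ker p) (q := LinearMap.ker q) fun v hv => by
      rw [LinearMap.mem_ker, hsq, LinearMap.mem_ker.1 hv, map_zero]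
  have hF : Function.Bijective F := by
    constructor
    · rw [injective_iff_map_eq_zero]
      rintro ⟨v, hv⟩ h
      exact Subtype.ext (hinj v hv (congrArg Subtype.val h))
    · rintro ⟨w, hw⟩
      obtain ⟨v, hv, h⟩ := hsurj w hw
      exact ⟨⟨v, hv⟩, Subtype.ext h⟩
  let Fe := LinearEquiv.ofBijective F hF
  have hFe : ∀ x, f (Fe.symm x).1 = x.1 := fun x => congrArg Subtype.val (Fe.apply_symm_apply x)
  have huniq : ∀ a, p a = 0 → e (f a) = 0 → d a = 0 := fun a ha h =>
    hinj _ (by rw [← hp, ha, map_zero]) (by rw [← hf, h])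
  let c1 : LinearMap.ker e' →ₗ[k] LinearMap.ker q :=
    LinearMap.codRestrict _ (e ∘ₗ σ ∘ₗ (LinearMap.ker e').subtype) fun c => by
      simp [← hq, hσ]
  let Δ0 : LinearMap.ker e' →ₗ[k] LinearMap.ker d :=
    LinearMap.codRestrict _ ((LinearMap.ker p).subtype ∘ₗ Fe.symm.toLinearMap ∘ₗ c1) fun c =>
      huniq _ (Fe.symm (c1 c)).2 ((congrArg e (hFe (c1 c))).trans (hee _))
  have hΔ0 : ∀ c, f (Δ0 c).1 = e (σ c.1) := fun c => hFe (c1 c)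
  have hΔ0p : ∀ c, p (Δ0 c).1 = 0 := fun c => (Fe.symm (c1 c)).2
  -- Two lifts of c differ by an element f v of ker q with p v = 0, so the two answers differ by d
  -- v.
  have hchar : ∀ (c : LinearMap.ker e') (b : W) (a : LinearMap.ker d), q b = c → e b = f a →
      p a = 0 → mk d (Δ0 c) = mk d a := by
    intro c b a h1 h2 h3
    obtain ⟨v, hv, h⟩ := hsurj (σ c.1 - b) (by rw [map_sub, hσ, h1, sub_self])
    refine mk_eq_mk.2 ⟨v, ?_⟩
    rw [← sub_eq_zero]
    apply hinj
    · rw [map_sub, map_sub, hΔ0p, h3, ← hp, hv, map_zero, sub_zero, sub_zero]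
    · rw [map_sub, map_sub, hΔ0, ← hf, h, map_sub, h2, sub_self]
  have hle : (LinearMap.range e').submoduleOf (LinearMap.ker e') ≤
      LinearMap.ker (mk d ∘ₗ Δ0) := by
    rintro ⟨_, hz⟩ ⟨u, rfl⟩
    rw [LinearMap.mem_ker, LinearMap.comp_apply, hchar _ (e (σ u)) 0, map_zero]
    · change q (e (σ u)) = e' u
      rw [← hq, hσ]
    · simp [hee]
    · simp
  let Δ : DiffHomology e' →ₗ[k] DiffHomology d := Submodule.liftQ _ (mk d ∘ₗ Δ0) hle
  have hΔ : ∀ c, Δ (mk _ c) = mk d (Δ0 c) := fun c => rfl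
  refine ⟨Δ, fun c => ?_, fun a => ?_, fun c b a h1 h2 h3 => by rw [hΔ, hchar c b a h1 h2 h3]⟩
  · obtain ⟨c, rfl⟩ := mk_surjective _ c
    constructor
    · intro h
      rw [hΔ, mk_eq_zero] at h
      obtain ⟨u, hu⟩ := h
      -- If the zigzag for c ends in d u, then σ c - f u and p u are cycles, and their images in W'
      -- add up to c.
      have h1 : e (σ c.1 - f u) = 0 := by rw [map_sub, hf, hu, hΔ0, sub_self]
      have h2 : e' (p u |> f') = 0 := by rw [hf', hp, hu, hΔ0p, map_zero]
      have h3 : d' (p u) = 0 := by rw [hp, hu, hΔ0p]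
      refine ⟨mk _ ⟨_, h1⟩, mk _ ⟨_, h3⟩, ?_⟩
      rw [map_mk, map_mk, ← map_add]
      congr 1
      ext
      simp [hσ, hsq]
    · rintro ⟨a, b, h⟩
      obtain ⟨a, rfl⟩ := mk_surjective _ a
      obtain ⟨b, rfl⟩ := mk_surjective _ b
      obtain ⟨b', hb'⟩ := hps b.1
      have hdb : d b' ∈ LinearMap.ker d := huniq _ (by rw [← hp, hb', b.2]) (by rw [← hf, hee])
      have h1 : Δ (map q (.of_comm hq) (mk _ a)) = 0 :=
        (hchar ⟨q a.1, _⟩ a.1 0 rfl (by simp) (by simp)).trans (map_zero _)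
      have h2 : Δ (map f' (.of_comm hf') (mk _ b)) = 0 :=
        (hchar ⟨f' b.1, _⟩ (f b') ⟨d b', hdb⟩ (by simp [hsq, hb']) (hf _)
          (by simp [← hp, hb'])).trans (mk_eq_zero.2 ⟨b', rfl⟩)
      rw [← h, map_add, h1, h2, add_zero]
  · obtain ⟨a, rfl⟩ := mk_surjective _ a
    constructor
    · intro h
      rw [map_mk, mk_eq_zero] at h
      obtain ⟨b, hb⟩ := h
      -- The image of p a under f' is q (f a) = e' (q b), a boundary. Injectivity of f' on homology
      -- therefore makes p a itself a boundary, so a can be moved into ker p; this is the only use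
      -- of that hypothesis.
      have h1 : mk d' ⟨p a.1, by rw [LinearMap.mem_ker, hp, a.2, map_zero]⟩ = 0 := by
        apply hHf'
        exact (mk_eq_zero.2 ⟨q b, by rw [hq, hb]; exact hsq _⟩).trans (map_zero _).symm
      obtain ⟨b', hb'⟩ := mk_eq_zero.1 h1
      obtain ⟨b0, rfl⟩ := hps b'
      replace hb' : d' (p b0) = p a.1 := hb'
      replace hb : e b = f a.1 := hb
      have h2 : q (b - f b0) ∈ LinearMap.ker e' := by
        rw [LinearMap.mem_ker, map_sub, map_sub, hq, hb, hsq, hsq, hf', hb', sub_self]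
      have h3 : d (a.1 - d b0) = 0 := by
        refine huniq _ (by rw [map_sub, ← hp, hb', sub_self]) ?_
        rw [map_sub, map_sub, hf, a.2, map_zero, ← hf, hee, sub_self]
      refine ⟨mk _ ⟨_, h2⟩, ?_⟩
      rw [hΔ, hchar ⟨_, h2⟩ (b - f b0) ⟨_, h3⟩ rfl (by simp [hb, hf]) (by simp [← hp, hb'])]
      exact mk_eq_mk.2 ⟨- b0, by simp⟩
    · rintro ⟨c, h⟩
      obtain ⟨c, rfl⟩ := mk_surjective _ c
      rw [← h, hΔ, map_mk, mk_eq_zero]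
      exact ⟨σ c.1, (hΔ0 c).symm⟩

/-! #### The Künneth formula -/

/-- The differential on the tensor product, where `τ` is the operator giving the sign. -/
def tensorD (d : Module.End k V) (τ : Module.End k V) (e : Module.End k W) :
    Module.End k (V ⊗[k] W) :=
  TensorProduct.map d LinearMap.id + TensorProduct.map τ e

@[simp]
theorem tensorD_tmul (d : Module.End k V) (τ : Module.End k V) (e : Module.End k W) (v : V)
    (w : W) : tensorD d τ e (v ⊗ₜ w) = d v ⊗ₜ w + τ v ⊗ₜ e w := rfl

/-- Over a field, a section of V → range d extends to all of V. The resulting s with d s d = d is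
the raw material for the contracting homotopy in the Künneth formula. -/
theorem exists_generalized_inverse (d : Module.End k V) :
    ∃ s : Module.End k V, ∀ v, d (s (d v)) = d v := by
  obtain ⟨r, hr⟩ := LinearMap.exists_rightInverse_of_surjective d.rangeRestrict
    (LinearMap.range_rangeRestrict d)
  obtain ⟨s, hs⟩ := LinearMap.exists_extend r
  refine ⟨s, fun v => ?_⟩
  have h1 : s (d v) = r (d.rangeRestrict v) := LinearMap.congr_fun hs (d.rangeRestrict v)
  rw [h1]
  exact congrArg Subtype.val (LinearMap.congr_fun hr (d.rangeRestrict v))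

/-- The operator p = 1 - d s - s d has image in ker d and vanishes on range d, and s ⊗ 1 is a
homotopy from 1 to p ⊗ 1. So every class on V ⊗ W is represented in ker d ⊗ W, where the
differential is τ ⊗ e; flatness then moves the representative into ker d ⊗ ker e. No grading is
present: τ plays the role of the sign of the degree. The isomorphism is obtained by showing that the
two surjections from ker d ⊗ ker e have the same kernel. -/
theorem exists_kuenneth (h2 : (2 : k) ≠ 0) {d τ : Module.End k V} {e : Module.End k W}
    (hd : ∀ v, d (d v) = 0) (he : ∀ w, e (e w) = 0) (hτ : ∀ v, τ (τ v) = v)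
    (hdτ : ∀ v, d (τ v) = - τ (d v)) :
    ∃ K : (DiffHomology d ⊗[k] DiffHomology e) ≃ₗ[k] DiffHomology (tensorD d τ e),
      ∀ (z : LinearMap.ker d) (y : LinearMap.ker e),
        ∃ h, K (mk d z ⊗ₜ mk e y) = mk (tensorD d τ e) ⟨z.1 ⊗ₜ y.1, h⟩ := by
  obtain ⟨s0, hs0⟩ := exists_generalized_inverse d
  -- Averaging over conjugation by τ makes s anticommute with τ, as the homotopy identity needs, and
  -- preserves d s d = d. This is where 2 must be invertible.
  let s : Module.End k V := (2 : k)⁻¹ • (s0 - τ ∘ₗ s0 ∘ₗ τ)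
  have hs_apply : ∀ v, s v = (2 : k)⁻¹ • (s0 v - τ (s0 (τ v))) := fun v => rfl
  have hτd : ∀ v, τ (d v) = - d (τ v) := fun v => by rw [hdτ, neg_neg]
  have hsτ : ∀ v, s (τ v) = - τ (s v) := fun v => by
    simp only [hs_apply, hτ, map_smul, map_sub, ← smul_neg, neg_sub]
  have hds : ∀ v, d (s (d v)) = d v := fun v => by
    have h : d (τ (s0 (τ (d v)))) = - d v := by
      rw [hdτ, hτd v, map_neg, map_neg, hs0, map_neg, neg_neg, hτd, hτ]
    rw [hs_apply, map_smul, map_sub, hs0, h, sub_neg_eq_add, ← two_smul k, smul_smul,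
      inv_mul_cancel₀ h2, one_smul]
  let p : Module.End k V := LinearMap.id - d ∘ₗ s - s ∘ₗ d
  have hp_apply : ∀ v, p v = v - d (s v) - s (d v) := fun v => rfl
  have hdp : ∀ v, d (p v) = 0 := fun v => by
    rw [hp_apply, map_sub, map_sub, hd, hds, sub_zero, sub_self]
  have hpd : ∀ v, p (d v) = 0 := fun v => by
    rw [hp_apply, hd, hds, map_zero, sub_zero, sub_self]
  have hpτ : ∀ v, p (τ v) = τ (p v) := fun v => by
    rw [hp_apply, hp_apply, hsτ, hdτ, map_neg, map_neg, hdτ, hsτ, neg_neg, neg_neg, map_sub,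
      map_sub]
  let p' : V →ₗ[k] LinearMap.ker d := p.codRestrict _ hdp
  let ιd := (LinearMap.ker d).subtype
  let ιe := (LinearMap.ker e).subtype
  have hιd : Function.Injective ιd := Subtype.val_injective
  have hιe : Function.Injective ιe := Subtype.val_injective
  set D := tensorD d τ e with hD
  have hDt : ∀ v w, D (v ⊗ₜ w) = d v ⊗ₜ w + τ v ⊗ₜ e w := fun v w => rfl
  -- the homotopy
  have hhom : ∀ x, x = TensorProduct.map p LinearMap.id x + D (TensorProduct.map s LinearMap.id x) +
      TensorProduct.map s LinearMap.id (D x) := by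
    intro x
    induction x with
    | zero => simp
    | add x y hx hy =>
      rw [map_add, map_add, map_add, map_add, map_add]
      nth_rewrite 1 [hx, hy]
      abel
    | tmul v w =>
      simp only [TensorProduct.map_tmul, LinearMap.id_apply, hDt, map_add, hsτ,
        TensorProduct.neg_tmul]
      rw [add_assoc, add_assoc]
      rw [show ∀ b c d : V ⊗[k] W, b + (c + (d + -c)) = b + d by intros; abel]
      rw [← TensorProduct.add_tmul, ← TensorProduct.add_tmul, hp_apply]
      congr 1
      abel
  let K0 : (LinearMap.ker d ⊗[k] LinearMap.ker e) →ₗ[k] LinearMap.ker D :=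
    LinearMap.codRestrict _ (TensorProduct.map ιd ιe) fun x => by
      rw [LinearMap.mem_ker, ← LinearMap.comp_apply]
      suffices D ∘ₗ TensorProduct.map ιd ιe = 0 by rw [this]; rfl
      ext z y
      simp [hDt, ιd, ιe]
  let g := TensorProduct.map (mk d) (mk e)
  have hg : Function.Surjective g :=
      TensorProduct.map_surjective (mk_surjective d) (mk_surjective e)
  have hK0surj : Function.Surjective (mk D ∘ₗ K0) := by
    intro c
    obtain ⟨z, rfl⟩ := mk_surjective _ c
    have hz : D z.1 = 0 := z.2
    set m := TensorProduct.map p' (LinearMap.id : W →ₗ[k] W) z.1 with hm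
    have hm1 : TensorProduct.map ιd (LinearMap.id : W →ₗ[k] W) m =
        TensorProduct.map p LinearMap.id z.1 := by
      rw [hm, ← LinearMap.comp_apply, ← TensorProduct.map_comp]
      rfl
    have hm2 : TensorProduct.map ιd (LinearMap.id : W →ₗ[k] W) (LinearMap.lTensor _ e m) = 0 := by
      have h3 : D (TensorProduct.map ιd (LinearMap.id : W →ₗ[k] W) m) = 0 := by
        have := congrArg D (hhom z.1)
        rw [hz, map_zero, add_zero, map_add] at this
        have hDD : ∀ x, D (D x) = 0 := by
          intro x
          rw [← LinearMap.comp_apply]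
          suffices D ∘ₗ D = 0 by rw [this]; rfl
          ext v w
          simp [hDt, hd, he, hdτ, TensorProduct.neg_tmul]
        rw [hDD, add_zero, ← hm1] at this
        exact this.symm
      -- On ker d ⊗ W the differential is τ ⊗ e, and applying τ once more undoes τ.
      have h4 : ∀ m, TensorProduct.map ιd (LinearMap.id : W →ₗ[k] W) (LinearMap.lTensor _ e m) =
          TensorProduct.map τ LinearMap.id (D (TensorProduct.map ιd (LinearMap.id) m)) := by
        intro m
        induction m with
        | zero => simp
        | add x y hx hy => simp only [map_add, hx, hy]
        | tmul v w => simp [hDt, ιd, hτ]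
      rw [h4, h3, map_zero]
    -- Flatness of W cancels the inclusion of ker d; flatness of ker d then identifies the kernel of
    -- 1 ⊗ e with ker d ⊗ ker e.
    have hm3 : LinearMap.lTensor (LinearMap.ker d) e m = 0 := by
      apply TensorProduct.map_injective_of_flat_flat ιd (LinearMap.id : W →ₗ[k] W) hιd
        Function.injective_id
      rw [hm2, map_zero]
    obtain ⟨m', hm'⟩ := ((Module.Flat.lTensor_exact (R := k) (LinearMap.ker d)
      (LinearMap.exact_subtype_ker_map e)) m).1 hm3
    refine ⟨m', ?_⟩
    refine (mk_eq_mk.2 ⟨TensorProduct.map s LinearMap.id z.1, ?_⟩).symm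
    have h5 : (K0 m').1 = TensorProduct.map p LinearMap.id z.1 := by
      rw [← hm1, ← hm']
      change TensorProduct.map ιd ιe m' = _
      rw [LinearMap.lTensor, ← LinearMap.comp_apply, ← TensorProduct.map_comp]
      rfl
    rw [h5]
    have := hhom z.1
    rw [hz, map_zero, add_zero] at this
    exact (sub_eq_of_eq_add' this).symm
  have hker : LinearMap.ker g = LinearMap.ker (mk D ∘ₗ K0) := by
    apply le_antisymm
    · have hexd : Function.Exact ((LinearMap.range d).submoduleOf (LinearMap.ker d)).subtype
          (mk d) := LinearMap.exact_subtype_mkQ _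
      have hexe : Function.Exact ((LinearMap.range e).submoduleOf (LinearMap.ker e)).subtype
          (mk e) := LinearMap.exact_subtype_mkQ _
      rw [TensorProduct.map_ker hexd (mk_surjective d) hexe (mk_surjective e), sup_le_iff]
      constructor
      · rw [LinearMap.range_le_ker_iff]
        ext z ⟨y, u, hu⟩
        simp only [TensorProduct.AlgebraTensorModule.curry_apply, LinearMap.restrictScalars_self,
          TensorProduct.curry_apply, LinearMap.comp_apply, LinearMap.lTensor_tmul,
          LinearMap.zero_apply]
        rw [mk_eq_zero]
        refine ⟨τ z.1 ⊗ₜ u, ?_⟩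
        rw [hDt, hdτ, LinearMap.mem_ker.1 z.2, hτ, hu]
        simp [K0, ιd, ιe]
      · rw [LinearMap.range_le_ker_iff]
        ext ⟨z, u, hu⟩ y
        simp only [TensorProduct.AlgebraTensorModule.curry_apply, LinearMap.restrictScalars_self,
          TensorProduct.curry_apply, LinearMap.comp_apply, LinearMap.rTensor_tmul,
          LinearMap.zero_apply]
        rw [mk_eq_zero]
        refine ⟨u ⊗ₜ y.1, ?_⟩
        rw [hDt, LinearMap.mem_ker.1 y.2, hu]
        simp [K0, ιd, ιe]
    · intro m hm
      rw [LinearMap.mem_ker, LinearMap.comp_apply, mk_eq_zero] at hm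
      obtain ⟨u, hu⟩ := hm
      let e' : W →ₗ[k] LinearMap.ker e := e.codRestrict _ he
      -- On a cycle z, p z and z differ by d (s z). After p ⊗ 1 is applied, only the term (p τ) ⊗ e
      -- of D survives, because p d = 0; its second factor is a boundary, which g kills.
      have h1 : g m = g (TensorProduct.map (p' ∘ₗ ιd) LinearMap.id m) := by
        rw [← LinearMap.comp_apply]
        congr 1
        ext z y
        simp only [g, TensorProduct.AlgebraTensorModule.curry_apply,
          LinearMap.restrictScalars_self, TensorProduct.curry_apply, TensorProduct.map_tmul,
          LinearMap.comp_apply, LinearMap.id_apply]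
        congr 1
        refine mk_eq_mk.2 ⟨s z.1, ?_⟩
        change _ = z.1 - (z.1 - d (s z.1) - s (d z.1))
        rw [LinearMap.mem_ker.1 z.2, map_zero, sub_zero, sub_sub_cancel]
      have h2 : TensorProduct.map (p' ∘ₗ ιd) LinearMap.id m = TensorProduct.map (p' ∘ₗ τ) e' u := by
        apply TensorProduct.map_injective_of_flat_flat ιd ιe hιd hιe
        have h3 : TensorProduct.map ιd ιe (TensorProduct.map (p' ∘ₗ ιd) LinearMap.id m) =
            TensorProduct.map p LinearMap.id (K0 m).1 := by
          change _ = TensorProduct.map p LinearMap.id (TensorProduct.map ιd ιe m)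
          simp only [← LinearMap.comp_apply, ← TensorProduct.map_comp]
          rfl
        rw [h3, ← hu]
        simp only [← LinearMap.comp_apply]
        congr 1
        ext v w
        simp [hDt, hpd, p', e', ιd, ιe]
        rfl
      rw [LinearMap.mem_ker, h1, h2]
      rw [← LinearMap.comp_apply]
      suffices g ∘ₗ TensorProduct.map (p' ∘ₗ τ) e' = 0 by rw [this]; rfl
      ext v w
      have : mk e (e' w) = 0 := mk_eq_zero.2 ⟨w, rfl⟩
      simp [g, this]
  let K := ((g.quotKerEquivOfSurjective hg).symm ≪≫ₗ Submodule.quotEquivOfEq _ _ hker ≪≫ₗ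
    (mk D ∘ₗ K0).quotKerEquivOfSurjective hK0surj)
  refine ⟨K, fun z y => ⟨(K0 (z ⊗ₜ y)).2, ?_⟩⟩
  have h1 : mk d z ⊗ₜ mk e y = g.quotKerEquivOfSurjective hg (Submodule.Quotient.mk (z ⊗ₜ y)) := rfl
  rw [h1]
  change (mk D ∘ₗ K0).quotKerEquivOfSurjective hK0surj (Submodule.quotEquivOfEq _ _ hker
    ((g.quotKerEquivOfSurjective hg).symm (g.quotKerEquivOfSurjective hg _))) = _
  rw [LinearEquiv.symm_apply_apply]
  rfl

end DiffHomology

end DiffHomology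

end

noncomputable section

/-! ### The total Koszul complex -/

section KoszulTotal

variable {k : Type*} [Field k] {L : Type*} [AddCommGroup L] [Module k L]
  {L' : Type*} [AddCommGroup L'] [Module k L']
  {A : Type*} [AddCommGroup A] [Module k A] {B : Type*} [AddCommGroup B] [Module k B]
  {X : Type*} [AddCommMonoid X] [Module k X]

open ExteriorAlgebra (ι)

/-- Left exterior multiplication by `v` on `A ⊗ ⋀ L`. -/
def wedge (A : Type*) [AddCommGroup A] [Module k A] (v : L) :
    Module.End k (A ⊗[k] ExteriorAlgebra k L) :=
  LinearMap.lTensor A (LinearMap.mulLeft k (ι k v))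

@[simp]
theorem wedge_tmul (v : L) (a : A) (x : ExteriorAlgebra k L) :
    wedge A v (a ⊗ₜ x) = a ⊗ₜ (ι k v * x) := rfl

theorem wedge_wedge (v : L) (y : A ⊗[k] ExteriorAlgebra k L) : wedge A v (wedge A v y) = 0 := by
  induction y with
  | zero => simp
  | add x y hx hy => rw [map_add, map_add, hx, hy, add_zero]
  | tmul a x => rw [wedge_tmul, wedge_tmul, ← mul_assoc, ExteriorAlgebra.ι_sq_zero, zero_mul,
      TensorProduct.tmul_zero]

theorem ExteriorAlgebra.linearMap_ext {f g : ExteriorAlgebra k L →ₗ[k] X} (h1 : f 1 = g 1)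
    (h2 : ∀ v x, f x = g x → f (ι k v * x) = g (ι k v * x)) : f = g := by
  refine LinearMap.ext fun x => ?_
  induction x using CliffordAlgebra.left_induction with
  | algebraMap r => rw [Algebra.algebraMap_eq_smul_one, map_smul, map_smul, h1]
  | add x y hx hy => rw [map_add, map_add, hx, hy]
  | ι_mul x v hx => exact h2 v x hx

/-- The induction hypothesis covers all a at once because the Koszul differential changes the first
factor while it removes a vector from the second. -/
theorem tensorExterior_ext {f g : A ⊗[k] ExteriorAlgebra k L →ₗ[k] X}
    (h1 : ∀ a, f (a ⊗ₜ 1) = g (a ⊗ₜ 1))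
    (h2 : ∀ v x, (∀ a, f (a ⊗ₜ x) = g (a ⊗ₜ x)) →
      ∀ a, f (a ⊗ₜ (ι k v * x)) = g (a ⊗ₜ (ι k v * x))) : f = g := by
  have h : (TensorProduct.curry f).flip = (TensorProduct.curry g).flip := by
    refine ExteriorAlgebra.linearMap_ext (LinearMap.ext h1) fun v x hx => ?_
    exact LinearMap.ext (h2 v x fun a => LinearMap.congr_fun hx a)
  refine TensorProduct.ext' fun a x => ?_
  exact LinearMap.congr_fun (LinearMap.congr_fun h x) a

/-- The recursion step in the definition of the total Koszul differential. -/
def koszulTotalStep (μ : L →ₗ[k] Module.End k A) :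
    L →ₗ[k] ExteriorAlgebra k L × (A →ₗ[k] A ⊗[k] ExteriorAlgebra k L) →ₗ[k]
      (A →ₗ[k] A ⊗[k] ExteriorAlgebra k L) :=
  LinearMap.mk₂ k (fun v q => (TensorProduct.mk k A _).flip q.1 ∘ₗ μ v - wedge A v ∘ₗ q.2)
    (fun v w q => by
      ext a
      simp only [wedge, map_add, LinearMap.sub_apply, LinearMap.comp_apply, LinearMap.add_apply,
        LinearMap.lTensor]
      have : LinearMap.mulLeft k (ι k v + ι k w) =
        LinearMap.mulLeft k (ι k v) + LinearMap.mulLeft k (ι k w) :=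
        LinearMap.ext fun z => by simp [add_mul]
      rw [this, TensorProduct.map_add_right, LinearMap.add_apply]
      abel)
    (fun c v q => by
      ext a
      simp only [wedge, map_smul, LinearMap.sub_apply, LinearMap.comp_apply, LinearMap.smul_apply,
        LinearMap.lTensor, smul_sub]
      have : LinearMap.mulLeft k (c • ι k v) = c • LinearMap.mulLeft k (ι k v) :=
        LinearMap.ext fun z => by simp
      rw [this, TensorProduct.map_smul_right, LinearMap.smul_apply])
    (fun v q r => by
      ext a
      simp only [Prod.fst_add, Prod.snd_add, map_add, LinearMap.sub_apply, LinearMap.comp_apply,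
        LinearMap.add_apply]
      abel)
    (fun c v q => by
      ext a
      simp only [Prod.smul_fst, Prod.smul_snd, map_smul, LinearMap.sub_apply, LinearMap.comp_apply,
        LinearMap.smul_apply, smul_sub])

/-- This is the compatibility that recursion on an exterior algebra demands: inserting the same v
twice must give zero. The two copies of v a ⊗ (v ∧ x) cancel and v ∧ v ∧ vanishes. -/
theorem koszulTotalStep_step (μ : L →ₗ[k] Module.End k A) (v : L) (x : ExteriorAlgebra k L)
    (F : A →ₗ[k] A ⊗[k] ExteriorAlgebra k L) :
    koszulTotalStep μ v (ι k v * x, koszulTotalStep μ v (x, F)) =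
      (0 : QuadraticForm k L) v • F := by
  ext a
  have h : ∀ x (q : A →ₗ[k] A ⊗[k] ExteriorAlgebra k L) a, koszulTotalStep μ v (x, q) a =
    μ v a ⊗ₜ x - wedge A v (q a) := fun x q a => rfl
  rw [h, h, map_sub, wedge_tmul, wedge_wedge, sub_zero, sub_self]
  simp

/-- The total Koszul differential on `A ⊗ ⋀ L`. -/
def koszulTotalD (μ : L →ₗ[k] Module.End k A) : Module.End k (A ⊗[k] ExteriorAlgebra k L) :=
  TensorProduct.lift (CliffordAlgebra.foldr' (0 : QuadraticForm k L) (koszulTotalStep μ)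
    (koszulTotalStep_step μ) 0).flip

@[simp]
theorem koszulTotalD_one (μ : L →ₗ[k] Module.End k A) (a : A) :
    koszulTotalD μ (a ⊗ₜ 1) = 0 := by
  rw [koszulTotalD, TensorProduct.lift.tmul, LinearMap.flip_apply]
  have := CliffordAlgebra.foldr'_algebraMap (0 : QuadraticForm k L) (koszulTotalStep μ)
    (koszulTotalStep_step μ) 0 1
  rw [map_one, one_smul] at this
  rw [this, LinearMap.zero_apply]

theorem koszulTotalD_ι_mul (μ : L →ₗ[k] Module.End k A) (a : A) (v : L)
    (x : ExteriorAlgebra k L) : koszulTotalD μ (a ⊗ₜ (ι k v * x)) =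
      μ v a ⊗ₜ x - wedge A v (koszulTotalD μ (a ⊗ₜ x)) := by
  rw [koszulTotalD, TensorProduct.lift.tmul, LinearMap.flip_apply, CliffordAlgebra.foldr'_ι_mul]
  rfl

theorem koszulTotalD_wedge (μ : L →ₗ[k] Module.End k A) (v : L) (y : A ⊗[k] ExteriorAlgebra k L) :
    koszulTotalD μ (wedge A v y) =
      LinearMap.rTensor _ (μ v) y - wedge A v (koszulTotalD μ y) := by
  induction y with
  | zero => simp
  | add x y hx hy =>
    simp only [map_add, hx, hy]
    abel
  | tmul a x => rw [wedge_tmul, koszulTotalD_ι_mul, LinearMap.rTensor_tmul]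

theorem koszulTotalD_smul (c : k) (μ : L →ₗ[k] Module.End k A) :
    koszulTotalD (c • μ) = c • koszulTotalD μ := by
  refine tensorExterior_ext (by simp) fun v x h a => ?_
  simp only [koszulTotalD_ι_mul, h a, LinearMap.smul_apply, map_smul, smul_sub,
    TensorProduct.smul_tmul']

/-- Functoriality of the total Koszul differential. -/
theorem koszulTotalD_map (μ : L →ₗ[k] Module.End k A) (ν : L' →ₗ[k] Module.End k B)
    (π : A →ₗ[k] B) (p : L →ₗ[k] L') (h : ∀ v a, ν (p v) (π a) = π (μ v a))
    (y : A ⊗[k] ExteriorAlgebra k L) :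
    koszulTotalD ν (TensorProduct.map π (ExteriorAlgebra.map p).toLinearMap y) =
      TensorProduct.map π (ExteriorAlgebra.map p).toLinearMap (koszulTotalD μ y) := by
  rw [← LinearMap.comp_apply, ← LinearMap.comp_apply]
  congr 1
  have hw : ∀ v y, TensorProduct.map π (ExteriorAlgebra.map p).toLinearMap (wedge A v y) =
      wedge B (p v) (TensorProduct.map π (ExteriorAlgebra.map p).toLinearMap y) := by
    intro v y
    induction y with
    | zero => simp
    | add x y hx hy => simp only [map_add, hx, hy]
    | tmul a x => simp
  refine tensorExterior_ext (by simp) fun v x hx a => ?_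
  have := hx a
  simp only [LinearMap.comp_apply, TensorProduct.map_tmul, AlgHom.toLinearMap_apply, map_mul,
    ExteriorAlgebra.map_apply_ι, koszulTotalD_ι_mul, map_sub, hw] at this ⊢
  rw [this, h]

theorem koszulTotalD_rTensor (μ : L →ₗ[k] Module.End k A) (f : A →ₗ[k] B)
    (ν : L →ₗ[k] Module.End k B) (h : ∀ v a, ν v (f a) = f (μ v a))
    (y : A ⊗[k] ExteriorAlgebra k L) :
    koszulTotalD ν (LinearMap.rTensor _ f y) = LinearMap.rTensor _ f (koszulTotalD μ y) := by
  have := koszulTotalD_map μ ν f LinearMap.id (by simpa using h) y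
  rwa [ExteriorAlgebra.map_id] at this

theorem koszulTotalD_koszulTotalD (μ : L →ₗ[k] Module.End k A)
    (hμ : ∀ v w a, μ v (μ w a) = μ w (μ v a)) (y : A ⊗[k] ExteriorAlgebra k L) :
    koszulTotalD μ (koszulTotalD μ y) = 0 := by
  rw [← LinearMap.comp_apply]
  suffices koszulTotalD μ ∘ₗ koszulTotalD μ = 0 by rw [this]; rfl
  refine tensorExterior_ext (by simp) fun v x hx a => ?_
  have := hx a
  rw [LinearMap.zero_apply, LinearMap.comp_apply] at this ⊢
  rw [koszulTotalD_ι_mul, map_sub, koszulTotalD_wedge, this,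
    ← koszulTotalD_rTensor μ (μ v) μ (fun w a => hμ w v a), map_zero, sub_zero,
    LinearMap.rTensor_tmul, sub_self]

/-! #### Killing a regular element -/

/-- If `L = L' ⊕ k ℓ` and `ℓ` acts injectively on `A`, then the Koszul complex of `A` over `L` is
quasi-isomorphic to the Koszul complex of `A / ℓ A` over `L'`. -/
theorem koszulTotal_kill (μ : L →ₗ[k] Module.End k A) (ν : L' →ₗ[k] Module.End k B)
    (hμ : ∀ v w a, μ v (μ w a) = μ w (μ v a))
    (i : L' →ₗ[k] L) (p : L →ₗ[k] L') (ε : L →ₗ[k] k) (ℓ : L)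
    (hpi : p ∘ₗ i = LinearMap.id) (hpℓ : p ℓ = 0) (hεℓ : ε ℓ = 1) (hεi : ∀ v, ε (i v) = 0)
    (hdec : ∀ v, v = i (p v) + ε v • ℓ)
    (π : A →ₗ[k] B) (hπ : Function.Surjective π) (hinj : Function.Injective (μ ℓ))
    (hker : Function.Exact (μ ℓ) π) (h : ∀ v a, ν (p v) (π a) = π (μ v a)) :
    Function.Bijective (DiffHomology.map (d := koszulTotalD μ) (d' := koszulTotalD ν)
      (TensorProduct.map π (ExteriorAlgebra.map p).toLinearMap)
      (.of_comm (koszulTotalD_map μ ν π p h))) := by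
  set Φ := TensorProduct.map π (ExteriorAlgebra.map p).toLinearMap with hΦ
  let D' := koszulTotalD (μ ∘ₗ i)
  let I : A ⊗[k] ExteriorAlgebra k L' →ₗ[k] A ⊗[k] ExteriorAlgebra k L :=
    TensorProduct.map LinearMap.id (ExteriorAlgebra.map i).toLinearMap
  let m : Module.End k (A ⊗[k] ExteriorAlgebra k L') := LinearMap.rTensor _ (μ ℓ)
  let q : A ⊗[k] ExteriorAlgebra k L' →ₗ[k] B ⊗[k] ExteriorAlgebra k L' := LinearMap.rTensor _ π
  -- The maps r0 and r1 are the two components of the splitting ⋀L = ⋀L' ⊕ ℓ ∧ ⋀L'. Contraction with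
  -- ε extracts the coefficient of ℓ.
  let r0 : A ⊗[k] ExteriorAlgebra k L →ₗ[k] A ⊗[k] ExteriorAlgebra k L' :=
    TensorProduct.map LinearMap.id (ExteriorAlgebra.map p).toLinearMap
  let r1 : A ⊗[k] ExteriorAlgebra k L →ₗ[k] A ⊗[k] ExteriorAlgebra k L' :=
    TensorProduct.map LinearMap.id
      ((ExteriorAlgebra.map p).toLinearMap ∘ₗ CliffordAlgebra.contractLeft ε)
  have hmap : ∀ x, ExteriorAlgebra.map p (ExteriorAlgebra.map i x) = x := fun x => by
    rw [← AlgHom.comp_apply, ExteriorAlgebra.map_comp_map, hpi, ExteriorAlgebra.map_id]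
    rfl
  have hcontr : ∀ x : ExteriorAlgebra k L',
      CliffordAlgebra.contractLeft ε (ExteriorAlgebra.map i x) = 0 := by
    intro x
    induction x using CliffordAlgebra.left_induction with
    | algebraMap r =>
      rw [AlgHom.commutes]
      exact CliffordAlgebra.contractLeft_algebraMap (Q := (0 : QuadraticForm k L)) ε r
    | add x y hx hy => rw [map_add, map_add, hx, hy, add_zero]
    | ι_mul x v hx =>
      rw [map_mul, ExteriorAlgebra.map_apply_ι, CliffordAlgebra.contractLeft_ι_mul, hx, hεi,
        zero_smul, mul_zero, sub_zero]
  have hr0I : ∀ y, r0 (I y) = y := fun y => by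
    induction y with
    | zero => simp
    | add x y hx hy => rw [map_add, map_add, hx, hy]
    | tmul a x => simp [r0, I, hmap]
  have hr0w : ∀ y, r0 (wedge A ℓ y) = 0 := fun y => by
    induction y with
    | zero => simp
    | add x y hx hy => rw [map_add, map_add, hx, hy, add_zero]
    | tmul a x => simp [r0, hpℓ]
  have hr1I : ∀ y, r1 (I y) = 0 := fun y => by
    induction y with
    | zero => simp
    | add x y hx hy => rw [map_add, map_add, hx, hy, add_zero]
    | tmul a x => simp [r1, I, hcontr]
  have hr1w : ∀ y, r1 (wedge A ℓ (I y)) = y := fun y => by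
    induction y with
    | zero => simp
    | add x y hx hy => rw [map_add, map_add, map_add, hx, hy]
    | tmul a x =>
      simp only [r1, I, TensorProduct.map_tmul, wedge_tmul, LinearMap.comp_apply,
        AlgHom.toLinearMap_apply, LinearMap.id_apply]
      rw [CliffordAlgebra.contractLeft_ι_mul, hcontr, hεℓ, one_smul, mul_zero, sub_zero, hmap]
  have hdecomp : ∀ y, y = I (r0 y) + wedge A ℓ (I (r1 y)) := by
    suffices LinearMap.id = I ∘ₗ r0 + wedge A ℓ ∘ₗ I ∘ₗ r1 from fun y => LinearMap.congr_fun this y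
    refine tensorExterior_ext (fun a => ?_) fun v x hx a => ?_
    · simp [I, r0, r1]
    · have h1 := hx a
      simp only [LinearMap.id_apply, LinearMap.add_apply, LinearMap.comp_apply] at h1 ⊢
      have h2 : r0 (a ⊗ₜ (ι k v * x)) = wedge A (p v) (r0 (a ⊗ₜ x)) := by simp [r0]
      have h3 : r1 (a ⊗ₜ (ι k v * x)) = ε v • r0 (a ⊗ₜ x) - wedge A (p v) (r1 (a ⊗ₜ x)) := by
        simp only [r1, r0, TensorProduct.map_tmul, LinearMap.comp_apply, AlgHom.toLinearMap_apply,
          LinearMap.id_apply, wedge_tmul]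
        rw [CliffordAlgebra.contractLeft_ι_mul, map_sub, map_smul, map_mul,
          ExteriorAlgebra.map_apply_ι, TensorProduct.tmul_sub, TensorProduct.tmul_smul]
      have h4 : ∀ (v : L') (y : A ⊗[k] ExteriorAlgebra k L'),
          I (wedge A v y) = wedge A (i v) (I y) := by
        intro v y
        induction y with
        | zero => simp
        | add x y hx hy => simp only [map_add, hx, hy]
        | tmul a x => simp [I]
      have h5 : ∀ (v : L) (y : A ⊗[k] ExteriorAlgebra k L),
          wedge A ℓ (wedge A v y) = - wedge A v (wedge A ℓ y) := by
        intro v y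
        induction y with
        | zero => simp
        | add x y hx hy => simp only [map_add, hx, hy, neg_add]
        | tmul a x =>
          simp only [wedge_tmul, ← mul_assoc, ← TensorProduct.tmul_neg]
          rw [eq_neg_of_add_eq_zero_left (ExteriorAlgebra.ι_add_mul_swap ℓ v), neg_mul]
      have h6 : ∀ (y : A ⊗[k] ExteriorAlgebra k L),
          wedge A v y = wedge A (i (p v)) y + ε v • wedge A ℓ y := by
        intro y
        nth_rewrite 1 [hdec v]
        simp only [wedge, map_add, map_smul]
        have : LinearMap.mulLeft k (ι k (i (p v)) + ε v • ι k ℓ) =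
          LinearMap.mulLeft k (ι k (i (p v))) + ε v • LinearMap.mulLeft k (ι k ℓ) := by
          ext; simp [add_mul]
        rw [this]
        simp
      rw [h2, h3, h4, map_sub, map_sub, map_smul, map_smul, h4, h5, ← wedge_tmul, h6]
      generalize I (r0 (a ⊗ₜ x)) = y0 at h1 ⊢
      generalize I (r1 (a ⊗ₜ x)) = y1 at h1 ⊢
      rw [h1, map_add, map_add, wedge_wedge, add_zero, sub_neg_eq_add]
      abel
  have hDI : ∀ y, koszulTotalD μ (I y) = I (D' y) := fun y =>
    koszulTotalD_map (μ ∘ₗ i) μ LinearMap.id i (fun v a => rfl) y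
  have hmI : ∀ y, LinearMap.rTensor _ (μ ℓ) (I y) = I (m y) := fun y => by
    induction y with
    | zero => simp
    | add x y hx hy => simp only [map_add, hx, hy]
    | tmul a x => simp [I, m]
  -- Together with `hDI` this shows that the complex over L is the mapping cone of multiplication by
  -- ℓ on the complex over L'. The cone of an injective map computes the homology of its cokernel.
  have hDw : ∀ y, koszulTotalD μ (wedge A ℓ (I y)) = I (m y) - wedge A ℓ (I (D' y)) := fun y => by
    rw [koszulTotalD_wedge, hDI, hmI]
  have hDm : ∀ y, D' (m y) = m (D' y) := fun y =>
    koszulTotalD_rTensor (μ ∘ₗ i) (μ ℓ) (μ ∘ₗ i) (fun v a => hμ _ _ _) y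
  have hνi : ∀ v a, ν v (π a) = π (μ (i v) a) := fun v a => by
    rw [← h]
    exact congrArg (fun f => ν (f v) (π a)) hpi.symm
  have hDq : ∀ y, koszulTotalD ν (q y) = q (D' y) := fun y =>
    koszulTotalD_rTensor (μ ∘ₗ i) π ν hνi y
  have hΦr : ∀ y, Φ y = q (r0 y) := fun y => by
    induction y with
    | zero => simp
    | add x y hx hy => simp only [map_add, hx, hy]
    | tmul a x => simp [Φ, q, r0]
  have hm : Function.Injective m := Module.Flat.rTensor_preserves_injective_linearMap _ hinj
  have hq : Function.Surjective q := LinearMap.rTensor_surjective _ hπ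
  have hmq : Function.Exact m q := rTensor_exact _ hker hπ
  have hD'D' : ∀ y, D' (D' y) = 0 :=
    koszulTotalD_koszulTotalD (μ ∘ₗ i) fun v w a => hμ _ _ _
  constructor
  · rw [injective_iff_map_eq_zero]
    intro c hc
    obtain ⟨z, rfl⟩ := DiffHomology.mk_surjective _ c
    rw [DiffHomology.map_mk, DiffHomology.mk_eq_zero] at hc
    obtain ⟨u, hu⟩ := hc
    replace hu : koszulTotalD ν u = Φ z.1 := hu
    obtain ⟨w, rfl⟩ := hq u
    have h1 : q (r0 z.1 - D' w) = 0 := by rw [map_sub, ← hDq, hu, hΦr, sub_self]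
    obtain ⟨v1, hv1⟩ := (hmq _).1 h1
    rw [DiffHomology.mk_eq_zero]
    -- Here w lifts the bounding chain in the quotient and m v1 is the discrepancy r0 z - D' w.
    -- After the subtraction only a multiple of ℓ remains, and the cycle condition together with
    -- injectivity of m removes it.
    refine ⟨I w + wedge A ℓ (I v1), ?_⟩
    have hz : koszulTotalD μ z.1 = 0 := z.2
    have h2 : z.1 - koszulTotalD μ (I w + wedge A ℓ (I v1)) =
        wedge A ℓ (I (r1 z.1 + D' v1)) := by
      nth_rewrite 1 [hdecomp z.1]
      rw [map_add, hDI, hDw, hv1, map_sub, map_add, map_add]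
      abel
    have h3 : r1 z.1 + D' v1 = 0 := by
      apply hm
      have h4 := congrArg (koszulTotalD μ) h2
      rw [hDw, map_sub, hz, koszulTotalD_koszulTotalD μ hμ, sub_zero] at h4
      have h5 := congrArg r0 h4
      rw [map_sub, hr0w, hr0I, map_zero, sub_zero] at h5
      rw [← h5, map_zero]
    rw [h3, map_zero, map_zero, sub_eq_zero] at h2
    exact h2.symm
  · intro c
    obtain ⟨z, rfl⟩ := DiffHomology.mk_surjective _ c
    have hz : koszulTotalD ν z.1 = 0 := z.2
    obtain ⟨u, hu⟩ := hq z.1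
    have h1 : q (D' u) = 0 := by rw [← hDq, hu, hz]
    obtain ⟨u1, hu1⟩ := (hmq _).1 h1
    have h2 : D' u1 = 0 := hm (by rw [← hDm, hu1, hD'D', map_zero])
    have h3 : koszulTotalD μ (I u - wedge A ℓ (I u1)) = 0 := by
      rw [map_sub, hDI, hDw, hu1, h2, map_zero, map_zero, sub_zero, sub_self]
    refine ⟨DiffHomology.mk _ ⟨_, h3⟩, ?_⟩
    rw [DiffHomology.map_mk]
    congr 1
    refine Subtype.ext ?_
    change Φ (I u - wedge A ℓ (I u1)) = z.1
    rw [hΦr, map_sub, hr0w, hr0I, sub_zero, hu]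

end KoszulTotal

end

noncomputable section

section KoszulTotal

variable {k : Type*} [Field k] {L : Type*} [AddCommGroup L] [Module k L]
  {L' : Type*} [AddCommGroup L'] [Module k L']
  {A : Type*} [AddCommGroup A] [Module k A] {B : Type*} [AddCommGroup B] [Module k B]

open ExteriorAlgebra (ι)

/-! #### The Koszul complex of a polynomial ring -/

/-- The de Rham differential on `A ⊗ ⋀ L`, for operators `∂ j` on `A` and elements `b j` of `L`. -/
def deRham {J : Type*} [Fintype J] (b : J → L) (del : J → Module.End k A) :
    Module.End k (A ⊗[k] ExteriorAlgebra k L) :=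
  ∑ j, wedge A (b j) ∘ₗ LinearMap.rTensor _ (del j)

/-- The operator on `⋀ L` which multiplies the elements of degree `t` by `t`. -/
def exteriorNumber {J : Type*} [Fintype J] (b : J → L) (c : J → Module.Dual k L) :
    Module.End k (ExteriorAlgebra k L) :=
  ∑ j, LinearMap.mulLeft k (ι k (b j)) ∘ₗ CliffordAlgebra.contractLeft (c j)

theorem exteriorNumber_ι_mul {J : Type*} [Fintype J] {b : J → L} {c : J → Module.Dual k L}
    (hc : ∀ v, ∑ j, c j v • b j = v) (v : L) (x : ExteriorAlgebra k L) :
    exteriorNumber b c (ι k v * x) = ι k v * x + ι k v * exteriorNumber b c x := by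
  simp only [exteriorNumber, LinearMap.sum_apply, LinearMap.comp_apply, LinearMap.mulLeft_apply]
  have h : ∀ j, ι k (b j) * CliffordAlgebra.contractLeft (c j) (ι k v * x) =
      ι k (c j v • b j) * x +
        ι k v * (ι k (b j) * CliffordAlgebra.contractLeft (c j) x) := fun j => by
    rw [CliffordAlgebra.contractLeft_ι_mul, mul_sub, ← mul_assoc, ← mul_assoc,
      eq_neg_of_add_eq_zero_left (ExteriorAlgebra.ι_add_mul_swap (b j) v), neg_mul, sub_neg_eq_add,
      map_smul, smul_mul_assoc, mul_smul_comm]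
  rw [Finset.sum_congr rfl fun j _ => h j, Finset.sum_add_distrib, ← Finset.sum_mul, ← map_sum, hc,
    Finset.mul_sum]

theorem exteriorNumber_ιMulti {J : Type*} [Fintype J] {b : J → L} {c : J → Module.Dual k L}
    (hc : ∀ v, ∑ j, c j v • b j = v) (t : ℕ) (v : Fin t → L) :
    exteriorNumber b c (ExteriorAlgebra.ιMulti k t v) =
      (t : k) • ExteriorAlgebra.ιMulti k t v := by
  induction t with
  | zero => simp [exteriorNumber]
  | succ t ih =>
    rw [ExteriorAlgebra.ιMulti_succ_apply, exteriorNumber_ι_mul hc, ih, mul_smul_comm]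
    push_cast
    rw [add_smul, one_smul, add_comm]

/-- A Cartan formula: `hdel` says that ∂_j differentiates multiplication by v to the scalar c_j(v),
so ∂_j commutes with the Koszul differential up to contraction with c_j. Wedging with b_j and
summing gives the Euler operator on A plus the exterior degree. -/
theorem koszulTotalD_deRham {J : Type*} [Fintype J] (μ : L →ₗ[k] Module.End k A) (b : J → L)
    (c : J → Module.Dual k L) (del : J → Module.End k A)
    (hdel : ∀ j v a, del j (μ v a) = μ v (del j a) + c j v • a)
    (y : A ⊗[k] ExteriorAlgebra k L) :
    koszulTotalD μ (deRham b del y) + deRham b del (koszulTotalD μ y) =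
      LinearMap.rTensor _ (∑ j, μ (b j) ∘ₗ del j) y +
        LinearMap.lTensor _ (exteriorNumber b c) y := by
  have hcomm : ∀ j, LinearMap.rTensor _ (del j) ∘ₗ koszulTotalD μ =
      koszulTotalD μ ∘ₗ LinearMap.rTensor _ (del j) +
        LinearMap.lTensor A (CliffordAlgebra.contractLeft (c j)) := by
    intro j
    have hwr : ∀ (v : L) (y : A ⊗[k] ExteriorAlgebra k L),
        LinearMap.rTensor _ (del j) (wedge A v y) =
        wedge A v (LinearMap.rTensor _ (del j) y) := by
      intro v y
      induction y with
      | zero => simp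
      | add x y hx hy => simp only [map_add, hx, hy]
      | tmul a x => simp
    refine tensorExterior_ext (fun a => ?_) fun v x hx a => ?_
    · simp [CliffordAlgebra.contractLeft_one]
    · have h1 := hx a
      simp only [LinearMap.comp_apply, LinearMap.add_apply, LinearMap.rTensor_tmul,
        LinearMap.lTensor_tmul] at h1 ⊢
      rw [koszulTotalD_ι_mul, koszulTotalD_ι_mul, map_sub, hwr, h1, LinearMap.rTensor_tmul, hdel,
        CliffordAlgebra.contractLeft_ι_mul, map_add, wedge_tmul, TensorProduct.add_tmul,
        TensorProduct.tmul_sub, TensorProduct.smul_tmul]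
      abel
  have hcomm' : ∀ j, LinearMap.rTensor _ (del j) (koszulTotalD μ y) =
      koszulTotalD μ (LinearMap.rTensor _ (del j) y) +
        LinearMap.lTensor A (CliffordAlgebra.contractLeft (c j)) y :=
    fun j => LinearMap.congr_fun (hcomm j) y
  have hr : LinearMap.rTensor (ExteriorAlgebra k L) (∑ j, μ (b j) ∘ₗ del j) =
      ∑ j, LinearMap.rTensor _ (μ (b j)) ∘ₗ LinearMap.rTensor _ (del j) := by
    refine TensorProduct.ext' fun a x => ?_
    simp [TensorProduct.sum_tmul]
  have hl : LinearMap.lTensor A (exteriorNumber b c) =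
      ∑ j, wedge A (b j) ∘ₗ LinearMap.lTensor A (CliffordAlgebra.contractLeft (c j)) := by
    refine TensorProduct.ext' fun a x => ?_
    simp [TensorProduct.tmul_sum, exteriorNumber]
  simp only [deRham, LinearMap.sum_apply, LinearMap.comp_apply, map_sum, hr, hl, hcomm',
    koszulTotalD_wedge, map_add, Finset.sum_add_distrib, Finset.sum_sub_distrib]
  abel

/-- The Koszul complex of a polynomial ring is a resolution of the base field. -/
theorem koszulTotal_acyclic [CharZero k] {J : Type*} [Fintype J] (μ : L →ₗ[k] Module.End k A)
    (hμ : ∀ v w a, μ v (μ w a) = μ w (μ v a)) (b : J → L)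
    (c : J → Module.Dual k L) (del : J → Module.End k A)
    (hdel : ∀ j v a, del j (μ v a) = μ v (del j a) + c j v • a)
    (hc : ∀ v, ∑ j, c j v • b j = v) (𝒜 : ℕ → Submodule k A) (h𝒜 : ⨆ s, 𝒜 s = ⊤)
    (hEuler : ∀ s, ∀ a ∈ 𝒜 s, ∑ j, μ (b j) (del j a) = (s : k) • a) (a₀ : A)
    (h0 : 𝒜 0 ≤ Submodule.span k {a₀}) (hdel0 : ∀ j, del j a₀ = 0)
    (y : A ⊗[k] ExteriorAlgebra k L) (hy : koszulTotalD μ y = 0) :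
    ∃ (r : k) (u : A ⊗[k] ExteriorAlgebra k L), y = r • a₀ ⊗ₜ 1 + koszulTotalD μ u := by
  classical
  set D := koszulTotalD μ with hD
  set e := deRham b del with he
  -- M acts on the piece of bidegree (s, t) as s + t, which in characteristic zero is invertible
  -- away from (0, 0). Hence every element is a multiple of a₀ ⊗ 1 plus a value of M.
  let M : Module.End k (A ⊗[k] ExteriorAlgebra k L) := D ∘ₗ e + e ∘ₗ D
  have hM : ∀ y, M y = D (e y) + e (D y) := fun y => rfl
  have hMhom : ∀ s t, ∀ a ∈ 𝒜 s, ∀ v : Fin t → L, M (a ⊗ₜ ExteriorAlgebra.ιMulti k t v) =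
      ((s + t : ℕ) : k) • a ⊗ₜ ExteriorAlgebra.ιMulti k t v := by
    intro s t a ha v
    rw [hM, koszulTotalD_deRham μ b c del hdel, LinearMap.rTensor_tmul, LinearMap.lTensor_tmul,
      exteriorNumber_ιMulti hc]
    simp only [LinearMap.sum_apply, LinearMap.comp_apply]
    rw [hEuler s a ha, TensorProduct.tmul_smul, ← TensorProduct.smul_tmul', ← add_smul]
    push_cast
    rfl
  let G : ℕ → Submodule k (A ⊗[k] ExteriorAlgebra k L) := fun n =>
    Submodule.span k {y | ∃ s t, s + t = n ∧ ∃ a ∈ 𝒜 s, ∃ v : Fin t → L,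
      y = a ⊗ₜ ExteriorAlgebra.ιMulti k t v}
  have hGM : ∀ n, G n ≤ M.eigenspace (n : k) := by
    intro n
    refine Submodule.span_le.2 ?_
    rintro _ ⟨s, t, rfl, a, ha, v, rfl⟩
    exact Module.End.mem_eigenspace_iff.2 (hMhom s t a ha v)
  have hGtop : ⨆ n, G n = ⊤ := by
    rw [eq_top_iff, ← TensorProduct.map₂_mk_top_top_eq_top, ← h𝒜, ← ExteriorAlgebra.ιMulti_span,
      Submodule.map₂_iSup_left, iSup_le_iff]
    intro s
    rw [Submodule.map₂_le]
    intro a ha x hx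
    induction hx using Submodule.span_induction with
    | zero => simp
    | add x y _ _ hx hy => rw [map_add]; exact Submodule.add_mem _ hx hy
    | smul r x _ hx => rw [map_smul]; exact Submodule.smul_mem _ _ hx
    | mem x hx =>
      obtain ⟨⟨t, v⟩, rfl⟩ := hx
      exact Submodule.mem_iSup_of_mem (s + t) (Submodule.subset_span ⟨s, t, rfl, a, ha, v, rfl⟩)
  have hG0 : M.eigenspace ((0 : ℕ) : k) ≤ Submodule.span k {a₀ ⊗ₜ 1} := by
    rw [← eq_eigenspace_of_le (fun m n h => Nat.cast_injective h) hGM hGtop 0]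
    refine Submodule.span_le.2 ?_
    rintro _ ⟨s, t, hst, a, ha, v, rfl⟩
    obtain ⟨rfl, rfl⟩ : s = 0 ∧ t = 0 := by omega
    obtain ⟨r, rfl⟩ := Submodule.mem_span_singleton.1 (h0 ha)
    rw [ExteriorAlgebra.ιMulti_zero_apply, ← TensorProduct.smul_tmul']
    exact Submodule.smul_mem _ _ (Submodule.mem_span_singleton_self _)
  have hsplit : ∀ y, ∃ (r : k) (w : A ⊗[k] ExteriorAlgebra k L), y = r • (a₀ ⊗ₜ 1) + M w := by
    intro y
    have hy : y ∈ ⨆ n, G n := hGtop ▸ Submodule.mem_top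
    induction hy using Submodule.iSup_induction' with
    | zero => exact ⟨0, 0, by simp⟩
    | add y z _ _ hy hz =>
      obtain ⟨r, w, h⟩ := hy
      obtain ⟨r', w', h'⟩ := hz
      refine ⟨r + r', w + w', ?_⟩
      nth_rewrite 1 [h, h']
      rw [add_smul, map_add]
      abel
    | mem n y hy =>
      have hy' := hGM n hy
      rcases Nat.eq_zero_or_pos n with rfl | hn
      · obtain ⟨r, hr⟩ := Submodule.mem_span_singleton.1 (hG0 hy')
        exact ⟨r, 0, by rw [hr, map_zero, add_zero]⟩
      · refine ⟨0, (n : k)⁻¹ • y, ?_⟩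
        rw [zero_smul, zero_add, map_smul, Module.End.mem_eigenspace_iff.1 hy', smul_smul,
          inv_mul_cancel₀ (Nat.cast_ne_zero.2 hn.ne'), one_smul]
  have hDD : ∀ y, D (D y) = 0 := koszulTotalD_koszulTotalD μ hμ
  obtain ⟨r, w, hw⟩ := hsplit y
  -- Since y is a cycle, M kills D w, so D w has total degree zero and is a multiple of a₀ ⊗ 1. The
  -- derivations kill a₀, hence e (D w) = 0 and M w reduces to the boundary D (e w).
  have h1 : D (e (D w)) = 0 := by
    have := congrArg D hw
    rwa [hy, map_add, map_smul, koszulTotalD_one, smul_zero, zero_add, hM, map_add, hDD, zero_add,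
      eq_comm] at this
  have h2 : M (D w) = 0 := by rw [hM, hDD, map_zero, add_zero, h1]
  obtain ⟨r', hr'⟩ := Submodule.mem_span_singleton.1
    (hG0 (Module.End.mem_eigenspace_iff.2 (h2.trans (by simp))))
  have h3 : e (D w) = 0 := by
    rw [← hr', map_smul]
    simp [he, deRham, hdel0]
  exact ⟨r, e w, by rw [hw, hM, h3, add_zero]⟩

/-! #### Scaling and signs -/

/-- The operator on `⋀ L` which multiplies the elements of degree `t` by `bᵗ`. -/
def exteriorScale (L : Type*) [AddCommGroup L] [Module k L] (b : k) :
    Module.End k (ExteriorAlgebra k L) :=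
  (ExteriorAlgebra.map (b • LinearMap.id)).toLinearMap

theorem exteriorScale_one (b : k) : exteriorScale L b 1 = 1 :=
  map_one (ExteriorAlgebra.map (b • (LinearMap.id : L →ₗ[k] L)))

theorem exteriorScale_ι_mul (b : k) (v : L) (x : ExteriorAlgebra k L) :
    exteriorScale L b (ι k v * x) = b • (ι k v * exteriorScale L b x) := by
  simp [exteriorScale]

theorem exteriorScale_of_mem (b : k) {t : ℕ} {x : ExteriorAlgebra k L} (hx : x ∈ ⋀[k]^t L) :
    exteriorScale L b x = b ^ t • x := by
  rw [← ExteriorAlgebra.ιMulti_span_fixedDegree] at hx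
  induction hx using Submodule.span_induction with
  | zero => simp
  | add x y _ _ hx hy => rw [map_add, hx, hy, smul_add]
  | smul r x _ hx => rw [map_smul, hx, smul_comm]
  | mem x hx =>
    obtain ⟨v, rfl⟩ := hx
    rw [exteriorScale, AlgHom.toLinearMap_apply, ExteriorAlgebra.map_apply_ιMulti]
    have : (⇑(b • (LinearMap.id : L →ₗ[k] L)) ∘ v) = fun i => b • v i := rfl
    rw [this]
    simpa using (ExteriorAlgebra.ιMulti k t (M := L)).map_smul_univ (fun _ => b) v

/-- The differential removes one exterior factor, costing b⁻¹, and multiplies by one linear form,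
contributing c. Formally this is functoriality for v ↦ b v with the action rescaled by b⁻¹c. -/
theorem koszulTotalD_scale (μ : L →ₗ[k] Module.End k A) (γ : Module.End k A) (b c : k)
    (hb : b ≠ 0) (h : ∀ v a, γ (μ v a) = c • μ v (γ a)) (y : A ⊗[k] ExteriorAlgebra k L) :
    TensorProduct.map γ (exteriorScale L b) (koszulTotalD μ y) =
      (b⁻¹ * c) • koszulTotalD μ (TensorProduct.map γ (exteriorScale L b) y) := by
  have h1 := koszulTotalD_map μ ((b⁻¹ * c) • μ) γ (b • LinearMap.id) (fun v a => by
    rw [h, LinearMap.smul_apply, LinearMap.smul_apply, LinearMap.smul_apply, LinearMap.id_apply,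
      map_smul, LinearMap.smul_apply, smul_smul, mul_comm, mul_inv_cancel_left₀ hb]) y
  rw [koszulTotalD_smul] at h1
  exact h1.symm

/-- The operator on `A ⊗ ⋀ L` which gives the sign of the degree. -/
def koszulSign (A L : Type*) [AddCommGroup A] [Module k A] [AddCommGroup L] [Module k L] :
    Module.End k (A ⊗[k] ExteriorAlgebra k L) :=
  TensorProduct.map LinearMap.id (exteriorScale L (-1))

theorem exteriorScale_neg_one (x : ExteriorAlgebra k L) :
    exteriorScale L (-1 : k) (exteriorScale L (-1 : k) x) = x := by
  simp only [exteriorScale, AlgHom.toLinearMap_apply]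
  rw [← AlgHom.comp_apply, ExteriorAlgebra.map_comp_map]
  have : ((-1 : k) • (LinearMap.id : L →ₗ[k] L)) ∘ₗ ((-1 : k) • LinearMap.id) = LinearMap.id := by
    ext; simp
  rw [this, ExteriorAlgebra.map_id]
  rfl

theorem koszulSign_koszulSign (y : A ⊗[k] ExteriorAlgebra k L) :
    koszulSign A L (koszulSign A L y) = y := by
  induction y with
  | zero => simp
  | add x y hx hy => rw [map_add, map_add, hx, hy]
  | tmul a x => simp [koszulSign, exteriorScale_neg_one]

theorem koszulTotalD_koszulSign (μ : L →ₗ[k] Module.End k A) (y : A ⊗[k] ExteriorAlgebra k L) :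
    koszulTotalD μ (koszulSign A L y) = - koszulSign A L (koszulTotalD μ y) := by
  have := koszulTotalD_scale μ LinearMap.id (-1) 1 (by simp) (by simp) y
  rw [koszulSign, this]
  simp

/-! #### The Koszul complex of a tensor product -/

/-- The multiplication `⋀ L ⊗ ⋀ L' → ⋀ (L × L')`. -/
def exteriorProd (L L' : Type*) [AddCommGroup L] [Module k L] [AddCommGroup L'] [Module k L'] :
    ExteriorAlgebra k L ⊗[k] ExteriorAlgebra k L' →ₗ[k] ExteriorAlgebra k (L × L') :=
  LinearMap.mul' k _ ∘ₗ TensorProduct.map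
    (ExteriorAlgebra.map (LinearMap.inl k L L')).toLinearMap
    (ExteriorAlgebra.map (LinearMap.inr k L L')).toLinearMap

theorem exteriorProd_tmul (x : ExteriorAlgebra k L) (y : ExteriorAlgebra k L') :
    exteriorProd L L' (x ⊗ₜ y) = ExteriorAlgebra.map (LinearMap.inl k L L') x *
      ExteriorAlgebra.map (LinearMap.inr k L L') y := rfl

theorem exteriorProd_ι_mul_left (v : L) (x : ExteriorAlgebra k L) (y : ExteriorAlgebra k L') :
    exteriorProd L L' ((ι k v * x) ⊗ₜ y) = ι k (v, (0 : L')) * exteriorProd L L' (x ⊗ₜ y) := by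
  simp [exteriorProd_tmul, mul_assoc]

/-- Moving w leftwards past x costs the sign of the degree of x; the scaling by -1 records it
without a grading. -/
theorem exteriorProd_ι_mul_right (w : L') (x : ExteriorAlgebra k L) (y : ExteriorAlgebra k L') :
    exteriorProd L L' (exteriorScale L (-1 : k) x ⊗ₜ (ι k w * y)) =
      ι k ((0 : L), w) * exteriorProd L L' (x ⊗ₜ y) := by
  have h : ∀ x : ExteriorAlgebra k L, ExteriorAlgebra.map (LinearMap.inl k L L')
      (exteriorScale L (-1 : k) x) * ι k ((0 : L), w) = ι k ((0 : L), w) *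
      ExteriorAlgebra.map (LinearMap.inl k L L') x := by
    intro x
    induction x using CliffordAlgebra.left_induction with
    | algebraMap r =>
      rw [exteriorScale, AlgHom.toLinearMap_apply, AlgHom.commutes, AlgHom.commutes,
        Algebra.commutes]
    | add x y hx hy => simp only [map_add, add_mul, mul_add, hx, hy]
    | ι_mul x v hx =>
      rw [exteriorScale_ι_mul, map_smul, map_mul, map_mul, ExteriorAlgebra.map_apply_ι,
        smul_mul_assoc, mul_assoc, hx, ← mul_assoc, ← mul_assoc, neg_one_smul, ← neg_mul]
      congr 1
      rw [neg_eq_iff_add_eq_zero]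
      exact ExteriorAlgebra.ι_add_mul_swap _ _
  simp only [exteriorProd_tmul, map_mul, ExteriorAlgebra.map_apply_ι, LinearMap.inr_apply]
  rw [← mul_assoc, h, mul_assoc]

/-- Let (v, w) act on ⋀L ⊗ ⋀L' by (v ∧) ⊗ 1 + sign ⊗ (w ∧). These operators square to zero, so ⋀(L ×
L') acts, and its action on 1 ⊗ 1 is the inverse map. -/
theorem exteriorProd_bijective : Function.Bijective (exteriorProd (k := k) L L') := by
  let T : (L × L') →ₗ[k] Module.End k (ExteriorAlgebra k L ⊗[k] ExteriorAlgebra k L') :=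
    { toFun := fun v => TensorProduct.map (LinearMap.mulLeft k (ι k v.1)) LinearMap.id +
        TensorProduct.map (exteriorScale L (-1 : k)) (LinearMap.mulLeft k (ι k v.2))
      map_add' := fun v w => by
        refine TensorProduct.ext' fun x y => ?_
        simp only [Prod.fst_add, Prod.snd_add, map_add, LinearMap.add_apply,
          TensorProduct.map_tmul, LinearMap.mulLeft_apply, add_mul, TensorProduct.add_tmul,
          TensorProduct.tmul_add, LinearMap.id_apply]
        abel
      map_smul' := fun c v => by
        refine TensorProduct.ext' fun x y => ?_
        simp [TensorProduct.smul_tmul'] }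
  have hT : ∀ v x y, T v (x ⊗ₜ y) =
      (ι k v.1 * x) ⊗ₜ y + exteriorScale L (-1 : k) x ⊗ₜ (ι k v.2 * y) := fun v x y => rfl
  have hTT : ∀ v, T v * T v = 0 := fun v => by
    refine TensorProduct.ext' fun x y => ?_
    rw [Module.End.mul_apply, hT, map_add, hT, hT, exteriorScale_ι_mul, exteriorScale_neg_one,
      ← mul_assoc, ← mul_assoc, ExteriorAlgebra.ι_sq_zero, ExteriorAlgebra.ι_sq_zero]
    simp [TensorProduct.neg_tmul]
  let ρ := ExteriorAlgebra.lift k ⟨T, hTT⟩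
  have hρ : ∀ v, ρ (ι k v) = T v := fun v => ExteriorAlgebra.lift_ι_apply k T hTT v
  let ev : ExteriorAlgebra k (L × L') →ₗ[k] ExteriorAlgebra k L ⊗[k] ExteriorAlgebra k L' :=
    LinearMap.applyₗ (1 ⊗ₜ 1) ∘ₗ ρ.toLinearMap
  have hev : ∀ x, ev x = ρ x (1 ⊗ₜ 1) := fun x => rfl
  have h1 : ∀ x z, ρ (ExteriorAlgebra.map (LinearMap.inl k L L') x) (1 ⊗ₜ z) = x ⊗ₜ z := by
    intro x z
    induction x using CliffordAlgebra.left_induction with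
    | algebraMap r =>
      rw [AlgHom.commutes, AlgHom.commutes, Module.algebraMap_end_apply,
        Algebra.algebraMap_eq_smul_one, TensorProduct.smul_tmul']
    | add x y hx hy => rw [map_add, map_add, LinearMap.add_apply, hx, hy, TensorProduct.add_tmul]
    | ι_mul x v hx =>
      rw [map_mul, map_mul, ExteriorAlgebra.map_apply_ι, Module.End.mul_apply, hx, hρ, hT]
      simp
  have h2 : ∀ y, ρ (ExteriorAlgebra.map (LinearMap.inr k L L') y) (1 ⊗ₜ 1) = 1 ⊗ₜ y := by
    intro y
    induction y using CliffordAlgebra.left_induction with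
    | algebraMap r =>
      rw [AlgHom.commutes, AlgHom.commutes, Module.algebraMap_end_apply,
        Algebra.algebraMap_eq_smul_one, TensorProduct.tmul_smul]
    | add x y hx hy => rw [map_add, map_add, LinearMap.add_apply, hx, hy, TensorProduct.tmul_add]
    | ι_mul x v hx =>
      rw [map_mul, map_mul, ExteriorAlgebra.map_apply_ι, Module.End.mul_apply, hx, hρ, hT]
      simp [exteriorScale_one]
  have hl : ∀ z, ev (exteriorProd L L' z) = z := by
    intro z
    induction z with
    | zero => simp
    | add x y hx hy => rw [map_add, map_add, hx, hy]
    | tmul x y => rw [hev, exteriorProd_tmul, map_mul, Module.End.mul_apply, h2, h1]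
  have hr : exteriorProd L L' ∘ₗ ev = LinearMap.id := by
    refine ExteriorAlgebra.linearMap_ext ?_ fun v x hx => ?_
    · rw [LinearMap.comp_apply, hev, map_one, Module.End.one_apply, exteriorProd_tmul]
      simp
    · have hTm : ∀ u, exteriorProd L L' (T v u) = ι k v * exteriorProd L L' u := by
        intro u
        induction u with
        | zero => simp
        | add x y hx hy => simp only [map_add, hx, hy, mul_add]
        | tmul x y =>
          rw [hT, map_add, exteriorProd_ι_mul_left, exteriorProd_ι_mul_right, ← add_mul, ← map_add,
            Prod.mk_add_mk, add_zero, zero_add]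
      rw [LinearMap.comp_apply, hev, map_mul, Module.End.mul_apply, hρ, hTm, ← hev,
        ← LinearMap.comp_apply, hx]
      rfl
  exact ⟨Function.LeftInverse.injective hl, fun z => ⟨ev z, LinearMap.congr_fun hr z⟩⟩

/-- The action of `L × L'` on a tensor product. -/
def prodAction (μ : L →ₗ[k] Module.End k A) (ν : L' →ₗ[k] Module.End k B) :
    L × L' →ₗ[k] Module.End k (A ⊗[k] B) :=
  LinearMap.coprod (LinearMap.rTensorHom B ∘ₗ μ) (LinearMap.lTensorHom A ∘ₗ ν)

@[simp]
theorem prodAction_tmul (μ : L →ₗ[k] Module.End k A) (ν : L' →ₗ[k] Module.End k B)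
    (v : L × L') (a : A) (b : B) :
    prodAction μ ν v (a ⊗ₜ b) = μ v.1 a ⊗ₜ b + a ⊗ₜ ν v.2 b := by
  simp [prodAction]

/-- The comparison of the tensor product of two Koszul complexes with a Koszul complex. -/
def koszulProd (A B L L' : Type*) [AddCommGroup A] [Module k A] [AddCommGroup B] [Module k B]
    [AddCommGroup L] [Module k L] [AddCommGroup L'] [Module k L'] :
    (A ⊗[k] ExteriorAlgebra k L) ⊗[k] (B ⊗[k] ExteriorAlgebra k L') ≃ₗ[k]
      (A ⊗[k] B) ⊗[k] ExteriorAlgebra k (L × L') :=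
  TensorProduct.tensorTensorTensorComm k A (ExteriorAlgebra k L) B (ExteriorAlgebra k L') ≪≫ₗ
    TensorProduct.congr (.refl k _) (.ofBijective _ exteriorProd_bijective)

theorem koszulProd_tmul (a : A) (x : ExteriorAlgebra k L) (b : B) (y : ExteriorAlgebra k L') :
    koszulProd A B L L' ((a ⊗ₜ x) ⊗ₜ (b ⊗ₜ y)) = (a ⊗ₜ b) ⊗ₜ exteriorProd L L' (x ⊗ₜ y) := rfl

set_option maxHeartbeats 800000 in
-- Both sides obey the same recursion when a vector is wedged onto the first exterior factor, which
-- reduces to a first factor a ⊗ 1; there the same argument runs over the second factor.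
theorem koszulTotalD_koszulProd (μ : L →ₗ[k] Module.End k A) (ν : L' →ₗ[k] Module.End k B)
    (y : (A ⊗[k] ExteriorAlgebra k L) ⊗[k] (B ⊗[k] ExteriorAlgebra k L')) :
    koszulTotalD (prodAction μ ν) (koszulProd A B L L' y) =
      koszulProd A B L L'
        (DiffHomology.tensorD (koszulTotalD μ) (koszulSign A L) (koszulTotalD ν) y) := by
  have hw1 : ∀ (v : L) (y : A ⊗[k] ExteriorAlgebra k L) (z : B ⊗[k] ExteriorAlgebra k L'),
      koszulProd A B L L' (wedge A v y ⊗ₜ[k] z) =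
      wedge (A ⊗[k] B) (v, (0 : L')) (koszulProd A B L L' (y ⊗ₜ z)) := by
    intro v y z
    induction y with
    | zero => simp
    | add x y hx hy => simp only [map_add, TensorProduct.add_tmul, hx, hy]
    | tmul a x =>
      induction z with
      | zero => simp
      | add x y hx hy => simp only [map_add, TensorProduct.tmul_add, hx, hy]
      | tmul b z =>
        rw [wedge_tmul, koszulProd_tmul, koszulProd_tmul, wedge_tmul, exteriorProd_ι_mul_left]
  have hw2 : ∀ (w : L') (a : A) (z : B ⊗[k] ExteriorAlgebra k L'),
      koszulProd A B L L' ((a ⊗ₜ[k] 1) ⊗ₜ[k] wedge B w z) =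
      wedge (A ⊗[k] B) ((0 : L), w) (koszulProd A B L L' ((a ⊗ₜ[k] 1) ⊗ₜ[k] z)) := by
    intro w a z
    induction z with
    | zero => simp
    | add x y hx hy => simp only [map_add, TensorProduct.tmul_add, hx, hy]
    | tmul b z =>
      rw [wedge_tmul, koszulProd_tmul, koszulProd_tmul, wedge_tmul, ← exteriorProd_ι_mul_right,
        exteriorScale_one]
  have hr1 : ∀ (v : L) (a : A) (x : ExteriorAlgebra k L) (z : B ⊗[k] ExteriorAlgebra k L'),
      LinearMap.rTensor _ (prodAction μ ν (v, 0))
      (koszulProd A B L L' ((a ⊗ₜ[k] x) ⊗ₜ[k] z)) =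
      koszulProd A B L L' ((μ v a ⊗ₜ[k] x) ⊗ₜ[k] z) := by
    intro v a x z
    induction z with
    | zero => simp
    | add x y hx hy => simp only [map_add, TensorProduct.tmul_add, hx, hy]
    | tmul b z => simp [koszulProd_tmul]
  set D := koszulTotalD (prodAction μ ν) with hD
  set Θ := koszulProd (k := k) A B L L' with hΘ
  let F : A ⊗[k] ExteriorAlgebra k L →ₗ[k] B ⊗[k] ExteriorAlgebra k L' →ₗ[k]
      (A ⊗[k] B) ⊗[k] ExteriorAlgebra k (L × L') := TensorProduct.curry (D ∘ₗ Θ.toLinearMap)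
  let G : A ⊗[k] ExteriorAlgebra k L →ₗ[k] B ⊗[k] ExteriorAlgebra k L' →ₗ[k]
      (A ⊗[k] B) ⊗[k] ExteriorAlgebra k (L × L') := TensorProduct.curry (Θ.toLinearMap ∘ₗ
      DiffHomology.tensorD (koszulTotalD μ) (koszulSign A L) (koszulTotalD ν))
  have hF : ∀ y z, F y z = D (Θ (y ⊗ₜ z)) := fun y z => rfl
  have hG : ∀ y z, G y z =
      Θ (koszulTotalD μ y ⊗ₜ z) + Θ (koszulSign A L y ⊗ₜ koszulTotalD ν z) := fun y z => by
    rw [← map_add]; rfl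
  have key : F = G := by
    refine tensorExterior_ext (fun a => ?_) fun v x hx a => ?_
    · refine tensorExterior_ext (fun b => ?_) fun w z hz b => ?_
      · rw [hF, hG, koszulTotalD_one, koszulTotalD_one, TensorProduct.zero_tmul,
          TensorProduct.tmul_zero, map_zero, add_zero, hΘ, koszulProd_tmul, exteriorProd_tmul,
          map_one, map_one, mul_one, koszulTotalD_one]
      · have h1 := hz b
        have hs : koszulSign A L (a ⊗ₜ 1) = a ⊗ₜ[k] 1 := by
          simp [koszulSign, exteriorScale_one]
        rw [hF, hG, koszulTotalD_one, TensorProduct.zero_tmul, map_zero, zero_add, hs] at h1 ⊢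
        rw [← wedge_tmul, hw2, koszulTotalD_wedge, h1, koszulTotalD_wedge, TensorProduct.tmul_sub,
          map_sub, hw2]
        congr 1
        rw [hΘ, LinearMap.rTensor_tmul, koszulProd_tmul, koszulProd_tmul, LinearMap.rTensor_tmul]
        simp
    · refine LinearMap.ext fun z => ?_
      have h1 := LinearMap.congr_fun (hx a) z
      have hs : koszulSign A L (wedge A v (a ⊗ₜ x)) = - wedge A v (koszulSign A L (a ⊗ₜ[k] x)) := by
        simp [koszulSign, exteriorScale_ι_mul, TensorProduct.tmul_neg]
      rw [hF, hG] at h1 ⊢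
      rw [← wedge_tmul, hw1, koszulTotalD_wedge, h1, koszulTotalD_wedge, hs, TensorProduct.sub_tmul,
        TensorProduct.neg_tmul, map_sub, map_neg, hw1, hw1, hr1, map_add, LinearMap.rTensor_tmul]
      abel
  have h : D ∘ₗ Θ.toLinearMap = Θ.toLinearMap ∘ₗ
      DiffHomology.tensorD (koszulTotalD μ) (koszulSign A L) (koszulTotalD ν) :=
    TensorProduct.ext' fun y z => LinearMap.congr_fun (LinearMap.congr_fun key y) z
  exact LinearMap.congr_fun h y

end KoszulTotal

end

noncomputable section

/-! ### Comparison of the Koszul complex with the total Koszul complex -/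

section Comparison

variable {k : Type*} [Field k] {L : Type*} [AddCommGroup L] [Module k L]
  {A : Type*} [AddCommGroup A] [Module k A]

open ExteriorAlgebra (ι)

theorem koszulTotalD_ιMulti (μ : L →ₗ[k] Module.End k A) (t : ℕ) (a : A) (ℓ : Fin (t + 1) → L) :
    koszulTotalD μ (a ⊗ₜ ExteriorAlgebra.ιMulti k (t + 1) ℓ) = ∑ i : Fin (t + 1),
      (-1) ^ (i : ℕ) • (μ (ℓ i) a ⊗ₜ[k] ExteriorAlgebra.ιMulti k t (i.removeNth ℓ)) := by
  induction t with
  | zero =>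
    rw [ExteriorAlgebra.ιMulti_succ_apply, koszulTotalD_ι_mul, ExteriorAlgebra.ιMulti_zero_apply,
      koszulTotalD_one]
    simp
  | succ t ih =>
    rw [ExteriorAlgebra.ιMulti_succ_apply, koszulTotalD_ι_mul, ih, Fin.sum_univ_succ (n := t + 1),
      map_sum, sub_eq_add_neg, ← Finset.sum_neg_distrib]
    congr 1
    · simp [Matrix.vecTail, Function.comp_def]
      rfl
    · refine Finset.sum_congr rfl fun i _ => ?_
      rw [map_zsmul, wedge_tmul, Fin.val_succ, pow_succ, mul_neg_one, neg_smul]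
      have h : (ι k) (ℓ 0) * (ExteriorAlgebra.ιMulti k t) (i.removeNth (Matrix.vecTail ℓ)) =
          ExteriorAlgebra.ιMulti k (t + 1) (i.succ.removeNth ℓ) := by
        rw [ExteriorAlgebra.ιMulti_succ_apply]
        congr 2
        ext j
        simp [Fin.removeNth, Matrix.vecTail]
      rw [h]
      rfl

/-- The inclusion of the Koszul chains into the total Koszul complex. -/
def koszulIncl (A L : Type*) [AddCommGroup A] [Module k A] [AddCommGroup L] [Module k L] (t : ℕ) :
    A ⊗[k] (⋀[k]^t L) →ₗ[k] A ⊗[k] ExteriorAlgebra k L :=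
  LinearMap.lTensor A (⋀[k]^t L).subtype

theorem koszulIncl_injective (t : ℕ) : Function.Injective (koszulIncl (k := k) A L t) :=
  Module.Flat.lTensor_preserves_injective_linearMap _ Subtype.val_injective

theorem koszulTotalD_koszulIncl (μ : L →ₗ[k] Module.End k A) (t : ℕ)
    (y : A ⊗[k] (⋀[k]^(t + 1) L)) :
    koszulTotalD μ (koszulIncl A L (t + 1) y) = koszulIncl A L t (koszulD μ t y) := by
  have h : (TensorProduct.curry (koszulTotalD μ ∘ₗ koszulIncl A L (t + 1))).flip =
      (TensorProduct.curry (koszulIncl A L t ∘ₗ koszulD μ t)).flip := by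
    refine exteriorPower.linearMap_ext ?_
    ext ℓ a
    change koszulTotalD μ (koszulIncl A L (t + 1) (a ⊗ₜ exteriorPower.ιMulti k (t + 1) ℓ)) =
      koszulIncl A L t (koszulD μ t (a ⊗ₜ exteriorPower.ιMulti k (t + 1) ℓ))
    rw [koszulD_tmul, map_sum]
    refine (koszulTotalD_ιMulti μ t a ℓ).trans (Finset.sum_congr rfl fun i _ => ?_)
    rw [map_zsmul]
    rfl
  have h' : koszulTotalD μ ∘ₗ koszulIncl A L (t + 1) = koszulIncl A L t ∘ₗ koszulD μ t :=
    TensorProduct.ext' fun a x => LinearMap.congr_fun (LinearMap.congr_fun h x) a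
  exact LinearMap.congr_fun h' y

theorem koszulTotalD_koszulIncl_zero (μ : L →ₗ[k] Module.End k A) (y : A ⊗[k] (⋀[k]^0 L)) :
    koszulTotalD μ (koszulIncl A L 0 y) = 0 := by
  have h : (TensorProduct.curry (koszulTotalD μ ∘ₗ koszulIncl A L 0)).flip = 0 := by
    refine exteriorPower.linearMap_ext ?_
    ext ℓ a
    change koszulTotalD μ (a ⊗ₜ ExteriorAlgebra.ιMulti k 0 ℓ) = 0
    rw [ExteriorAlgebra.ιMulti_zero_apply, koszulTotalD_one]
  have h' : koszulTotalD μ ∘ₗ koszulIncl A L 0 = 0 :=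
    TensorProduct.ext' fun a x => LinearMap.congr_fun (LinearMap.congr_fun h x) a
  exact LinearMap.congr_fun h' y

theorem mem_koszulCycles_iff (μ : L →ₗ[k] Module.End k A) (t : ℕ) (y : A ⊗[k] (⋀[k]^t L)) :
    y ∈ koszulCycles μ t ↔ koszulTotalD μ (koszulIncl A L t y) = 0 := by
  cases t with
  | zero => simp [koszulCycles, koszulTotalD_koszulIncl_zero]
  | succ t =>
    rw [koszulTotalD_koszulIncl, map_eq_zero_iff _ (koszulIncl_injective t)]
    rfl

/-- The map from the Koszul homology to the homology of the total Koszul complex. -/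
def koszulHomologyIncl (μ : L →ₗ[k] Module.End k A) (t : ℕ) :
    KoszulHomology μ t →ₗ[k] DiffHomology (koszulTotalD μ) :=
  Submodule.mapQ (koszulBoundaries μ t) _
    ((koszulIncl A L t).restrict (p := koszulCycles μ t) (q := LinearMap.ker (koszulTotalD μ))
      fun y hy => (mem_koszulCycles_iff μ t y).1 hy) (by
    rintro ⟨_, hz⟩ ⟨u, rfl⟩
    exact ⟨_, koszulTotalD_koszulIncl μ t u⟩)

theorem koszulHomologyIncl_mk (μ : L →ₗ[k] Module.End k A) (t : ℕ) (z : koszulCycles μ t) :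
    koszulHomologyIncl μ t (KoszulHomology.mk μ t z) =
      DiffHomology.mk _ ⟨koszulIncl A L t z.1, (mem_koszulCycles_iff μ t _).1 z.2⟩ := rfl

theorem KoszulHomology.mk_surjective (μ : L →ₗ[k] Module.End k A) (t : ℕ) :
    Function.Surjective (KoszulHomology.mk μ t) :=
  Submodule.mkQ_surjective _

theorem KoszulHomology.mk_eq_zero (μ : L →ₗ[k] Module.End k A) (t : ℕ) (z : koszulCycles μ t) :
    KoszulHomology.mk μ t z = 0 ↔ ∃ u, koszulD μ t u = z.1 := by
  refine (Submodule.Quotient.mk_eq_zero (koszulBoundaries μ t)).trans ?_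
  rfl

theorem iSup_range_koszulIncl : ⨆ t, LinearMap.range (koszulIncl (k := k) A L t) = ⊤ := by
  rw [eq_top_iff, ← TensorProduct.map₂_mk_top_top_eq_top, ← ExteriorAlgebra.ιMulti_span,
    Submodule.map₂_le]
  intro a _ x hx
  induction hx using Submodule.span_induction with
  | zero => simp
  | add x y _ _ hx hy => rw [map_add]; exact Submodule.add_mem _ hx hy
  | smul r x _ hx => rw [map_smul]; exact Submodule.smul_mem _ _ hx
  | mem x hx =>
    obtain ⟨⟨t, v⟩, rfl⟩ := hx
    exact Submodule.mem_iSup_of_mem t ⟨a ⊗ₜ exteriorPower.ιMulti k t v, rfl⟩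

/-! ### Koszul homology of fixed exterior degree inside the total homology. -/

variable [CharZero k]

theorem two_pow_injective : Function.Injective fun t : ℕ => (2 : k) ^ t := fun a b h =>
  Nat.pow_right_injective le_rfl (Nat.cast_injective (R := k) (by simpa using h))

/-- If a cycle of exterior degree t bounds a possibly inhomogeneous u, its component of degree t + 1
bounds it too. The component is found as an eigenvector of the operator equal to 2^t in degree t. -/
theorem koszulHomologyIncl_injective (μ : L →ₗ[k] Module.End k A) (t : ℕ) :
    Function.Injective (koszulHomologyIncl μ t) := by
  rw [injective_iff_map_eq_zero]
  intro c hc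
  obtain ⟨z, rfl⟩ := KoszulHomology.mk_surjective μ t c
  rw [koszulHomologyIncl_mk, DiffHomology.mk_eq_zero] at hc
  obtain ⟨u, hu⟩ := hc
  replace hu : koszulTotalD μ u = koszulIncl A L t z.1 := hu
  let Γ : Module.End k (A ⊗[k] ExteriorAlgebra k L) :=
    TensorProduct.map LinearMap.id (exteriorScale L 2)
  have hle : ∀ t, LinearMap.range (koszulIncl A L t) ≤ Γ.eigenspace ((2 : k) ^ t) := by
    rintro t _ ⟨y, rfl⟩
    rw [Module.End.mem_eigenspace_iff]
    induction y with
    | zero => simp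
    | add x y hx hy => rw [map_add, map_add, hx, hy, smul_add]
    | tmul a x =>
      simp only [Γ, koszulIncl, LinearMap.lTensor_tmul, TensorProduct.map_tmul,
        Submodule.subtype_apply, LinearMap.id_apply]
      rw [exteriorScale_of_mem 2 x.2, TensorProduct.tmul_smul]
  have hrange := eq_eigenspace_of_le two_pow_injective hle iSup_range_koszulIncl
  have htop : ⨆ μ, Γ.eigenspace μ = ⊤ := by
    refine iSup_eigenspace_eq_top_of_family (w := fun t : ℕ => (2 : k) ^ t) ?_
    simp_rw [← hrange]
    exact iSup_range_koszulIncl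
  have h2 : (2 : k) ≠ 0 := two_ne_zero
  -- The differential multiplies the weight by 1/2, so a target of weight 2^t asks for a source of
  -- weight 2^(t+1).
  obtain ⟨u', hu', h⟩ := exists_eigenvector_preimage (f := Γ) (g := Γ) htop (koszulTotalD μ)
    (c := 2⁻¹) (inv_ne_zero h2) (β := 2 ^ t) (v := u)
    (fun y => by rw [koszulTotalD_scale μ LinearMap.id 2 1 h2 (by simp), mul_one])
    (hu ▸ hle t ⟨_, rfl⟩)
  rw [inv_inv, ← pow_succ', ← hrange (t + 1)] at hu'
  obtain ⟨u'', rfl⟩ := hu'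
  rw [koszulTotalD_koszulIncl, hu] at h
  rw [KoszulHomology.mk_eq_zero]
  exact ⟨u'', koszulIncl_injective t h⟩

/-! #### The bigrading -/

/-- The eigenvalue of the grading operator on the piece of bidegree `(t, s)`. -/
def bigradedWeight (k : Type*) [Field k] (i : ℕ × ℕ) : k := 2 ^ i.1 * 3 ^ i.2

/-- Unique factorization. It lets the eigenspaces of a single operator encode both gradings. -/
theorem bigradedWeight_injective : Function.Injective (bigradedWeight k) := by
  rintro ⟨a, b⟩ ⟨c, d⟩ h
  have h1 : 2 ^ a * 3 ^ b = 2 ^ c * 3 ^ d := by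
    have : ((2 ^ a * 3 ^ b : ℕ) : k) = ((2 ^ c * 3 ^ d : ℕ) : k) := by
      simpa [bigradedWeight] using h
    exact_mod_cast this
  have h2 : ∀ {a b c d : ℕ}, 2 ^ a * 3 ^ b = 2 ^ c * 3 ^ d → 2 ^ a ∣ 2 ^ c ∧ 3 ^ b ∣ 3 ^ d :=
    fun {a b c d} h =>
    ⟨(Nat.Coprime.pow a d (by norm_num : Nat.Coprime 2 3)).dvd_of_dvd_mul_right ⟨_, h.symm⟩,
      (Nat.Coprime.pow b c (by norm_num : Nat.Coprime 3 2)).dvd_of_dvd_mul_left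
        ⟨2 ^ a, by rw [← h, mul_comm]⟩⟩
  have h3 := h2 h1
  have h4 := h2 h1.symm
  rw [Nat.pow_right_injective le_rfl (Nat.dvd_antisymm h3.1 h4.1),
    Nat.pow_right_injective (by norm_num) (Nat.dvd_antisymm h3.2 h4.2)]

/-- The grading operator on the total Koszul complex. -/
def koszulGrading (L : Type*) [AddCommGroup L] [Module k L] (γ : Module.End k A) :
    Module.End k (A ⊗[k] ExteriorAlgebra k L) :=
  TensorProduct.map γ (exteriorScale L 2)

/-- The factor 2⁻¹ · 3 is the ratio of the weights at (t - 1, s + 1) and (t, s). -/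
theorem koszulGrading_koszulTotalD {μ : L →ₗ[k] Module.End k A} {γ : Module.End k A}
    (h : ∀ v a, γ (μ v a) = (3 : k) • μ v (γ a)) (y : A ⊗[k] ExteriorAlgebra k L) :
    koszulGrading L γ (koszulTotalD μ y) =
      (2⁻¹ * 3 : k) • koszulTotalD μ (koszulGrading L γ y) :=
  koszulTotalD_scale μ γ 2 3 two_ne_zero h y

theorem koszulGrading_preserves {μ : L →ₗ[k] Module.End k A} {γ : Module.End k A}
    (h : ∀ v a, γ (μ v a) = (3 : k) • μ v (γ a)) :
    DiffHomology.Preserves (koszulTotalD μ) (koszulTotalD μ) (koszulGrading L γ) := by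
  have h0 : (2⁻¹ * 3 : k) ≠ 0 := mul_ne_zero (inv_ne_zero two_ne_zero) three_ne_zero
  refine .of_smul (2⁻¹ * 3 : k)⁻¹ (fun y => ?_) (inv_ne_zero h0)
  rw [koszulGrading_koszulTotalD h, smul_smul, inv_mul_cancel₀ h0, one_smul]

/-- The grading operator on the homology of the total Koszul complex. -/
def homologyGrading {μ : L →ₗ[k] Module.End k A} {γ : Module.End k A}
    (h : ∀ v a, γ (μ v a) = (3 : k) • μ v (γ a)) : Module.End k (DiffHomology (koszulTotalD μ)) :=
  DiffHomology.map (koszulGrading L γ) (koszulGrading_preserves h)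

/-- The bigraded pieces of the Koszul homology, as subspaces of the homology of the total Koszul
complex. -/
def koszulPieceIncl (μ : L →ₗ[k] Module.End k A) (𝒜 : ℕ → Submodule k A) (t s : ℕ) :
    koszulHomologyDegree μ 𝒜 t s →ₗ[k] DiffHomology (koszulTotalD μ) :=
  koszulHomologyIncl μ t ∘ₗ (koszulHomologyDegree μ 𝒜 t s).subtype

theorem koszulPieceIncl_injective (μ : L →ₗ[k] Module.End k A) (𝒜 : ℕ → Submodule k A) (t s : ℕ) :
    Function.Injective (koszulPieceIncl μ 𝒜 t s) :=
  (koszulHomologyIncl_injective μ t).comp Subtype.val_injective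

omit [CharZero k] in
theorem koszulGrading_koszulIncl {𝒜 : ℕ → Submodule k A} {γ : Module.End k A}
    (hγ : ∀ s, ∀ a ∈ 𝒜 s, γ a = (3 : k) ^ s • a) {μ : L →ₗ[k] Module.End k A} {t s : ℕ}
    {y : A ⊗[k] (⋀[k]^t L)} (hy : y ∈ koszulDegree μ 𝒜 t s) :
    koszulGrading L γ (koszulIncl A L t y) = bigradedWeight k (t, s) • koszulIncl A L t y := by
  obtain ⟨x, rfl⟩ := hy
  induction x with
  | zero => simp
  | add x y hx hy => simp only [map_add, hx, hy, smul_add]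
  | tmul a x =>
    simp only [koszulGrading, koszulIncl, LinearMap.lTensor_tmul, LinearMap.rTensor_tmul,
      TensorProduct.map_tmul, Submodule.subtype_apply]
    rw [exteriorScale_of_mem 2 x.2, hγ s a.1 a.2, TensorProduct.tmul_smul,
      ← TensorProduct.smul_tmul', smul_smul]
    rfl

omit [CharZero k] in
theorem iSup_map_koszulDegree {𝒜 : ℕ → Submodule k A} (h𝒜 : ⨆ s, 𝒜 s = ⊤)
    (μ : L →ₗ[k] Module.End k A) :
    ⨆ i : ℕ × ℕ, (koszulDegree μ 𝒜 i.1 i.2).map (koszulIncl A L i.1) = ⊤ := by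
  rw [eq_top_iff, ← TensorProduct.map₂_mk_top_top_eq_top, ← ExteriorAlgebra.ιMulti_span, ← h𝒜,
    Submodule.map₂_iSup_left, iSup_le_iff]
  intro s
  rw [Submodule.map₂_le]
  intro a ha x hx
  induction hx using Submodule.span_induction with
  | zero => simp
  | add x y _ _ hx hy => rw [map_add]; exact Submodule.add_mem _ hx hy
  | smul r x _ hx => rw [map_smul]; exact Submodule.smul_mem _ _ hx
  | mem x hx =>
    obtain ⟨⟨t, v⟩, rfl⟩ := hx
    exact Submodule.mem_iSup_of_mem (t, s)
      ⟨a ⊗ₜ exteriorPower.ιMulti k t v, ⟨⟨a, ha⟩ ⊗ₜ exteriorPower.ιMulti k t v, rfl⟩, rfl⟩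

/-- The bihomogeneous components of a cycle are cycles: their differentials are eigenvectors of
distinct weights with sum zero. -/
theorem iSup_range_koszulPieceIncl {μ : L →ₗ[k] Module.End k A} {𝒜 : ℕ → Submodule k A}
    {γ : Module.End k A} (h : ∀ v a, γ (μ v a) = (3 : k) • μ v (γ a)) (h𝒜 : ⨆ s, 𝒜 s = ⊤)
    (hγ : ∀ s, ∀ a ∈ 𝒜 s, γ a = (3 : k) ^ s • a) :
    ⨆ i : ℕ × ℕ, LinearMap.range (koszulPieceIncl μ 𝒜 i.1 i.2) = ⊤ := by
  rw [eq_top_iff]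
  rintro c -
  obtain ⟨⟨z, hz⟩, rfl⟩ := DiffHomology.mk_surjective _ c
  have hz' : z ∈ ⨆ i : ℕ × ℕ, (koszulDegree μ 𝒜 i.1 i.2).map (koszulIncl A L i.1) :=
    iSup_map_koszulDegree h𝒜 μ ▸ Submodule.mem_top
  obtain ⟨g, hg, rfl⟩ := (Submodule.mem_iSup_iff_exists_finsupp _ _).1 hz'
  have h0 : (2⁻¹ * 3 : k) ≠ 0 := mul_ne_zero (inv_ne_zero two_ne_zero) three_ne_zero
  have hD : ∀ i ∈ g.support, koszulTotalD μ (g i) = 0 := by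
    refine eigenvectors_eq_zero_of_sum_eq_zero (koszulGrading L γ)
      (fun i => (2⁻¹ * 3 : k) * bigradedWeight k i)
      ((mul_right_injective₀ h0).comp bigradedWeight_injective) g.support
      (fun i => koszulTotalD μ (g i)) (fun i _ => ?_) ?_
    · obtain ⟨y, hy, hyg⟩ := hg i
      rw [Module.End.mem_eigenspace_iff, koszulGrading_koszulTotalD h, ← hyg,
        koszulGrading_koszulIncl hγ hy, map_smul, smul_smul]
    · rw [← map_sum]
      exact hz
  have hDi : ∀ i, koszulTotalD μ (g i) = 0 := fun i => by
    by_cases hi : i ∈ g.support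
    · exact hD i hi
    · rw [Finsupp.notMem_support_iff.1 hi, map_zero]
  have hsum : DiffHomology.mk (koszulTotalD μ) ⟨g.sum fun _ x => x, hz⟩ =
      ∑ i ∈ g.support, DiffHomology.mk _ ⟨g i, hDi i⟩ := by
    rw [← map_sum]
    congr 1
    ext
    simp [Finsupp.sum]
  rw [hsum]
  refine Submodule.sum_mem _ fun i _ => Submodule.mem_iSup_of_mem i ?_
  obtain ⟨y, hy, hyg⟩ := hg i
  have hyc : y ∈ koszulCycles μ i.1 := by rw [mem_koszulCycles_iff, hyg, hDi]
  refine ⟨⟨KoszulHomology.mk μ i.1 ⟨y, hyc⟩, ⟨⟨y, hyc⟩, hy, rfl⟩⟩, ?_⟩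
  change koszulHomologyIncl μ i.1 (KoszulHomology.mk μ i.1 ⟨y, hyc⟩) = _
  rw [koszulHomologyIncl_mk]
  congr 1
  exact Subtype.ext hyg

/-- Each piece lies in its eigenspace and together the pieces span, so each fills its eigenspace.
From here on a statement about a bigraded Tor is a statement about eigenvectors in total homology.
-/
theorem range_koszulPieceIncl {μ : L →ₗ[k] Module.End k A} {𝒜 : ℕ → Submodule k A}
    {γ : Module.End k A} (h : ∀ v a, γ (μ v a) = (3 : k) • μ v (γ a)) (h𝒜 : ⨆ s, 𝒜 s = ⊤)
    (hγ : ∀ s, ∀ a ∈ 𝒜 s, γ a = (3 : k) ^ s • a) (i : ℕ × ℕ) :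
    LinearMap.range (koszulPieceIncl μ 𝒜 i.1 i.2) =
      (homologyGrading h).eigenspace (bigradedWeight k i) := by
  refine eq_eigenspace_of_le bigradedWeight_injective
    (G := fun i => LinearMap.range (koszulPieceIncl μ 𝒜 i.1 i.2)) ?_
    (iSup_range_koszulPieceIncl h h𝒜 hγ) i
  rintro i _ ⟨⟨_, ⟨z, hz, rfl⟩⟩, rfl⟩
  rw [Module.End.mem_eigenspace_iff]
  change homologyGrading h (koszulHomologyIncl μ i.1 (KoszulHomology.mk μ i.1 z)) =
    bigradedWeight k i • koszulHomologyIncl μ i.1 (KoszulHomology.mk μ i.1 z)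
  rw [koszulHomologyIncl_mk, homologyGrading, DiffHomology.map_mk, ← map_smul]
  congr 1
  exact Subtype.ext (koszulGrading_koszulIncl hγ hz)

theorem iSup_eigenspace_homologyGrading {μ : L →ₗ[k] Module.End k A} {𝒜 : ℕ → Submodule k A}
    {γ : Module.End k A} (h : ∀ v a, γ (μ v a) = (3 : k) • μ v (γ a)) (h𝒜 : ⨆ s, 𝒜 s = ⊤)
    (hγ : ∀ s, ∀ a ∈ 𝒜 s, γ a = (3 : k) ^ s • a) :
    ⨆ i, (homologyGrading h).eigenspace (bigradedWeight k i) = ⊤ := by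
  simp_rw [← range_koszulPieceIncl h h𝒜 hγ]
  exact iSup_range_koszulPieceIncl h h𝒜 hγ

end Comparison

end

noncomputable section

/-! ### Stanley--Reisner rings: universal property, monomials, grading -/

theorem Finset.prod_eq_zero_of_subset {ι A : Type*} [CommRing A] {s t : Finset ι} (hst : s ⊆ t)
    {f : ι → A} (h : ∏ i ∈ s, f i = 0) : ∏ i ∈ t, f i = 0 :=
  zero_dvd_iff.1 (h ▸ Finset.prod_dvd_prod_of_subset s t f hst)

theorem Finset.prod_eq_zero_of_pair {ι A : Type*} [CommRing A] {t : Finset ι} {i j : ι}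
    (hi : i ∈ t) (hj : j ∈ t) (hij : i ≠ j) {f : ι → A} (h : f i * f j = 0) :
    ∏ i ∈ t, f i = 0 := by
  classical
  refine Finset.prod_eq_zero_of_subset (s := {i, j}) (by simp [Finset.insert_subset_iff, hi, hj]) ?_
  rwa [Finset.prod_pair hij]

namespace StanleyReisner

open MvPolynomial

variable {V : Type*} {Δ T : Set (Finset V)} {A : Type*} [CommRing A] [Algebra ℂ A]

/-- The projection from the polynomial ring to the Stanley--Reisner ring. -/
def proj (Δ : Set (Finset V)) : MvPolynomial V ℂ →ₐ[ℂ] StanleyReisner Δ :=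
  Ideal.Quotient.mkₐ ℂ (stanleyReisnerIdeal Δ)

theorem proj_surjective : Function.Surjective (proj Δ) := Ideal.Quotient.mkₐ_surjective _ _

@[simp] theorem proj_X (v : V) : proj Δ (X v) = x Δ v := rfl

theorem proj_eq_zero {p : MvPolynomial V ℂ} : proj Δ p = 0 ↔ p ∈ stanleyReisnerIdeal Δ :=
  Ideal.Quotient.eq_zero_iff_mem

theorem prod_x_eq_zero {s : Finset V} (hs : s ∉ Δ) : ∏ v ∈ s, x Δ v = 0 := by
  have h : proj Δ (∏ v ∈ s, X v) = 0 := proj_eq_zero.2 (Ideal.subset_span ⟨s, hs, rfl⟩)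
  simpa using h

theorem x_eq_zero {v : V} (hv : {v} ∉ Δ) : x Δ v = 0 := by
  simpa using prod_x_eq_zero hv

theorem x_mul_x_eq_zero [DecidableEq V] {v w : V} (hvw : v ≠ w) (h : {v, w} ∉ Δ) :
    x Δ v * x Δ w = 0 := by
  simpa [Finset.prod_pair hvw] using prod_x_eq_zero h

/-- The homomorphism from a Stanley--Reisner ring which is induced by a homomorphism from the
polynomial ring. -/
def lift (f : MvPolynomial V ℂ →ₐ[ℂ] A) (h : ∀ s ∉ Δ, ∏ v ∈ s, f (X v) = 0) :
    StanleyReisner Δ →ₐ[ℂ] A :=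
  Ideal.Quotient.liftₐ _ f (by
    change stanleyReisnerIdeal Δ ≤ RingHom.ker f
    refine Ideal.span_le.2 ?_
    rintro _ ⟨s, hs, rfl⟩
    simpa [RingHom.mem_ker] using h s hs)

@[simp] theorem lift_proj (f : MvPolynomial V ℂ →ₐ[ℂ] A) (h : ∀ s ∉ Δ, ∏ v ∈ s, f (X v) = 0)
    (p : MvPolynomial V ℂ) : lift f h (proj Δ p) = f p := rfl

@[simp] theorem lift_x (f : MvPolynomial V ℂ →ₐ[ℂ] A) (h : ∀ s ∉ Δ, ∏ v ∈ s, f (X v) = 0)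
    (v : V) : lift f h (x Δ v) = f (X v) := rfl

theorem algHom_ext {B : Type*} [Semiring B] [Algebra ℂ B] {f g : StanleyReisner Δ →ₐ[ℂ] B}
    (h : ∀ v, f (x Δ v) = g (x Δ v)) : f = g := by
  have : f.comp (proj Δ) = g.comp (proj Δ) := MvPolynomial.algHom_ext h
  ext a
  obtain ⟨p, rfl⟩ := proj_surjective a
  exact DFunLike.congr_fun this p

theorem prod_X_eq_monomial (s : Finset V) :
    ∏ v ∈ s, (X v : MvPolynomial V ℂ) = monomial (∑ v ∈ s, Finsupp.single v 1) 1 := by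
  classical
  induction s using Finset.induction_on with
  | empty => simp
  | insert v s hv ih =>
    rw [Finset.prod_insert hv, Finset.sum_insert hv, ih, X, monomial_mul, one_mul]

theorem sum_single_le_iff (s : Finset V) (m : V →₀ ℕ) :
    ∑ v ∈ s, Finsupp.single v 1 ≤ m ↔ s ⊆ m.support := by
  classical
  have h : ∀ w, (∑ v ∈ s, Finsupp.single v 1) w = if w ∈ s then 1 else 0 := fun w => by
    simp [Finsupp.finsetSum_apply, Finsupp.single_apply]
  constructor
  · intro hm v hv
    have := hm v
    rw [h, if_pos hv] at this
    exact Finsupp.mem_support_iff.2 (by omega)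
  · intro hm v
    rw [h]
    split_ifs with hv
    · exact Nat.one_le_iff_ne_zero.2 (Finsupp.mem_support_iff.1 (hm hv))
    · exact Nat.zero_le _

/-- The ideal is monomial, so membership is tested monomial by monomial; for a simplicial complex a
monomial lies in it exactly when its support is a non-face. -/
theorem proj_eq_zero_iff (hΔ : IsLowerSet Δ) {p : MvPolynomial V ℂ} :
    proj Δ p = 0 ↔ ∀ m ∈ p.support, m.support ∉ Δ := by
  have h : stanleyReisnerIdeal Δ = Ideal.span
      ((fun m => monomial m (1 : ℂ)) '' {m | ∃ s : Finset V, s ∉ Δ ∧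
        m = ∑ v ∈ s, Finsupp.single v 1}) := by
    refine congrArg Ideal.span (Set.ext fun p => ⟨?_, ?_⟩)
    · rintro ⟨s, hs, rfl⟩
      exact ⟨_, ⟨s, hs, rfl⟩, (prod_X_eq_monomial s).symm⟩
    · rintro ⟨_, ⟨s, hs, rfl⟩, rfl⟩
      exact ⟨s, hs, (prod_X_eq_monomial s).symm⟩
  rw [proj_eq_zero, h, mem_ideal_span_monomial_image]
  refine forall₂_congr fun m _ => ⟨?_, fun hm => ?_⟩
  · rintro ⟨_, ⟨s, hs, rfl⟩, hsm⟩ hm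
    exact hs (hΔ ((sum_single_le_iff s m).1 hsm) hm)
  · exact ⟨_, ⟨_, hm, rfl⟩, (sum_single_le_iff _ m).2 subset_rfl⟩

/-- Every element that vanishes in the ring of a subcomplex is represented by a polynomial all of
whose monomials are supported on faces outside the subcomplex. -/
theorem exists_representative (hΔ : IsLowerSet Δ) (hT : IsLowerSet T) {p : MvPolynomial V ℂ}
    (hp : proj T p = 0) :
    ∃ q : MvPolynomial V ℂ, (∀ m ∈ q.support, m.support ∈ Δ ∧ m.support ∉ T) ∧
      proj Δ q = proj Δ p := by
  classical
  rw [proj_eq_zero_iff hT] at hp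
  refine ⟨∑ m ∈ p.support with m.support ∈ Δ, monomial m (p.coeff m), fun m hm => ?_, ?_⟩
  · rw [mem_support_iff, coeff_sum] at hm
    obtain ⟨m', hm', h⟩ := Finset.exists_ne_zero_of_sum_ne_zero hm
    rw [coeff_monomial] at h
    obtain rfl : m' = m := by
      by_contra hne
      exact h (if_neg hne)
    rw [Finset.mem_filter] at hm'
    exact ⟨hm'.2, hp _ hm'.1⟩
  · rw [eq_comm, ← sub_eq_zero, ← map_sub]
    nth_rewrite 1 [p.as_sum]
    rw [← Finset.sum_filter_add_sum_filter_not p.support (fun m => m.support ∈ Δ) fun m =>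
      monomial m (p.coeff m), add_sub_cancel_left, map_sum]
    refine Finset.sum_eq_zero fun m hm => (proj_eq_zero_iff hΔ).2 fun m' hm' => ?_
    obtain rfl := Finset.mem_singleton.1 (support_monomial_subset hm')
    exact (Finset.mem_filter.1 hm).2

/-- The projection to the Stanley--Reisner ring of a subcomplex. -/
def restrict (h : T ⊆ Δ) : StanleyReisner Δ →ₐ[ℂ] StanleyReisner T :=
  lift (proj T) fun s hs => by simpa using prod_x_eq_zero fun hs' => hs (h hs')

@[simp] theorem restrict_proj (h : T ⊆ Δ) (p : MvPolynomial V ℂ) :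
    restrict h (proj Δ p) = proj T p := rfl

@[simp] theorem restrict_x (h : T ⊆ Δ) (v : V) : restrict h (x Δ v) = x T v := rfl

theorem restrict_surjective (h : T ⊆ Δ) : Function.Surjective (restrict h) := fun a => by
  obtain ⟨p, rfl⟩ := proj_surjective a
  exact ⟨proj Δ p, rfl⟩

/-! #### The grading -/

theorem mem_degree {s : ℕ} {a : StanleyReisner Δ} :
    a ∈ degree Δ s ↔ ∃ p : MvPolynomial V ℂ, p.IsHomogeneous s ∧ proj Δ p = a := Iff.rfl

theorem iSup_degree : ⨆ s, degree Δ s = ⊤ := by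
  rw [eq_top_iff]
  rintro a -
  obtain ⟨p, rfl⟩ := proj_surjective a
  rw [← p.sum_homogeneousComponent, map_sum]
  exact Submodule.sum_mem _ fun s _ => Submodule.mem_iSup_of_mem s
    ⟨_, homogeneousComponent_isHomogeneous s p, rfl⟩

theorem degree_zero_le : degree Δ 0 ≤ Submodule.span ℂ {1} := by
  rintro _ ⟨p, hp, rfl⟩
  rw [SetLike.mem_coe, mem_homogeneousSubmodule, ← totalDegree_zero_iff_isHomogeneous,
    totalDegree_eq_zero_iff_eq_C] at hp
  rw [hp]
  refine Submodule.mem_span_singleton.2 ⟨p.coeff 0, ?_⟩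
  rw [← algebraMap_eq, AlgHom.toLinearMap_apply, AlgHom.commutes, Algebra.algebraMap_eq_smul_one]

/-- The operator which multiplies by `3 ^ s` in degree `s`. -/
def scale (Δ : Set (Finset V)) : StanleyReisner Δ →ₐ[ℂ] StanleyReisner Δ :=
  lift (aeval fun v => (3 : ℂ) • x Δ v) fun s hs => by
    simp [Finset.prod_smul, prod_x_eq_zero hs]

@[simp] theorem scale_x (v : V) : scale Δ (x Δ v) = (3 : ℂ) • x Δ v := by simp [scale]

theorem aeval_smul_of_isHomogeneous {p : MvPolynomial V ℂ} {s : ℕ} (hp : p.IsHomogeneous s) (c : ℂ)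
    (f : V → A) : aeval (fun v => c • f v) p = c ^ s • aeval f p := by
  rw [aeval_def, aeval_def, eval₂_eq, eval₂_eq, Finset.smul_sum]
  refine Finset.sum_congr rfl fun m hm => ?_
  have hs : ∑ v ∈ m.support, m v = s := by
    rw [← hp (mem_support_iff.1 hm), Finsupp.weight_apply, Finsupp.sum]
    simp
  simp_rw [smul_pow]
  rw [Finset.prod_smul, Finset.prod_pow_eq_pow_sum, hs, mul_smul_comm]

theorem scale_of_mem_degree {s : ℕ} {a : StanleyReisner Δ} (ha : a ∈ degree Δ s) :
    scale Δ a = (3 : ℂ) ^ s • a := by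
  obtain ⟨p, hp, rfl⟩ := mem_degree.1 ha
  have h : proj Δ = aeval (x Δ) := MvPolynomial.algHom_ext fun v => by simp
  rw [scale, lift_proj, aeval_smul_of_isHomogeneous hp, h]

/-- The augmentation, for a complex which has the empty face. -/
def augmentation (h : ∅ ∈ Δ) : StanleyReisner Δ →ₐ[ℂ] ℂ :=
  lift (aeval fun _ => 0) fun s hs => by
    obtain ⟨v, hv⟩ := Finset.nonempty_iff_ne_empty.2 fun h' : s = ∅ => hs (h' ▸ h)
    exact Finset.prod_eq_zero hv (by simp)

@[simp] theorem augmentation_x (h : ∅ ∈ Δ) (v : V) : augmentation h (x Δ v) = 0 := by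
  simp [augmentation]

end StanleyReisner

end

noncomputable section

/-! ### Faces of Bergman fans -/

section Faces

variable {α : Type*} {M : Matroid α} {P Pm Pp : Set (Set α)} {Z : Set α}

/-- Finiteness of the ground type makes the rank of I finite, which is needed to pass from equal
ranks to equal closures. -/
theorem spansFlat_iff [Fintype α] {I F : Set α} (hI : I ⊆ M.E) (hF : M.IsFlat F) :
    SpansFlat M I F ↔ M.closure I = F := by
  constructor
  · rintro ⟨h1, h2⟩
    have hfin : M.IsRkFinite I := by
      obtain ⟨J, hJ⟩ := M.exists_isBasis' I
      exact hJ.isRkFinite_of_finite (Set.toFinite J)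
    rw [hfin.closure_eq_closure_of_subset_of_eRk_ge_eRk h1 h2.ge, hF.closure]
  · rintro rfl
    exact ⟨M.subset_closure I, (M.eRk_closure_eq I).symm⟩

theorem mem_bergmanFan_iff [Fintype α] (hP : P ⊆ properFlats M) {τ : Finset (α ⊕ Set α)} :
    τ ∈ bergmanFan M P ↔ (∀ i, Sum.inl i ∈ τ → i ∈ M.E) ∧ (∀ F, Sum.inr F ∈ τ → F ∈ P) ∧
      (∀ F G, Sum.inr F ∈ τ → Sum.inr G ∈ τ → F ⊆ G ∨ G ⊆ F) ∧
      (∀ i F, Sum.inl i ∈ τ → Sum.inr F ∈ τ → i ∈ F) ∧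
      ∀ F ∈ insert M.E P, M.closure {i | Sum.inl i ∈ τ} ≠ F := by
  have hflat : ∀ F ∈ insert M.E P, M.IsFlat F := by
    rintro F (rfl | hF)
    · exact M.ground_isFlat
    · exact (hP hF).1
  constructor
  · rintro ⟨I, 𝓕, rfl, h1, h2, h3, h4, h5⟩
    have hI : {i | Sum.inl i ∈ I.disjSum 𝓕} = (I : Set α) := by ext; simp
    refine ⟨fun i hi => h1 (by simpa using hi), fun F hF => h2 (by simpa using hF),
      fun F G hF hG => h3.total (by simpa using hF) (by simpa using hG),
      fun i F hi hF => h4 F (by simpa using hF) (by simpa using hi), fun F hF => ?_⟩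
    rw [hI, Ne, ← spansFlat_iff h1 (hflat F hF)]
    exact h5 F hF
  · rintro ⟨h1, h2, h3, h4, h5⟩
    have hI : {i | Sum.inl i ∈ τ} = (τ.toLeft : Set α) := by ext; simp
    have h1' : (τ.toLeft : Set α) ⊆ M.E := fun i hi => h1 i (by simpa using hi)
    refine ⟨τ.toLeft, τ.toRight, (Finset.toLeft_disjSum_toRight).symm, h1',
      fun F hF => h2 F (by simpa using hF),
      fun F hF G hG _ => h3 F G (by simpa using hF) (by simpa using hG),
      fun F hF i hi => h4 i F (by simpa using hi) (by simpa using hF), fun F hF => ?_⟩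
    rw [spansFlat_iff h1' (hflat F hF), ← hI]
    exact h5 F hF

/-- The delicate condition is that I spans nothing in P ∪ {E}. If a subset of I spans such a flat,
the closure of I is a flat containing it, hence equals E or lies in P by the filter property,
against the assumption on I. -/
theorem isLowerSet_bergmanFan [Fintype α] (hP : IsOrderFilter M P) :
    IsLowerSet (bergmanFan M P) := by
  intro τ τ' hle h
  rw [mem_bergmanFan_iff hP.1] at h ⊢
  obtain ⟨h1, h2, h3, h4, h5⟩ := h
  refine ⟨fun i hi => h1 i (hle hi), fun F hF => h2 F (hle hF),
    fun F G hF hG => h3 F G (hle hF) (hle hG), fun i F hi hF => h4 i F (hle hi) (hle hF), ?_⟩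
  rintro F hF rfl
  have hsub : M.closure {i | Sum.inl i ∈ τ'} ⊆ M.closure {i | Sum.inl i ∈ τ} :=
    M.closure_subset_closure fun i hi => hle hi
  by_cases hE : M.closure {i | Sum.inl i ∈ τ} = M.E
  · exact h5 _ (Set.mem_insert _ _) hE
  rcases hF with hF | hF
  · exact hE (subset_antisymm (M.closure_subset_ground _) (hF ▸ hsub))
  · exact h5 _ (Set.mem_insert_of_mem _ (hP.2 _ hF _
      ⟨M.isFlat_closure _, (hP.1 hF).2.1.mono hsub, hE⟩ hsub)) rfl

/-- The proper flats which contain `Z` strictly. -/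
def flatsAbove (M : Matroid α) (Z : Set α) : Set (Set α) := {F | F ∈ properFlats M ∧ Z ⊂ F}

/-- The faces of `Σ_{M,Pm}` which are not affected by a flip with center `Z` of it are the ones
outside this subcomplex, the closed star of the relative interior of the removed cone. -/
def lowerStar (M : Matroid α) (Z : Set α) : Set (Finset (α ⊕ Set α)) :=
  {τ | (∀ i, Sum.inl i ∈ τ → i ∈ Z) ∧ (∀ F, Sum.inr F ∈ τ → F ∈ flatsAbove M Z) ∧
    ∀ F G, Sum.inr F ∈ τ → Sum.inr G ∈ τ → F ⊆ G ∨ G ⊆ F}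

/-- The closed star of the ray `e_Z` in `Σ_{M,Pp}`. -/
def upperStar (M : Matroid α) (Z : Set α) : Set (Finset (α ⊕ Set α)) :=
  {τ | (∀ i, Sum.inl i ∈ τ → i ∈ Z) ∧ M.closure {i | Sum.inl i ∈ τ} ≠ Z ∧
    (∀ F, Sum.inr F ∈ τ → F = Z ∨ F ∈ flatsAbove M Z) ∧
    ∀ F G, Sum.inr F ∈ τ → Sum.inr G ∈ τ → F ⊆ G ∨ G ⊆ F}

theorem isLowerSet_lowerStar : IsLowerSet (lowerStar M Z) := fun _ _ hle h =>
  ⟨fun i hi => h.1 i (hle hi), fun F hF => h.2.1 F (hle hF),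
    fun F G hF hG => h.2.2 F G (hle hF) (hle hG)⟩

theorem isLowerSet_upperStar (hZ : M.IsFlat Z) : IsLowerSet (upperStar M Z) := by
  intro τ τ' hle h
  refine ⟨fun i hi => h.1 i (hle hi), fun heq => h.2.1 ?_, fun F hF => h.2.2.1 F (hle hF),
    fun F G hF hG => h.2.2.2 F G (hle hF) (hle hG)⟩
  refine subset_antisymm (hZ.closure ▸ M.closure_subset_closure fun i hi => h.1 i hi) ?_
  nth_rewrite 1 [← heq]
  exact M.closure_subset_closure fun i hi => hle hi

/-! ### Comparison of the faces of the two fans of a flip. -/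

section Flip

variable (hflip : IsMatroidalFlip M Pm Pp Z)
include hflip

theorem IsMatroidalFlip.mem_properFlats : Z ∈ properFlats M :=
  hflip.2.1.1 (hflip.2.2.2 ▸ Set.mem_insert Z Pm)

theorem IsMatroidalFlip.isFlat : M.IsFlat Z := hflip.mem_properFlats.1

theorem IsMatroidalFlip.flatsAbove_subset : flatsAbove M Z ⊆ Pm := fun F hF => by
  have h : F ∈ Pp := hflip.2.1.2 Z (hflip.2.2.2 ▸ Set.mem_insert Z Pm) F hF.1 hF.2.1
  rw [hflip.2.2.2] at h
  exact h.resolve_left fun h' => hF.2.ne h'.symm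

theorem IsMatroidalFlip.subset : Pm ⊆ Pp := hflip.2.2.2 ▸ Set.subset_insert _ _

theorem IsMatroidalFlip.mem : Z ∈ Pp := hflip.2.2.2 ▸ Set.mem_insert _ _

/-- Otherwise the filter property would put Z into P₋, or Z would be the whole ground set. -/
theorem IsMatroidalFlip.not_subset {F : Set α} (hF : F ∈ insert M.E Pm) : ¬ F ⊆ Z := by
  intro h
  rcases hF with rfl | hF
  · exact hflip.mem_properFlats.2.2 (subset_antisymm hflip.isFlat.subset_ground h)
  · exact hflip.2.2.1 (hflip.1.2 F hF Z hflip.mem_properFlats h)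

theorem IsMatroidalFlip.mem_flatsAbove {F : Set α} (hF : F ∈ Pm) (h : Z ⊆ F) :
    F ∈ flatsAbove M Z :=
  ⟨hflip.1.1 hF, h, hflip.not_subset (Set.mem_insert_of_mem _ hF)⟩

theorem IsMatroidalFlip.closure_not_mem {I : Set α} (hI : I ⊆ Z) {F : Set α}
    (hF : F ∈ insert M.E Pm) : M.closure I ≠ F := fun h =>
  hflip.not_subset hF (h ▸ hflip.isFlat.closure ▸ M.closure_subset_closure hI)

theorem IsMatroidalFlip.lowerStar_subset [Fintype α] : lowerStar M Z ⊆ bergmanFan M Pm :=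
    fun τ h => by
  rw [mem_bergmanFan_iff hflip.1.1]
  exact ⟨fun i hi => hflip.isFlat.subset_ground (h.1 i hi),
    fun F hF => hflip.flatsAbove_subset (h.2.1 F hF), h.2.2,
    fun i F hi hF => (h.2.1 F hF).2.1 (h.1 i hi), fun F hF => hflip.closure_not_mem h.1 hF⟩

theorem IsMatroidalFlip.upperStar_subset [Fintype α] : upperStar M Z ⊆ bergmanFan M Pp :=
    fun τ h => by
  rw [mem_bergmanFan_iff hflip.2.1.1]
  refine ⟨fun i hi => hflip.isFlat.subset_ground (h.1 i hi), fun F hF => ?_, h.2.2.2,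
    fun i F hi hF => ?_, fun F hF => ?_⟩
  · rcases h.2.2.1 F hF with rfl | hF
    · exact hflip.mem
    · exact hflip.subset (hflip.flatsAbove_subset hF)
  · rcases h.2.2.1 F hF with rfl | hF
    · exact h.1 i hi
    · exact hF.2.1 (h.1 i hi)
  · rw [hflip.2.2.2, Set.insert_comm] at hF
    rcases hF with rfl | hF
    · exact h.2.1
    · exact hflip.closure_not_mem h.1 hF

/-- A face of Σ₋ fails to be one of Σ₊ only when its set I spans Z; then I ⊆ Z, and every flat of
the face contains cl(I) = Z, so the face is in the lower star. A face of Σ₊ fails to be one of Σ₋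
only when it has the vertex Z; then its set I lies in Z, and its other flats, being comparable to Z
and not inside it, lie above Z, so it is in the upper star. -/
theorem IsMatroidalFlip.diff_eq [Fintype α] :
    bergmanFan M Pm \ lowerStar M Z = bergmanFan M Pp \ upperStar M Z := by
  ext τ
  rw [Set.mem_sdiff, Set.mem_sdiff, mem_bergmanFan_iff hflip.1.1, mem_bergmanFan_iff hflip.2.1.1]
  constructor
  · rintro ⟨⟨h1, h2, h3, h4, h5⟩, h6⟩
    refine ⟨⟨h1, fun F hF => hflip.subset (h2 F hF), h3, h4, ?_⟩, ?_⟩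
    · rw [hflip.2.2.2, Set.insert_comm]
      rintro F (rfl | hF)
      · intro heq
        have hsub : {i | Sum.inl i ∈ τ} ⊆ F := by
          rw [← heq]
          exact M.subset_closure _ h1
        refine h6 ⟨hsub, fun G hG => hflip.mem_flatsAbove (h2 G hG) ?_, h3⟩
        have hG' : {i | Sum.inl i ∈ τ} ⊆ G := fun i hi => h4 i G hi hG
        rw [← heq, ← (hflip.1.1 (h2 G hG)).1.closure]
        exact M.closure_subset_closure hG'
      · exact h5 F hF
    · rintro ⟨h7, -, h8, -⟩
      exact h6 ⟨h7, fun F hF => (h8 F hF).resolve_left fun h => hflip.2.2.1 (h ▸ h2 F hF), h3⟩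
  · rintro ⟨⟨h1, h2, h3, h4, h5⟩, h6⟩
    have hcl : M.closure {i | Sum.inl i ∈ τ} ≠ Z := h5 Z (Set.mem_insert_of_mem _ hflip.mem)
    have h2' : ∀ F, Sum.inr F ∈ τ → F = Z ∨ F ∈ Pm := fun F hF => by
      have := h2 F hF
      rwa [hflip.2.2.2] at this
    have hZ : Sum.inr Z ∉ τ := fun hZ => by
      refine h6 ⟨fun i hi => h4 i Z hi hZ, hcl, fun F hF => (h2' F hF).imp_right fun hF' =>
        hflip.mem_flatsAbove hF' ?_, h3⟩
      exact (h3 F Z hF hZ).resolve_left (hflip.not_subset (Set.mem_insert_of_mem _ hF'))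
    have h2'' : ∀ F, Sum.inr F ∈ τ → F ∈ Pm := fun F hF =>
      (h2' F hF).resolve_left fun h => hZ (h ▸ hF)
    exact ⟨⟨h1, h2'', h3, h4, fun F hF => h5 F (Set.insert_subset_insert hflip.subset hF)⟩,
      fun h7 => h6 ⟨h7.1, hcl, fun F hF => Or.inr (h7.2.1 F hF), h3⟩⟩

end Flip

/-! #### Restriction and contraction -/

theorem mem_bergmanFan_restrict_iff [Fintype α] (hZ : M.IsFlat Z) {τ : Finset (α ⊕ Set α)} :
    τ ∈ bergmanFan (M.restrict Z) ∅ ↔ (∀ i, Sum.inl i ∈ τ → i ∈ Z) ∧ (∀ F, Sum.inr F ∉ τ) ∧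
      M.closure {i | Sum.inl i ∈ τ} ≠ Z := by
  rw [mem_bergmanFan_iff (Set.empty_subset _)]
  constructor
  · rintro ⟨h1, h2, h3, h4, h5⟩
    refine ⟨h1, h2, fun heq => h5 Z (Set.mem_insert _ _) ?_⟩
    refine (Matroid.restrict_closure_eq M (X := {i | Sum.inl i ∈ τ}) h1 hZ.subset_ground).trans ?_
    rw [heq]
    exact Set.inter_self Z
  · rintro ⟨h1, h2, h3⟩
    refine ⟨h1, h2, fun F G hF => (h2 F hF).elim, fun i F hi hF => (h2 F hF).elim, ?_⟩
    rintro F (rfl | hF) heq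
    · replace heq := (Matroid.restrict_closure_eq M (X := {i | Sum.inl i ∈ τ}) h1
        hZ.subset_ground).symm.trans heq
      rw [Set.inter_eq_right] at heq
      refine h3 (subset_antisymm ?_ heq)
      exact hZ.closure ▸ M.closure_subset_closure fun i hi => h1 i hi
    · exact hF

/-- Looplessness makes cl(∅) empty, so ∅ does not span the non-empty flat Z. This is what provides
the augmentation of ℂ[Σ_{M^Z,∅}]. -/
theorem empty_mem_bergmanFan_restrict [Fintype α] [M.Loopless] (hZ : Z ∈ properFlats M) :
    ∅ ∈ bergmanFan (M.restrict Z) ∅ := by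
  rw [mem_bergmanFan_restrict_iff hZ.1]
  refine ⟨by simp, by simp, fun h => hZ.2.1.ne_empty ?_⟩
  rw [← h]
  simpa [Matroid.loops] using M.loops_eq_empty

theorem mem_properFlats_contract_iff (hZ : Z ∈ properFlats M) {G : Set α} :
    G ∈ properFlats (M.contract Z) ↔ Disjoint G Z ∧ G ∪ Z ∈ flatsAbove M Z := by
  have hZE := hZ.1.subset_ground
  constructor
  · rintro ⟨h1, h2, h3⟩
    have hsub := h1.subset_ground
    rw [Matroid.contract_ground, Set.subset_sdiff] at hsub
    have hcl := h1.closure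
    rw [Matroid.contract_closure_eq] at hcl
    have hflat : M.IsFlat (G ∪ Z) := by
      rw [Matroid.isFlat_iff_closure_eq]
      have : Z ⊆ M.closure (G ∪ Z) :=
        Set.subset_union_right.trans (M.subset_closure _ (Set.union_subset hsub.1 hZE))
      nth_rewrite 2 [← hcl]
      rw [Set.sdiff_union_of_subset this]
    refine ⟨hsub.2, ⟨hflat, h2.mono Set.subset_union_left, fun h => h3 ?_⟩,
      Set.subset_union_right, fun h => ?_⟩
    · rw [Matroid.contract_ground, ← h, Set.union_sdiff_cancel_right (Set.disjoint_iff.1 hsub.2)]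
    · obtain ⟨x, hx⟩ := h2
      exact Set.disjoint_left.1 hsub.2 hx (h (Or.inl hx))
  · rintro ⟨h1, ⟨h2, -, h3⟩, h4⟩
    have h5 : (G ∪ Z) \ Z = G := Set.union_sdiff_cancel_right (Set.disjoint_iff.1 h1)
    refine ⟨?_, ?_, fun h => h3 ?_⟩
    · rw [Matroid.isFlat_iff_closure_eq, Matroid.contract_closure_eq, h2.closure, h5]
    · obtain ⟨x, hx, hxZ⟩ := Set.exists_of_ssubset h4
      exact ⟨x, hx.resolve_right hxZ⟩
    · rw [h, Matroid.contract_ground, Set.sdiff_union_of_subset hZE]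

theorem sdiff_mem_properFlats_contract (hZ : Z ∈ properFlats M) {F : Set α}
    (hF : F ∈ flatsAbove M Z) : F \ Z ∈ properFlats (M.contract Z) := by
  rw [mem_properFlats_contract_iff hZ, Set.sdiff_union_of_subset hF.2.1]
  exact ⟨Set.disjoint_sdiff_left, hF⟩

/-- With all proper flats in the filter, a non-empty I spans its own closure, which is forbidden; so
faces are chains of flats. The empty set causes no obstruction because Z is closed in M: its closure
in M_Z is empty. -/
theorem mem_bergmanFan_contract_iff [Fintype α] [M.Loopless] (hZ : Z ∈ properFlats M)
    {τ : Finset (α ⊕ Set α)} :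
    τ ∈ bergmanFan (M.contract Z) (properFlats (M.contract Z)) ↔ (∀ i, Sum.inl i ∉ τ) ∧
      (∀ G, Sum.inr G ∈ τ → G ∈ properFlats (M.contract Z)) ∧
      ∀ F G, Sum.inr F ∈ τ → Sum.inr G ∈ τ → F ⊆ G ∨ G ⊆ F := by
  have hflat : ∀ I, (M.contract Z).closure I ≠ ∅ →
      (M.contract Z).closure I ∈ insert (M.contract Z).E (properFlats (M.contract Z)) :=
    fun I hI => or_iff_not_imp_left.2 fun h =>
      ⟨Matroid.isFlat_closure _, Set.nonempty_iff_ne_empty.2 hI, h⟩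
  rw [mem_bergmanFan_iff subset_rfl]
  constructor
  · rintro ⟨h1, h2, h3, h4, h5⟩
    refine ⟨fun i hi => h5 _ (hflat _ fun h => ?_) rfl, h2, h3⟩
    have : i ∈ (M.contract Z).closure {i | Sum.inl i ∈ τ} := Matroid.subset_closure _ _ h1 hi
    rw [h] at this
    exact this
  · rintro ⟨h1, h2, h3⟩
    refine ⟨fun i hi => (h1 i hi).elim, h2, h3, fun i F hi => (h1 i hi).elim, fun F hF heq => ?_⟩
    have hempty : {i | Sum.inl i ∈ τ} = ∅ := Set.eq_empty_of_forall_notMem h1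
    rw [hempty, Matroid.contract_closure_eq, Set.empty_union, hZ.1.closure, Set.sdiff_self] at heq
    rcases hF with rfl | hF
    · rw [Matroid.contract_ground] at heq
      exact hZ.2.2 (subset_antisymm hZ.1.subset_ground (Set.sdiff_eq_empty.1 heq.symm))
    · exact hF.2.1.ne_empty heq.symm

end Faces

end

noncomputable section

/-! ### The homomorphism of Stanley--Reisner rings of a matroidal flip -/

section FlipMap

open MvPolynomial StanleyReisner

variable {α : Type*} {M : Matroid α} {P Pm Pp : Set (Set α)} {Z : Set α}

theorem bergmanFan_x_inl_eq_zero [Fintype α] (hP : P ⊆ properFlats M) {i : α} (hi : i ∉ M.E) :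
    x (bergmanFan M P) (Sum.inl i) = 0 := by
  refine x_eq_zero fun h => hi ?_
  rw [mem_bergmanFan_iff hP] at h
  exact h.1 i (by simp)

theorem bergmanFan_x_inr_eq_zero [Fintype α] (hP : P ⊆ properFlats M) {F : Set α} (hF : F ∉ P) :
    x (bergmanFan M P) (Sum.inr F) = 0 := by
  refine x_eq_zero fun h => hF ?_
  rw [mem_bergmanFan_iff hP] at h
  exact h.2.1 F (by simp)

theorem bergmanFan_x_inr_mul_x_inr [Fintype α] (hP : P ⊆ properFlats M) {F G : Set α} (h1 : ¬ F ⊆ G)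
    (h2 : ¬ G ⊆ F) :
    x (bergmanFan M P) (Sum.inr F) * x (bergmanFan M P) (Sum.inr G) = 0 := by
  classical
  refine x_mul_x_eq_zero (fun h => h1 (Sum.inr_injective h).le) fun h => ?_
  rw [mem_bergmanFan_iff hP] at h
  exact (h.2.2.1 F G (by simp) (by simp)).elim h1 h2

theorem bergmanFan_x_inl_mul_x_inr [Fintype α] (hP : P ⊆ properFlats M) {i : α} {F : Set α}
    (h1 : i ∉ F) :
    x (bergmanFan M P) (Sum.inl i) * x (bergmanFan M P) (Sum.inr F) = 0 := by
  classical
  refine x_mul_x_eq_zero Sum.inl_ne_inr fun h => h1 ?_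
  rw [mem_bergmanFan_iff hP] at h
  exact h.2.2.2.1 i F (by simp) (by simp)

open Classical in
/-- The substitution `x_i ↦ x_i + x_Z` for `i ∈ Z`, `x_Z ↦ 0`. -/
def flipSubst (Z : Set α) : MvPolynomial (α ⊕ Set α) ℂ →ₐ[ℂ] MvPolynomial (α ⊕ Set α) ℂ :=
  aeval (Sum.elim (fun i => X (Sum.inl i) + if i ∈ Z then X (Sum.inr Z) else 0)
    fun F => if F = Z then 0 else X (Sum.inr F))

open Classical in
theorem flipSubst_inl (Z : Set α) (i : α) : flipSubst Z (X (Sum.inl i)) =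
    X (Sum.inl i) + if i ∈ Z then X (Sum.inr Z) else 0 := by
  simp [flipSubst]

theorem flipSubst_inl_of_notMem {i : α} (hi : i ∉ Z) :
    flipSubst Z (X (Sum.inl i)) = X (Sum.inl i) := by
  simp [flipSubst_inl, hi]

open Classical in
theorem flipSubst_inr (Z F : Set α) : flipSubst Z (X (Sum.inr F)) =
    if F = Z then 0 else X (Sum.inr F) := by
  simp [flipSubst]

theorem flipSubst_inr_of_ne {F : Set α} (hF : F ≠ Z) :
    flipSubst Z (X (Sum.inr F)) = X (Sum.inr F) := by
  simp [flipSubst_inr, hF]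

theorem flipSubst_inr_self : flipSubst Z (X (Sum.inr Z)) = 0 := by
  simp [flipSubst_inr]

/-- The substitution changes a polynomial only by multiples of x_Z, which a annihilates. -/
theorem mul_proj_flipSubst {Δ : Set (Finset (α ⊕ Set α))} {a : StanleyReisner Δ}
    (ha : a * x Δ (Sum.inr Z) = 0) (p : MvPolynomial (α ⊕ Set α) ℂ) :
    a * proj Δ (flipSubst Z p) = a * proj Δ p := by
  induction p using MvPolynomial.induction_on with
  | C r => rw [← algebraMap_eq, AlgHom.commutes]
  | add p q hp hq => simp only [map_add, mul_add, hp, hq]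
  | mul_X p v hp =>
    rw [map_mul, map_mul, map_mul, mul_left_comm, ← mul_assoc, mul_comm _ a, hp, mul_assoc,
      mul_left_comm, mul_left_comm a]
    congr 1
    rcases v with i | F
    · rw [flipSubst_inl]
      split_ifs with hi
      · rw [map_add, mul_add, proj_X (Sum.inr Z), ha, add_zero]
      · rw [add_zero]
    · rw [flipSubst_inr]
      split_ifs with hF
      · rw [hF, proj_X, ha, map_zero, mul_zero]
      · rfl

theorem proj_flipSubst_X_mul {Δ : Set (Finset (α ⊕ Set α))} {v : α ⊕ Set α}
    (h1 : flipSubst Z (X v) = X v) (h2 : x Δ v * x Δ (Sum.inr Z) = 0)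
    (p : MvPolynomial (α ⊕ Set α) ℂ) :
    proj Δ (flipSubst Z (X v * p)) = proj Δ (X v * p) := by
  rw [map_mul, map_mul, map_mul, h1, proj_X, mul_proj_flipSubst h2]

/-- The homomorphism of Stanley--Reisner rings of the two stars of a matroidal flip. -/
def starHom (M : Matroid α) (Z : Set α) :
    StanleyReisner (lowerStar M Z) →ₐ[ℂ] StanleyReisner (upperStar M Z) :=
  StanleyReisner.lift ((proj _).comp (flipSubst Z)) fun s hs => by
    classical
    -- Here and in the similar constructions below the argument is contrapositive: a non-zero
    -- product of images forces the conditions for s to be a face, one after another.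
    by_contra hne
    have hF : ∀ F, Sum.inr F ∈ s → F ∈ flatsAbove M Z := fun F hF => by
      by_contra h
      refine hne (Finset.prod_eq_zero hF ?_)
      rw [AlgHom.comp_apply]
      by_cases hFZ : F = Z
      · rw [hFZ, flipSubst_inr_self, map_zero]
      · rw [flipSubst_inr_of_ne hFZ, proj_X, x_eq_zero]
        exact fun h' => (h'.2.2.1 F (by simp)).elim hFZ h
    refine hs ⟨fun i hi => ?_, hF, fun F G hF' hG' => ?_⟩
    · by_contra h
      refine hne (Finset.prod_eq_zero hi ?_)
      rw [AlgHom.comp_apply, flipSubst_inl_of_notMem h, proj_X, x_eq_zero]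
      exact fun h' => h (h'.1 i (by simp))
    · by_contra! h
      refine hne (Finset.prod_eq_zero_of_pair hF' hG'
        (fun h' => h.1 (Sum.inr_injective h').le) ?_)
      rw [AlgHom.comp_apply, AlgHom.comp_apply, flipSubst_inr_of_ne (hF F hF').2.ne',
        flipSubst_inr_of_ne (hF G hG').2.ne', proj_X, proj_X]
      refine x_mul_x_eq_zero (fun h' => h.1 (Sum.inr_injective h').le) fun h' => ?_
      exact (h'.2.2.2 F G (by simp) (by simp)).elim h.1 h.2

theorem starHom_proj (p : MvPolynomial (α ⊕ Set α) ℂ) :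
    starHom M Z (proj _ p) = proj _ (flipSubst Z p) := rfl

/-! ### The homomorphism ι and its behaviour on kernels. -/

variable [Fintype α] (hflip : IsMatroidalFlip M Pm Pp Z)
include hflip

/-- Two kinds of non-face need care. If i ∉ F, then (x_i + x_Z) x_F = 0 for i ∈ Z because Z and F
are incomparable. If I spans a member of P₋ ∪ {E}, then I has an element i outside Z; as x_i x_Z =
0, the substitution does not affect the product over I, which already vanishes in ℂ[Σ₊]. -/
theorem IsMatroidalFlip.prod_flipSubst_eq_zero {s : Finset (α ⊕ Set α)} (hs : s ∉ bergmanFan M Pm) :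
    ∏ v ∈ s, (proj (bergmanFan M Pp)).comp (flipSubst Z) (X v) = 0 := by
  classical
  by_contra hne
  have hPp := hflip.2.1.1
  have hE : ∀ i, Sum.inl i ∈ s → i ∈ M.E := fun i hi => by
    by_contra h
    refine hne (Finset.prod_eq_zero hi ?_)
    rw [AlgHom.comp_apply, flipSubst_inl_of_notMem fun h' => h (hflip.isFlat.subset_ground h'),
      proj_X, bergmanFan_x_inl_eq_zero hPp h]
  have hP : ∀ F, Sum.inr F ∈ s → F ∈ Pm := fun F hF => by
    by_contra h
    refine hne (Finset.prod_eq_zero hF ?_)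
    rw [AlgHom.comp_apply]
    by_cases hFZ : F = Z
    · rw [hFZ, flipSubst_inr_self, map_zero]
    · rw [flipSubst_inr_of_ne hFZ, proj_X, bergmanFan_x_inr_eq_zero hPp]
      rw [hflip.2.2.2]
      exact fun h' => h'.elim hFZ h
  have hP' : ∀ F, Sum.inr F ∈ s → (proj (bergmanFan M Pp)).comp (flipSubst Z) (X (Sum.inr F)) =
      x _ (Sum.inr F) := fun F hF => by
    rw [AlgHom.comp_apply, flipSubst_inr_of_ne (ne_of_mem_of_not_mem (hP F hF) hflip.2.2.1), proj_X]
  refine hs ((mem_bergmanFan_iff hflip.1.1).2 ⟨hE, hP, fun F G hF hG => ?_, fun i F hi hF => ?_,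
    fun G hG heq => ?_⟩)
  · by_contra! h
    refine hne (Finset.prod_eq_zero_of_pair hF hG
      (fun h' => h.1 (Sum.inr_injective h').le) ?_)
    rw [hP' F hF, hP' G hG]
    exact bergmanFan_x_inr_mul_x_inr hPp h.1 h.2
  · by_contra h
    refine hne (Finset.prod_eq_zero_of_pair hi hF Sum.inl_ne_inr ?_)
    rw [hP' F hF, AlgHom.comp_apply, flipSubst_inl, map_add, add_mul, proj_X,
      bergmanFan_x_inl_mul_x_inr hPp h, zero_add]
    split_ifs with hiZ
    · exact bergmanFan_x_inr_mul_x_inr hPp (fun h' => h (h' hiZ))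
        (hflip.not_subset (Set.mem_insert_of_mem _ (hP F hF)))
    · rw [map_zero, zero_mul]
  · obtain ⟨i, hi, hiZ⟩ : ∃ i, Sum.inl i ∈ s ∧ i ∉ Z := by
      by_contra! h
      exact hflip.closure_not_mem (I := {i | Sum.inl i ∈ s}) h hG heq
    set t := s.filter fun v => v.isLeft = true with ht
    have hit : Sum.inl i ∈ t := by simp [ht, hi]
    have htΔ : t ∉ bergmanFan M Pp := fun h => by
      rw [mem_bergmanFan_iff hPp] at h
      have hts : {i | Sum.inl i ∈ t} = {i | Sum.inl i ∈ s} := by ext; simp [ht]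
      exact h.2.2.2.2 G (Set.insert_subset_insert hflip.subset hG) (hts ▸ heq)
    refine hne (Finset.prod_eq_zero_of_subset (s := t) (Finset.filter_subset _ s) ?_)
    rw [← map_prod, ← Finset.mul_prod_erase t X hit, AlgHom.comp_apply,
      proj_flipSubst_X_mul (flipSubst_inl_of_notMem hiZ) (bergmanFan_x_inl_mul_x_inr hPp hiZ),
      Finset.mul_prod_erase t X hit, map_prod]
    exact prod_x_eq_zero htΔ

/-- The homomorphism of Stanley--Reisner rings of a matroidal flip. -/
def IsMatroidalFlip.hom : StanleyReisner (bergmanFan M Pm) →ₐ[ℂ] StanleyReisner (bergmanFan M Pp) :=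
  StanleyReisner.lift ((proj _).comp (flipSubst Z)) fun _ hs => hflip.prod_flipSubst_eq_zero hs

theorem IsMatroidalFlip.hom_proj (p : MvPolynomial (α ⊕ Set α) ℂ) :
    hflip.hom (proj _ p) = proj _ (flipSubst Z p) := rfl

open Classical in
theorem IsMatroidalFlip.hom_inl (i : α) : hflip.hom (x _ (Sum.inl i)) =
    x _ (Sum.inl i) + if i ∈ Z then x _ (Sum.inr Z) else 0 := by
  rw [← proj_X, hflip.hom_proj, flipSubst_inl, map_add, proj_X]
  split_ifs <;> simp

theorem IsMatroidalFlip.hom_inr {F : Set α} (hF : F ∈ Pm) :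
    hflip.hom (x _ (Sum.inr F)) = x _ (Sum.inr F) := by
  rw [← proj_X, hflip.hom_proj, flipSubst_inr_of_ne (ne_of_mem_of_not_mem hF hflip.2.2.1), proj_X]

/-- The sum over P₊ has the extra summand x_Z when i ∈ Z, and this is exactly what ι adds to x_i. -/
theorem IsMatroidalFlip.hom_structureMap (p : MvPolynomial α ℂ) :
    hflip.hom (structureMap M Pm p) = structureMap M Pp p := by
  classical
  refine DFunLike.congr_fun
    (MvPolynomial.algHom_ext (f := hflip.hom.comp (structureMap M Pm)) fun i => ?_) p
  rw [AlgHom.comp_apply, structureMap, structureMap, aeval_X, aeval_X, map_add, hflip.hom_inl,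
    map_sum, add_assoc]
  congr 1
  rw [Finset.sum_congr rfl fun F hF => hflip.hom_inr (Finset.mem_filter.1 hF).2.1,
    Finset.sum_filter, Finset.sum_filter]
  have h : (if i ∈ Z then x (bergmanFan M Pp) (Sum.inr Z) else 0) = ∑ F : Set α,
      if F = Z then (if i ∈ Z then x (bergmanFan M Pp) (Sum.inr Z) else 0) else 0 := by
    rw [Finset.sum_ite_eq' Finset.univ Z, if_pos (Finset.mem_univ _)]
  rw [h, ← Finset.sum_add_distrib]
  refine Finset.sum_congr rfl fun F _ => ?_
  rw [hflip.2.2.2]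
  by_cases hF : F = Z
  · subst hF
    simp [hflip.2.2.1]
  · simp [hF]

/-- A face outside the lower star contains some i ∉ Z or some flat not strictly above Z. The
corresponding variable is fixed by the substitution and annihilated by x_Z, so the whole monomial is
unchanged. -/
theorem IsMatroidalFlip.proj_flipSubst_of_support {p : MvPolynomial (α ⊕ Set α) ℂ}
    (hp : ∀ m ∈ p.support, m.support ∈ bergmanFan M Pm ∧ m.support ∉ lowerStar M Z) :
    proj (bergmanFan M Pp) (flipSubst Z p) = proj (bergmanFan M Pp) p := by
  classical
  rw [p.as_sum, map_sum, map_sum, map_sum]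
  refine Finset.sum_congr rfl fun m hm => ?_
  obtain ⟨h1, h2⟩ := hp m hm
  rw [mem_bergmanFan_iff hflip.1.1] at h1
  obtain ⟨v, hv, hv1, hv2⟩ : ∃ v ∈ m.support, flipSubst Z (X v) = X v ∧
      x (bergmanFan M Pp) v * x _ (Sum.inr Z) = 0 := by
    by_contra! h
    refine h2 ⟨fun i hi => ?_, fun F hF => ?_, h1.2.2.1⟩
    · by_contra hiZ
      exact h _ hi (flipSubst_inl_of_notMem hiZ) (bergmanFan_x_inl_mul_x_inr hflip.2.1.1 hiZ)
    · by_contra hFZ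
      have hFP := h1.2.1 F hF
      exact h _ hF (flipSubst_inr_of_ne (ne_of_mem_of_not_mem hFP hflip.2.2.1))
        (bergmanFan_x_inr_mul_x_inr hflip.2.1.1
          (hflip.not_subset (Set.mem_insert_of_mem _ hFP))
          fun h' => hFZ (hflip.mem_flatsAbove hFP h'))
  have hm' : monomial m (p.coeff m) = X v * monomial (m - Finsupp.single v 1) (p.coeff m) := by
    rw [X, monomial_mul, one_mul, add_tsub_cancel_of_le]
    exact Finsupp.single_le_iff.2 (Nat.one_le_iff_ne_zero.2 (Finsupp.mem_support_iff.1 hv))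
  rw [hm', proj_flipSubst_X_mul hv1 hv2]

theorem IsMatroidalFlip.restrict_hom (a : StanleyReisner (bergmanFan M Pm)) :
    restrict hflip.upperStar_subset (hflip.hom a) =
      starHom M Z (restrict hflip.lowerStar_subset a) := by
  obtain ⟨p, rfl⟩ := proj_surjective a
  rw [hflip.hom_proj, restrict_proj, restrict_proj, starHom_proj]

/-- Elements of the kernel of restriction have representatives with monomials on faces outside the
star. There the two complexes agree and ι is the identity on monomials, so it is an isomorphism
between the two kernels; the next lemma is the surjective half. -/
theorem IsMatroidalFlip.eq_zero_of_hom_eq_zero {a : StanleyReisner (bergmanFan M Pm)}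
    (h1 : restrict hflip.lowerStar_subset a = 0) (h2 : hflip.hom a = 0) : a = 0 := by
  obtain ⟨p, rfl⟩ := proj_surjective a
  obtain ⟨q, hq, hqp⟩ := exists_representative (isLowerSet_bergmanFan hflip.1)
    isLowerSet_lowerStar h1
  rw [← hqp] at h2 ⊢
  rw [hflip.hom_proj, hflip.proj_flipSubst_of_support hq,
    proj_eq_zero_iff (isLowerSet_bergmanFan hflip.2.1)] at h2
  refine (proj_eq_zero_iff (isLowerSet_bergmanFan hflip.1)).2 fun m hm => (h2 m hm ?_).elim
  have h3 : m.support ∈ bergmanFan M Pm \ lowerStar M Z := hq m hm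
  rw [hflip.diff_eq] at h3
  exact h3.1

theorem IsMatroidalFlip.exists_hom_eq {b : StanleyReisner (bergmanFan M Pp)}
    (h1 : restrict hflip.upperStar_subset b = 0) :
    ∃ a, restrict hflip.lowerStar_subset a = 0 ∧ hflip.hom a = b := by
  obtain ⟨p, rfl⟩ := proj_surjective b
  obtain ⟨q, hq, hqp⟩ := exists_representative (isLowerSet_bergmanFan hflip.2.1)
    (isLowerSet_upperStar hflip.isFlat) h1
  replace hq : ∀ m ∈ q.support, m.support ∈ bergmanFan M Pm ∧ m.support ∉ lowerStar M Z :=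
    fun m hm => by
      have h3 : m.support ∈ bergmanFan M Pp \ upperStar M Z := hq m hm
      rwa [← hflip.diff_eq] at h3
  refine ⟨proj _ q, ?_, ?_⟩
  · rw [restrict_proj, proj_eq_zero_iff isLowerSet_lowerStar]
    exact fun m hm => (hq m hm).2
  · rw [hflip.hom_proj, hflip.proj_flipSubst_of_support hq, hqp]

end FlipMap

end

noncomputable section

/-! ### The rings of the two stars of a flip as polynomial rings -/

section StarRings

open MvPolynomial StanleyReisner

variable {α : Type*}

/-- The Stanley--Reisner ring of `Σ_{M^Z,∅}`. -/
abbrev RestrictRing (M : Matroid α) (Z : Set α) : Type _ :=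
  StanleyReisner (bergmanFan (M.restrict Z) ∅)

/-- The Stanley--Reisner ring of `Σ_{M_Z}`. -/
abbrev ContractRing (M : Matroid α) (Z : Set α) : Type _ :=
  StanleyReisner (bergmanFan (M.contract Z) (properFlats (M.contract Z)))

/-- The polynomial ring on the elements of `Z` different from `i₀`. -/
abbrev FreeVarRing (Z : Set α) (i₀ : α) : Type _ := MvPolynomial {i // i ∈ Z ∧ i ≠ i₀} ℂ

/-- The polynomial ring in one indeterminate over `R ⊗ Q`. -/
abbrev PolyTensor (R Q : Type*) [CommRing R] [Algebra ℂ R] [CommRing Q] [Algebra ℂ Q] : Type _ :=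
  Polynomial (R ⊗[ℂ] Q)

/-- The embedding of `R` into `(R ⊗ Q)[y]`. -/
def polyLeft (R Q : Type*) [CommRing R] [Algebra ℂ R] [CommRing Q] [Algebra ℂ Q] :
    R →ₐ[ℂ] PolyTensor R Q :=
  Polynomial.CAlgHom.comp Algebra.TensorProduct.includeLeft

/-- The embedding of `Q` into `(R ⊗ Q)[y]`. -/
def polyRight (R Q : Type*) [CommRing R] [Algebra ℂ R] [CommRing Q] [Algebra ℂ Q] :
    Q →ₐ[ℂ] PolyTensor R Q :=
  Polynomial.CAlgHom.comp Algebra.TensorProduct.includeRight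

theorem polyLeft_apply {R Q : Type*} [CommRing R] [Algebra ℂ R] [CommRing Q] [Algebra ℂ Q]
    (r : R) : polyLeft R Q r = Polynomial.C (r ⊗ₜ 1) := rfl

theorem polyRight_apply {R Q : Type*} [CommRing R] [Algebra ℂ R] [CommRing Q] [Algebra ℂ Q]
    (q : Q) : polyRight R Q q = Polynomial.C (1 ⊗ₜ q) := rfl

variable {M : Matroid α} {Z : Set α} {i₀ : α}

open Classical in
/-- The class `x_{F ∖ Z}` for a proper flat `F` which contains `Z` strictly. -/
def aboveElt (M : Matroid α) (Z F : Set α) : ContractRing M Z :=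
  if F ∈ flatsAbove M Z then x _ (Sum.inr (F \ Z)) else 0

theorem aboveElt_of_mem {F : Set α} (hF : F ∈ flatsAbove M Z) :
    aboveElt M Z F = x _ (Sum.inr (F \ Z)) := if_pos hF

theorem aboveElt_of_notMem {F : Set α} (hF : F ∉ flatsAbove M Z) : aboveElt M Z F = 0 := if_neg hF

theorem aboveElt_self : aboveElt M Z Z = 0 := aboveElt_of_notMem fun h => h.2.ne rfl

open Classical in
/-- The element `x_i` of the polynomial ring, with `x_{i₀} = 0`. -/
def freeElt (Z : Set α) (i₀ i : α) : FreeVarRing Z i₀ :=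
  if h : i ∈ Z ∧ i ≠ i₀ then X ⟨i, h⟩ else 0

theorem freeElt_coe (j : {i // i ∈ Z ∧ i ≠ i₀}) : freeElt Z i₀ j = X j := dif_pos j.2

theorem freeElt_self : freeElt Z i₀ i₀ = 0 := dif_neg fun h => h.2 rfl

theorem freeElt_of_notMem {i : α} (hi : i ∉ Z) : freeElt Z i₀ i = 0 := dif_neg fun h => hi h.1

variable [Fintype α]

theorem aboveElt_mul_aboveElt {F G : Set α} (h1 : ¬ F ⊆ G) (h2 : ¬ G ⊆ F) :
    aboveElt M Z F * aboveElt M Z G = 0 := by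
  by_cases hF : F ∈ flatsAbove M Z; swap
  · rw [aboveElt_of_notMem hF, zero_mul]
  by_cases hG : G ∈ flatsAbove M Z; swap
  · rw [aboveElt_of_notMem hG, mul_zero]
  rw [aboveElt_of_mem hF, aboveElt_of_mem hG]
  refine bergmanFan_x_inr_mul_x_inr subset_rfl (fun h => h1 ?_) fun h => h2 ?_
  · rw [← Set.sdiff_union_of_subset hF.2.1, ← Set.sdiff_union_of_subset hG.2.1]
    exact Set.union_subset_union_left Z h
  · rw [← Set.sdiff_union_of_subset hF.2.1, ← Set.sdiff_union_of_subset hG.2.1]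
    exact Set.union_subset_union_left Z h

theorem restrictRing_x_inr (hZ : M.IsFlat Z) (F : Set α) :
    x (bergmanFan (M.restrict Z) ∅) (Sum.inr F) = 0 := by
  refine x_eq_zero fun h => ?_
  rw [mem_bergmanFan_restrict_iff hZ] at h
  exact h.2.1 F (by simp)

theorem restrictRing_x_inl (hZ : M.IsFlat Z) {i : α} (hi : i ∉ Z) :
    x (bergmanFan (M.restrict Z) ∅) (Sum.inl i) = 0 := by
  refine x_eq_zero fun h => hi ?_
  rw [mem_bergmanFan_restrict_iff hZ] at h
  exact h.1 i (by simp)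

theorem contractRing_x_inl [M.Loopless] (hZ : Z ∈ properFlats M) (i : α) :
    x (bergmanFan (M.contract Z) (properFlats (M.contract Z))) (Sum.inl i) = 0 := by
  refine x_eq_zero fun h => ?_
  rw [mem_bergmanFan_contract_iff hZ] at h
  exact h.1 i (by simp)

open Classical in
/-- The homomorphism `x_G ↦ x_{G ∪ Z}`. -/
def aboveMap [M.Loopless] (hZ : Z ∈ properFlats M) (T : Set (Finset (α ⊕ Set α)))
    (hT : ∀ τ ∈ T, ∀ F G, Sum.inr F ∈ τ → Sum.inr G ∈ τ → F ⊆ G ∨ G ⊆ F) :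
    ContractRing M Z →ₐ[ℂ] StanleyReisner T :=
  StanleyReisner.lift (aeval (Sum.elim (fun _ => 0) fun G =>
    if G ∈ properFlats (M.contract Z) then x T (Sum.inr (G ∪ Z)) else 0)) fun s hs => by
    by_contra hne
    have hG : ∀ G, Sum.inr G ∈ s → G ∈ properFlats (M.contract Z) := fun G hG => by
      by_contra h
      exact hne (Finset.prod_eq_zero hG (by simp [h]))
    refine hs ((mem_bergmanFan_contract_iff hZ).2
      ⟨fun i hi => hne (Finset.prod_eq_zero hi (by simp)), hG, fun F G hF' hG' => ?_⟩)
    by_contra! h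
    have hsub : ∀ {F G : Set α}, Disjoint F Z → F ∪ Z ⊆ G ∪ Z → F ⊆ G := fun hd hFG a ha =>
      (hFG (Or.inl ha)).resolve_right (Set.disjoint_left.1 hd ha)
    have h1 := fun h' => h.1 (hsub ((mem_properFlats_contract_iff hZ).1 (hG F hF')).1 h')
    have h2 := fun h' => h.2 (hsub ((mem_properFlats_contract_iff hZ).1 (hG G hG')).1 h')
    refine hne (Finset.prod_eq_zero_of_pair hF' hG'
        (fun h' => h.1 (Sum.inr_injective h').le) ?_)
    simp only [aeval_X, Sum.elim_inr, if_pos (hG F hF'), if_pos (hG G hG')]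
    refine x_mul_x_eq_zero (fun h' => h1 (Sum.inr_injective h').le) fun h' => ?_
    exact (hT _ h' _ _ (by simp) (by simp)).elim h1 h2

theorem aboveMap_inr [M.Loopless] (hZ : Z ∈ properFlats M) (T : Set (Finset (α ⊕ Set α)))
    (hT : ∀ τ ∈ T, ∀ F G, Sum.inr F ∈ τ → Sum.inr G ∈ τ → F ⊆ G ∨ G ⊆ F) {G : Set α}
    (hG : G ∈ properFlats (M.contract Z)) :
    aboveMap hZ T hT (x _ (Sum.inr G)) = x T (Sum.inr (G ∪ Z)) := by
  simp [aboveMap, hG]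

theorem aboveMap_aboveElt [M.Loopless] (hZ : Z ∈ properFlats M) (T : Set (Finset (α ⊕ Set α)))
    (hT : ∀ τ ∈ T, ∀ F G, Sum.inr F ∈ τ → Sum.inr G ∈ τ → F ⊆ G ∨ G ⊆ F) {F : Set α}
    (hF : F ∈ flatsAbove M Z) :
    aboveMap hZ T hT (aboveElt M Z F) = x T (Sum.inr F) := by
  rw [aboveElt_of_mem hF, aboveMap_inr hZ T hT (sdiff_mem_properFlats_contract hZ hF),
    Set.sdiff_union_of_subset hF.2.1]

omit [Fintype α] in
theorem aboveElt_union (hZ : Z ∈ properFlats M) {G : Set α}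
    (hG : G ∈ properFlats (M.contract Z)) : aboveElt M Z (G ∪ Z) = x _ (Sum.inr G) := by
  have h := (mem_properFlats_contract_iff hZ).1 hG
  rw [aboveElt_of_mem h.2, Set.union_sdiff_cancel_right (Set.disjoint_iff.1 h.1)]

/-- The homomorphism `x_i ↦ x_i`. -/
def restrictMap (hZ : M.IsFlat Z) : RestrictRing M Z →ₐ[ℂ] StanleyReisner (upperStar M Z) :=
  StanleyReisner.lift (aeval (Sum.elim (fun i => x _ (Sum.inl i)) fun _ => 0)) fun s hs => by
    by_contra hne
    have hr : ∀ F, Sum.inr F ∉ s := fun F hF => hne (Finset.prod_eq_zero hF (by simp))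
    have hs' : s ∉ upperStar M Z := fun h => hs ((mem_bergmanFan_restrict_iff hZ).2
      ⟨h.1, hr, h.2.1⟩)
    refine hne (Eq.trans (Finset.prod_congr rfl fun v hv => ?_) (prod_x_eq_zero hs'))
    rcases v with i | F
    · simp
    · exact (hr F hv).elim

@[simp] theorem restrictMap_inl (hZ : M.IsFlat Z) (i : α) :
    restrictMap hZ (x _ (Sum.inl i)) = x _ (Sum.inl i) := by simp [restrictMap]

open Classical in
/-- The isomorphism from the ring of the upper star to a polynomial ring, as a homomorphism. -/
def upperToPoly (hZ : M.IsFlat Z) : StanleyReisner (upperStar M Z) →ₐ[ℂ]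
    PolyTensor (RestrictRing M Z) (ContractRing M Z) :=
  StanleyReisner.lift (aeval (Sum.elim (fun i => polyLeft _ _ (x _ (Sum.inl i)))
    fun F => if F = Z then Polynomial.X else polyRight _ _ (aboveElt M Z F))) fun s hs => by
    by_contra hne
    have hF : ∀ F, Sum.inr F ∈ s → F = Z ∨ F ∈ flatsAbove M Z := fun F hF => by
      by_contra! h
      exact hne (Finset.prod_eq_zero hF (by simp [h.1, aboveElt_of_notMem h.2]))
    refine hs ⟨fun i hi => ?_, fun heq => ?_, hF, fun F G hF' hG' => ?_⟩
    · by_contra h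
      exact hne (Finset.prod_eq_zero hi (by simp [restrictRing_x_inl hZ h]))
    · let t := s.filter fun v => v.isLeft = true
      have ht : t ∉ bergmanFan (M.restrict Z) ∅ := fun h => by
        rw [mem_bergmanFan_restrict_iff hZ] at h
        have hts : {i | Sum.inl i ∈ t} = {i | Sum.inl i ∈ s} := by ext; simp [t]
        exact h.2.2 (hts ▸ heq)
      refine hne (Finset.prod_eq_zero_of_subset (s := t) (Finset.filter_subset _ s) ?_)
      have : ∀ v ∈ t, (aeval (Sum.elim (fun i => polyLeft _ _ (x _ (Sum.inl i)))
          fun F => if F = Z then Polynomial.X else polyRight _ _ (aboveElt M Z F)))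
            (X v : MvPolynomial _ ℂ) =
          polyLeft (RestrictRing M Z) (ContractRing M Z) (x _ v) := by
        rintro (i | F) hv
        · simp
        · simp [t] at hv
      rw [Finset.prod_congr rfl this, ← map_prod, prod_x_eq_zero ht, map_zero]
    · by_contra! h
      refine hne (Finset.prod_eq_zero_of_pair hF' hG'
        (fun h' => h.1 (Sum.inr_injective h').le) ?_)
      rcases hF F hF' with rfl | hF1
      · rcases hF G hG' with rfl | hG1
        · exact (h.1 subset_rfl).elim
        · exact (h.1 hG1.2.1).elim
      · rcases hF G hG' with rfl | hG1
        · exact (h.2 hF1.2.1).elim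
        · simp only [aeval_X, Sum.elim_inr, if_neg hF1.2.ne', if_neg hG1.2.ne']
          rw [← map_mul, aboveElt_mul_aboveElt h.1 h.2, map_zero]

@[simp] theorem upperToPoly_inl (hZ : M.IsFlat Z) (i : α) :
    upperToPoly hZ (x _ (Sum.inl i)) = polyLeft _ _ (x _ (Sum.inl i)) := by simp [upperToPoly]

@[simp] theorem upperToPoly_center (hZ : M.IsFlat Z) :
    upperToPoly hZ (x _ (Sum.inr Z)) = Polynomial.X := by simp [upperToPoly]

theorem upperToPoly_inr (hZ : M.IsFlat Z) {F : Set α} (hF : F ≠ Z) :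
    upperToPoly hZ (x _ (Sum.inr F)) = polyRight _ _ (aboveElt M Z F) := by
  simp [upperToPoly, hF]

open Classical in
/-- The isomorphism from the ring of the lower star to a polynomial ring, as a homomorphism. -/
def lowerToPoly (M : Matroid α) (Z : Set α) (i₀ : α) : StanleyReisner (lowerStar M Z) →ₐ[ℂ]
    PolyTensor (FreeVarRing Z i₀) (ContractRing M Z) :=
  StanleyReisner.lift (aeval (Sum.elim
    (fun i => polyLeft _ _ (freeElt Z i₀ i) + if i ∈ Z then Polynomial.X else 0)
    fun F => polyRight _ _ (aboveElt M Z F))) fun s hs => by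
    by_contra hne
    have hF : ∀ F, Sum.inr F ∈ s → F ∈ flatsAbove M Z := fun F hF => by
      by_contra! h
      exact hne (Finset.prod_eq_zero hF (by simp [aboveElt_of_notMem h]))
    refine hs ⟨fun i hi => ?_, hF, fun F G hF' hG' => ?_⟩
    · by_contra h
      exact hne (Finset.prod_eq_zero hi (by simp [freeElt_of_notMem h, h]))
    · by_contra! h
      refine hne (Finset.prod_eq_zero_of_pair hF' hG'
        (fun h' => h.1 (Sum.inr_injective h').le) ?_)
      simp only [aeval_X, Sum.elim_inr]
      rw [← map_mul, aboveElt_mul_aboveElt h.1 h.2, map_zero]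

open Classical in
@[simp] theorem lowerToPoly_inl (i : α) : lowerToPoly M Z i₀ (x _ (Sum.inl i)) =
    polyLeft _ _ (freeElt Z i₀ i) + if i ∈ Z then Polynomial.X else 0 := by simp [lowerToPoly]

@[simp] theorem lowerToPoly_inr (F : Set α) :
    lowerToPoly M Z i₀ (x _ (Sum.inr F)) = polyRight _ _ (aboveElt M Z F) := by
  simp [lowerToPoly]

theorem algHom_ext_contractRing [M.Loopless] (hZ : Z ∈ properFlats M) {A : Type*} [Semiring A]
    [Algebra ℂ A] {f g : ContractRing M Z →ₐ[ℂ] A}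
    (h : ∀ G ∈ properFlats (M.contract Z), f (x _ (Sum.inr G)) = g (x _ (Sum.inr G))) : f = g := by
  refine StanleyReisner.algHom_ext fun v => ?_
  rcases v with i | G
  · rw [contractRing_x_inl hZ, map_zero, map_zero]
  · by_cases hG : G ∈ properFlats (M.contract Z)
    · exact h G hG
    · rw [bergmanFan_x_inr_eq_zero subset_rfl hG, map_zero, map_zero]

theorem polynomial_tensor_algHom_ext {R Q A : Type*} [CommRing R] [Algebra ℂ R] [CommRing Q]
    [Algebra ℂ Q] [Semiring A] [Algebra ℂ A] {f g : PolyTensor R Q →ₐ[ℂ] A}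
    (h1 : f.comp (polyLeft R Q) = g.comp (polyLeft R Q))
    (h2 : f.comp (polyRight R Q) = g.comp (polyRight R Q))
    (h3 : f Polynomial.X = g Polynomial.X) : f = g :=
  Polynomial.algHom_ext' (Algebra.TensorProduct.ext h1 h2) h3

/-- The homomorphism from `(R ⊗ Q)[y]` with prescribed restrictions to `R` and `Q` and a prescribed
value at `y`. -/
def polyDesc {R Q A : Type*} [CommRing R] [Algebra ℂ R] [CommRing Q] [Algebra ℂ Q] [CommRing A]
    [Algebra ℂ A] (f : R →ₐ[ℂ] A) (g : Q →ₐ[ℂ] A) (y : A) : PolyTensor R Q →ₐ[ℂ] A :=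
  Polynomial.eval₂AlgHom (Algebra.TensorProduct.productMap f g) y fun _ => Commute.all _ _

section PolyDesc

variable {R Q A : Type*} [CommRing R] [Algebra ℂ R] [CommRing Q] [Algebra ℂ Q] [CommRing A]
  [Algebra ℂ A] (f : R →ₐ[ℂ] A) (g : Q →ₐ[ℂ] A) (y : A)

@[simp] theorem polyDesc_left (r : R) : polyDesc f g y (polyLeft R Q r) = f r := by
  refine (Polynomial.eval₂_C _ _).trans ?_
  simp

@[simp] theorem polyDesc_right (q : Q) : polyDesc f g y (polyRight R Q q) = g q := by
  refine (Polynomial.eval₂_C _ _).trans ?_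
  simp

@[simp] theorem polyDesc_X : polyDesc f g y Polynomial.X = y := Polynomial.eval₂_X _ _

end PolyDesc

variable [M.Loopless] (hZ : Z ∈ properFlats M)

/-- The isomorphism from the ring of the upper star to a polynomial ring. -/
def upperEquiv : StanleyReisner (upperStar M Z) ≃ₐ[ℂ]
    PolyTensor (RestrictRing M Z) (ContractRing M Z) :=
  AlgEquiv.ofAlgHom (upperToPoly hZ.1)
    (polyDesc (restrictMap hZ.1) (aboveMap hZ (upperStar M Z) fun _ h => h.2.2.2)
      (x (upperStar M Z) (Sum.inr Z)))
    (by
      refine polynomial_tensor_algHom_ext (R := RestrictRing M Z) (Q := ContractRing M Z) ?_ ?_ ?_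
      · refine StanleyReisner.algHom_ext fun v => ?_
        rcases v with i | F
        · simp
        · rw [restrictRing_x_inr hZ.1, map_zero, map_zero]
      · refine algHom_ext_contractRing hZ fun G hG => ?_
        have h := (mem_properFlats_contract_iff hZ).1 hG
        simp [aboveMap_inr hZ _ _ hG, upperToPoly_inr hZ.1 h.2.2.ne', aboveElt_union hZ hG]
      · simp)
    (by
      refine StanleyReisner.algHom_ext fun v => ?_
      rcases v with i | F
      · simp
      · by_cases hFZ : F = Z
        · rw [hFZ]
          simp
        by_cases hF : F ∈ flatsAbove M Z
        · simp [upperToPoly_inr hZ.1 hFZ, aboveMap_aboveElt hZ _ _ hF]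
        · have h0 : x (upperStar M Z) (Sum.inr F) = 0 :=
            x_eq_zero fun h => (h.2.2.1 F (by simp)).elim hFZ hF
          rw [h0, map_zero, map_zero])

/-- The isomorphism from the ring of the lower star to a polynomial ring. -/
def lowerEquiv (hi₀ : i₀ ∈ Z) : StanleyReisner (lowerStar M Z) ≃ₐ[ℂ]
    PolyTensor (FreeVarRing Z i₀) (ContractRing M Z) :=
  AlgEquiv.ofAlgHom (lowerToPoly M Z i₀)
    -- The coordinates are y = x_{i₀} and the differences x_i - x_{i₀}. Adding x_Z to every x_i, i ∈
    -- Z, moves only y.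
    (polyDesc (aeval fun j : {i // i ∈ Z ∧ i ≠ i₀} =>
        x (lowerStar M Z) (Sum.inl j.1) - x (lowerStar M Z) (Sum.inl i₀))
      (aboveMap hZ (lowerStar M Z) fun _ h => h.2.2) (x (lowerStar M Z) (Sum.inl i₀)))
    (by
      refine polynomial_tensor_algHom_ext (R := FreeVarRing Z i₀) (Q := ContractRing M Z) ?_ ?_ ?_
      · refine MvPolynomial.algHom_ext fun j => ?_
        simp [freeElt_coe, freeElt_self, hi₀, j.2.1]
      · refine algHom_ext_contractRing hZ fun G hG => ?_
        simp [aboveMap_inr hZ _ _ hG, aboveElt_union hZ hG]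
      · simp [hi₀, freeElt_self])
    (by
      refine StanleyReisner.algHom_ext fun v => ?_
      rcases v with i | F
      · by_cases hi : i ∈ Z
        · by_cases hii : i = i₀
          · rw [hii]
            simp [freeElt_self, hi₀]
          · have : freeElt Z i₀ i = X ⟨i, hi, hii⟩ := dif_pos ⟨hi, hii⟩
            simp [this, hi]
        · have h0 : x (lowerStar M Z) (Sum.inl i) = 0 := x_eq_zero fun h => hi (h.1 i (by simp))
          rw [h0, map_zero, map_zero]
      · by_cases hF : F ∈ flatsAbove M Z
        · simp [aboveMap_aboveElt hZ _ _ hF]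
        · have h0 : x (lowerStar M Z) (Sum.inr F) = 0 := x_eq_zero fun h => hF (h.2.1 F (by simp))
          rw [h0, map_zero, map_zero])

/-! #### Killing the difference of two coordinates -/

section Evaluation

variable {B R : Type*} [CommRing B] [Algebra ℂ B] [CommRing R] [Algebra ℂ R]
  (θ : B ≃ₐ[ℂ] Polynomial R) {ℓ : B} {r : R}

/-- The evaluation at `r` of the polynomials in the ring `B ≅ R[y]`. -/
def evalAt (θ : B ≃ₐ[ℂ] Polynomial R) (r : R) : B →ₐ[ℂ] R :=
  ((Polynomial.aeval (R := R) r).restrictScalars ℂ).comp θ.toAlgHom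

theorem evalAt_apply (b : B) : evalAt θ r b = (θ b).eval r := by
  simp [evalAt]

theorem evalAt_surjective : Function.Surjective (evalAt θ r) := fun a =>
  ⟨θ.symm (Polynomial.C a), by simp [evalAt_apply]⟩

include θ in
theorem mul_injective_of_polynomial (h : θ ℓ = Polynomial.X - Polynomial.C r) :
    Function.Injective (LinearMap.mulLeft ℂ ℓ) := fun a b hab => by
  refine θ.injective ((Polynomial.monic_X_sub_C r).isRegular.left ?_)
  have := congrArg θ hab
  simpa [h] using this

/-- The factor theorem: a polynomial with root r is divisible by X - r. -/
theorem exact_mul_evalAt (h : θ ℓ = Polynomial.X - Polynomial.C r) :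
    Function.Exact (LinearMap.mulLeft ℂ ℓ) (evalAt θ r) := fun b => by
  rw [evalAt_apply, ← Polynomial.IsRoot.def, ← Polynomial.dvd_iff_isRoot]
  constructor
  · rintro ⟨c, hc⟩
    refine ⟨θ.symm c, θ.injective ?_⟩
    simp [h, hc]
  · rintro ⟨c, rfl⟩
    simp [h]

end Evaluation

end StarRings

end

noncomputable section

/-! ### Graded long exact sequences -/

section GradedSequence

variable {k : Type*} [Field k]

theorem exists_lift_of_injective {V T T' : Type*} [AddCommGroup V] [Module k V] [AddCommGroup T]
    [Module k T] [AddCommGroup T'] [Module k T'] (j' : T' →ₗ[k] V) (hj' : Function.Injective j')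
    (φ : T →ₗ[k] V) (h : ∀ x, φ x ∈ LinearMap.range j') :
    ∃ f : T →ₗ[k] T', ∀ x, j' (f x) = φ x := by
  refine ⟨(LinearEquiv.ofInjective j' hj').symm.toLinearMap ∘ₗ φ.codRestrict _ h, fun x => ?_⟩
  exact congrArg Subtype.val
    ((LinearEquiv.ofInjective j' hj').apply_symm_apply (φ.codRestrict _ h x))

variable {H₁ H₂ H₃ : Type*} [AddCommGroup H₁] [Module k H₁] [AddCommGroup H₂] [Module k H₂]
  [AddCommGroup H₃] [Module k H₃]

theorem mem_eigenspace_map {f : Module.End k H₁} {g : Module.End k H₂} (F : H₁ →ₗ[k] H₂) {c : k}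
    (hF : ∀ v, g (F v) = c • F (f v)) {β : k} {v : H₁} (hv : v ∈ f.eigenspace β) :
    F v ∈ g.eigenspace (c * β) := by
  rw [Module.End.mem_eigenspace_iff] at hv ⊢
  rw [hF, hv, map_smul, smul_smul]

variable [CharZero k]

/-- An exact triangle of spaces with diagonalizable grading operators, the third map of which has
bidegree `(-1, 1)`, gives a long exact sequence of the bigraded pieces. -/
theorem exists_long_exact_sequence {Γ₁ : Module.End k H₁} {Γ₂ : Module.End k H₂}
    {Γ₃ : Module.End k H₃}
    (hΓ₁ : ⨆ i, Γ₁.eigenspace (bigradedWeight k i) = ⊤)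
    (hΓ₂ : ⨆ i, Γ₂.eigenspace (bigradedWeight k i) = ⊤)
    (hΓ₃ : ⨆ i, Γ₃.eigenspace (bigradedWeight k i) = ⊤)
    (F : H₁ →ₗ[k] H₂) (G : H₂ →ₗ[k] H₃) (Δ : H₃ →ₗ[k] H₁)
    (hF : ∀ v, Γ₂ (F v) = F (Γ₁ v)) (hG : ∀ v, Γ₃ (G v) = G (Γ₂ v))
    (hΔ : ∀ v, Γ₁ (Δ v) = (2⁻¹ * 3 : k) • Δ (Γ₃ v))
    (hFG : Function.Exact F G) (hGΔ : Function.Exact G Δ) (hΔF : Function.Exact Δ F)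
    {T₁ T₂ T₃ : ℕ → ℕ → Type*} [∀ t s, AddCommGroup (T₁ t s)] [∀ t s, Module k (T₁ t s)]
    [∀ t s, AddCommGroup (T₂ t s)] [∀ t s, Module k (T₂ t s)]
    [∀ t s, AddCommGroup (T₃ t s)] [∀ t s, Module k (T₃ t s)]
    (j₁ : ∀ t s, T₁ t s →ₗ[k] H₁) (j₂ : ∀ t s, T₂ t s →ₗ[k] H₂) (j₃ : ∀ t s, T₃ t s →ₗ[k] H₃)
    (hj₁ : ∀ t s, Function.Injective (j₁ t s)) (hj₂ : ∀ t s, Function.Injective (j₂ t s))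
    (hj₃ : ∀ t s, Function.Injective (j₃ t s))
    (hr₁ : ∀ t s, LinearMap.range (j₁ t s) = Γ₁.eigenspace (bigradedWeight k (t, s)))
    (hr₂ : ∀ t s, LinearMap.range (j₂ t s) = Γ₂.eigenspace (bigradedWeight k (t, s)))
    (hr₃ : ∀ t s, LinearMap.range (j₃ t s) = Γ₃.eigenspace (bigradedWeight k (t, s))) :
    ∃ (f : ∀ t s, T₁ t s →ₗ[k] T₂ t s) (g : ∀ t s, T₂ t s →ₗ[k] T₃ t s)
      (δ : ∀ t s, T₃ (t + 1) s →ₗ[k] T₁ t (s + 1)),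
      (∀ t s x, j₂ t s (f t s x) = F (j₁ t s x)) ∧
      (∀ t s, Function.Exact (f t s) (g t s)) ∧
      (∀ t s, Function.Exact (g (t + 1) s) (δ t s)) ∧
      (∀ t s, Function.Exact (δ t s) (f t (s + 1))) ∧
      (∀ t, Function.Injective (f t 0)) ∧
      ∀ s, Function.Surjective (g 0 s) := by
  have h2 : (2 : k) ≠ 0 := two_ne_zero
  have h3 : (3 : k) ≠ 0 := three_ne_zero
  have hc : (2⁻¹ * 3 : k) ≠ 0 := mul_ne_zero (inv_ne_zero h2) h3
  -- The factor 3/2 in the commutation rule of Δ is precisely the passage from bidegree (t + 1, s)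
  -- to (t, s + 1).
  have hw : ∀ t s, (2⁻¹ * 3 : k) * bigradedWeight k (t + 1, s) = bigradedWeight k (t, s + 1) :=
    fun t s => by simp only [bigradedWeight]; field_simp; ring
  have hw' : ∀ t s, (2⁻¹ * 3 : k)⁻¹ * bigradedWeight k (t, s + 1) = bigradedWeight k (t + 1, s) :=
    fun t s => by rw [← hw, inv_mul_cancel_left₀ hc]
  have hF' : ∀ v, Γ₂ (F v) = (1 : k) • F (Γ₁ v) := fun v => by rw [hF, one_smul]
  have hG' : ∀ v, Γ₃ (G v) = (1 : k) • G (Γ₂ v) := fun v => by rw [hG, one_smul]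
  choose f hf using fun t s => exists_lift_of_injective (j₂ t s) (hj₂ t s) (F ∘ₗ j₁ t s) fun x => by
    rw [hr₂, ← one_mul (bigradedWeight k (t, s))]
    exact mem_eigenspace_map F hF' (hr₁ t s ▸ ⟨x, rfl⟩)
  choose g hg using fun t s => exists_lift_of_injective (j₃ t s) (hj₃ t s) (G ∘ₗ j₂ t s) fun x => by
    rw [hr₃, ← one_mul (bigradedWeight k (t, s))]
    exact mem_eigenspace_map G hG' (hr₂ t s ▸ ⟨x, rfl⟩)
  choose δ hδ using fun t s => exists_lift_of_injective (j₁ t (s + 1)) (hj₁ t (s + 1))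
    (Δ ∘ₗ j₃ (t + 1) s) fun x => by
      rw [hr₁, ← hw]
      exact mem_eigenspace_map Δ hΔ (hr₃ (t + 1) s ▸ ⟨x, rfl⟩)
  simp only [LinearMap.comp_apply] at hf hg hδ
  have hpre₁ := iSup_eigenspace_eq_top_of_family hΓ₁
  have hpre₂ := iSup_eigenspace_eq_top_of_family hΓ₂
  have hpre₃ := iSup_eigenspace_eq_top_of_family hΓ₃
  have hmem₁ : ∀ t s x, j₁ t s x ∈ Γ₁.eigenspace (bigradedWeight k (t, s)) := fun t s x =>
    hr₁ t s ▸ ⟨x, rfl⟩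
  have hmem₂ : ∀ t s x, j₂ t s x ∈ Γ₂.eigenspace (bigradedWeight k (t, s)) := fun t s x =>
    hr₂ t s ▸ ⟨x, rfl⟩
  have hmem₃ : ∀ t s x, j₃ t s x ∈ Γ₃.eigenspace (bigradedWeight k (t, s)) := fun t s x =>
    hr₃ t s ▸ ⟨x, rfl⟩
  have hfg : ∀ t s, Function.Exact (f t s) (g t s) := fun t s y => by
    rw [← (hj₃ t s).eq_iff, hg, map_zero, hFG]
    constructor
    · rintro ⟨v, hv⟩
      obtain ⟨v', hv', h⟩ := exists_eigenvector_preimage hpre₁ F one_ne_zero hF'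
        (hv ▸ hmem₂ t s y)
      rw [inv_one, one_mul, ← hr₁] at hv'
      obtain ⟨x, rfl⟩ := hv'
      exact ⟨x, hj₂ t s (by rw [hf, h, hv])⟩
    · rintro ⟨x, rfl⟩
      exact ⟨j₁ t s x, (hf t s x).symm⟩
  have hgδ : ∀ t s, Function.Exact (g (t + 1) s) (δ t s) := fun t s y => by
    rw [← (hj₁ t (s + 1)).eq_iff, hδ, map_zero, hGΔ]
    constructor
    · rintro ⟨v, hv⟩
      obtain ⟨v', hv', h⟩ := exists_eigenvector_preimage hpre₂ G one_ne_zero hG'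
        (hv ▸ hmem₃ (t + 1) s y)
      rw [inv_one, one_mul, ← hr₂] at hv'
      obtain ⟨x, rfl⟩ := hv'
      exact ⟨x, hj₃ _ _ (by rw [hg, h, hv])⟩
    · rintro ⟨x, rfl⟩
      exact ⟨j₂ _ _ x, (hg _ _ x).symm⟩
  have hδf : ∀ t s, Function.Exact (δ t s) (f t (s + 1)) := fun t s y => by
    rw [← (hj₂ t (s + 1)).eq_iff, hf, map_zero, hΔF]
    constructor
    · rintro ⟨v, hv⟩
      obtain ⟨v', hv', h⟩ := exists_eigenvector_preimage hpre₃ Δ hc hΔ (hv ▸ hmem₁ t (s + 1) y)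
      rw [hw', ← hr₃] at hv'
      obtain ⟨x, rfl⟩ := hv'
      exact ⟨x, hj₁ _ _ (by rw [hδ, h, hv])⟩
    · rintro ⟨x, rfl⟩
      exact ⟨j₃ _ _ x, (hδ _ _ x).symm⟩
  refine ⟨f, g, δ, hf, hfg, hgδ, hδf, fun t => ?_, fun s y => ?_⟩
  · rw [injective_iff_map_eq_zero]
    intro y hy
    rw [← (hj₂ t 0).eq_iff, hf, map_zero, hΔF] at hy
    obtain ⟨v, hv⟩ := hy
    -- A homogeneous preimage under Δ would have weight 2^(t+1) 3^(-1), that is s = -1, and no such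
    -- weight occurs.
    obtain ⟨v', hv', h⟩ := exists_eigenvector_preimage hpre₃ Δ hc hΔ (hv ▸ hmem₁ t 0 y)
    rw [eigenspace_eq_bot_of_family hΓ₃, Submodule.mem_bot] at hv'
    · apply hj₁ t 0
      rw [← hv, ← h, hv', map_zero, map_zero]
    · rintro ⟨a, b⟩ hab
      have h' : bigradedWeight k (a, b + 1) = bigradedWeight k (t + 1, 0) := by
        simp only [bigradedWeight] at hab ⊢
        field_simp at hab
        rw [pow_zero, mul_one, pow_succ, pow_succ]
        linear_combination hab
      simpa using congrArg Prod.snd (bigradedWeight_injective h')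
  -- The image under Δ would have weight 2^(-1) 3^(s+1), that is t = -1, so it is zero and y comes
  -- from H₂.
  · have hΔy : Δ (j₃ 0 s y) ∈ Γ₁.eigenspace ((2⁻¹ * 3 : k) * bigradedWeight k (0, s)) :=
      mem_eigenspace_map Δ hΔ (hmem₃ 0 s y)
    rw [eigenspace_eq_bot_of_family hΓ₁, Submodule.mem_bot, hGΔ] at hΔy
    · obtain ⟨v, hv⟩ := hΔy
      obtain ⟨v', hv', h⟩ := exists_eigenvector_preimage hpre₂ G one_ne_zero hG'
        (hv ▸ hmem₃ 0 s y)
      rw [inv_one, one_mul, ← hr₂] at hv'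
      obtain ⟨x, rfl⟩ := hv'
      exact ⟨x, hj₃ _ _ (by rw [hg, h, hv])⟩
    · rintro ⟨a, b⟩ hab
      have h' : bigradedWeight k (a + 1, b) = bigradedWeight k (0, s + 1) := by
        simp only [bigradedWeight] at hab ⊢
        field_simp at hab
        rw [pow_succ, pow_succ]
        linear_combination hab
      simpa using congrArg Prod.fst (bigradedWeight_injective h')

end GradedSequence

/-! ### Bigraded pieces of a quotient of a tensor product -/

section TensorPieces

variable {k : Type*} [Field k] {X Y : Type*} [AddCommGroup X] [Module k X]
  [AddCommGroup Y] [Module k Y] {ΓX : Module.End k X} {ΓY : Module.End k Y} {u : X}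

/-- The tensors with first factor `u`. -/
def leftMultiples (k : Type*) [Field k] {X : Type*} [AddCommGroup X] [Module k X]
    (Y : Type*) [AddCommGroup Y] [Module k Y] (u : X) : Submodule k (X ⊗[k] Y) :=
  LinearMap.range (TensorProduct.mk k X Y u)

theorem leftMultiples_le_comap (hu : ΓX u = u) :
    leftMultiples k Y u ≤ (leftMultiples k Y u).comap (TensorProduct.map ΓX ΓY) := by
  rintro _ ⟨y, rfl⟩
  exact ⟨ΓY y, by simp [hu]⟩

/-- The grading operator on the quotient by the tensors with first factor `u`. -/
def quotientGrading (ΓX : Module.End k X) (ΓY : Module.End k Y) (hu : ΓX u = u) :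
    Module.End k ((X ⊗[k] Y) ⧸ leftMultiples k Y u) :=
  Submodule.mapQ _ _ (TensorProduct.map ΓX ΓY) (leftMultiples_le_comap hu)

variable {X' Y' : ℕ → ℕ → Type*} [∀ t s, AddCommGroup (X' t s)] [∀ t s, Module k (X' t s)]
  [∀ t s, AddCommGroup (Y' t s)] [∀ t s, Module k (Y' t s)]
  (jX : ∀ t s, X' t s →ₗ[k] X) (jY : ∀ t s, Y' t s →ₗ[k] Y)

open Classical in
/-- The map from the sum of the tensor products of bigraded pieces to the quotient. -/
def excPieceIncl (u : X) (t s : ℕ) :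
    (⨁ p : ExcIndex t s, X' p.1.1.1 p.1.1.2 ⊗[k] Y' p.1.2.1 p.1.2.2) →ₗ[k]
      (X ⊗[k] Y) ⧸ leftMultiples k Y u :=
  DirectSum.toModule k _ _ fun p =>
    (leftMultiples k Y u).mkQ ∘ₗ TensorProduct.map (jX p.1.1.1 p.1.1.2) (jY p.1.2.1 p.1.2.2)

variable {jX jY}

theorem map_mem_eigenspace {f : Module.End k X} {g : Module.End k Y} {a b : k} {T T' : Type*}
    [AddCommGroup T] [Module k T] [AddCommGroup T'] [Module k T'] {i : T →ₗ[k] X} {j : T' →ₗ[k] Y}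
    (hi : ∀ x, f (i x) = a • i x) (hj : ∀ x, g (j x) = b • j x) (x : T ⊗[k] T') :
    TensorProduct.map f g (TensorProduct.map i j x) = (a * b) • TensorProduct.map i j x := by
  induction x with
  | zero => simp
  | add x y hx hy => rw [map_add, map_add, hx, hy, smul_add]
  | tmul x y =>
    rw [TensorProduct.map_tmul, TensorProduct.map_tmul, hi, hj, TensorProduct.smul_tmul_smul]

theorem bigradedWeight_mul (i j : ℕ × ℕ) :
    bigradedWeight k i * bigradedWeight k j = bigradedWeight k (i + j) := by
  simp only [bigradedWeight, Prod.fst_add, Prod.snd_add, pow_add]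
  ring

theorem bigradedWeight_zero : bigradedWeight k (0, 0) = 1 := by simp [bigradedWeight]

/-- The grading of the first factor alone suffices: with t and s fixed, (t₁, s₁) determines the
whole index. A relation modulo u ⊗ Y is a vanishing sum of eigenvectors of ΓX ⊗ 1 with distinct
weights, where u ⊗ y has the weight of (0, 0), excluded from the indices by t₁ + s₁ > 0. -/
theorem excPieceIncl_injective [CharZero k] (hX : ∀ t s, Function.Injective (jX t s))
    (hY : ∀ t s, Function.Injective (jY t s))
    (hrX : ∀ t s, LinearMap.range (jX t s) = ΓX.eigenspace (bigradedWeight k (t, s)))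
    (hu : ΓX u = u) (t s : ℕ) : Function.Injective (excPieceIncl jX jY u t s) := by
  classical
  have hmem : ∀ t s x, ΓX (jX t s x) = bigradedWeight k (t, s) • jX t s x := fun t s x =>
    Module.End.mem_eigenspace_iff.1 (hrX t s ▸ ⟨x, rfl⟩)
  rw [injective_iff_map_eq_zero]
  intro x hx
  rw [← DirectSum.sum_support_of x, map_sum] at hx
  simp only [excPieceIncl, ← DirectSum.lof_eq_of k, DirectSum.toModule_lof, LinearMap.comp_apply]
    at hx
  rw [← map_sum, Submodule.mkQ_apply, Submodule.Quotient.mk_eq_zero] at hx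
  obtain ⟨y, hy⟩ := hx
  -- The extra index `none` carries the multiple of u coming from the relation in the quotient.
  let a : Option (ExcIndex t s) → X ⊗[k] Y := fun o => o.elim (- (u ⊗ₜ y))
    fun p => TensorProduct.map (jX p.1.1.1 p.1.1.2) (jY p.1.2.1 p.1.2.2) (x p)
  have ha := eigenvectors_eq_zero_of_sum_eq_zero (TensorProduct.map ΓX (LinearMap.id : Y →ₗ[k] Y))
    (fun o : Option (ExcIndex t s) => bigradedWeight k (o.elim (0, 0) fun p => p.1.1))
    (bigradedWeight_injective.comp ?_) (insert none (x.support.map Function.Embedding.some)) a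
    ?_ ?_
  · refine DFinsupp.ext fun p => ?_
    by_cases hp : p ∈ x.support
    · have := ha (some p) (by simp [-DFinsupp.mem_support_toFun, hp])
      refine (map_eq_zero_iff _ ?_).1 this
      exact TensorProduct.map_injective_of_flat_flat _ _ (hX _ _) (hY _ _)
    · exact DFinsupp.notMem_support_iff.1 hp
  · rintro (_ | p) (_ | q) h
    · rfl
    · have := q.2.2.2
      simp only [Option.elim_none, Option.elim_some] at h
      rw [← h] at this
      simp at this
    · have := p.2.2.2
      simp only [Option.elim_none, Option.elim_some] at h
      rw [h] at this
      simp at this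
    · simp only [Option.elim_some] at h
      congr 1
      apply Subtype.ext
      obtain ⟨hp1, hp2, -⟩ := p.2
      obtain ⟨hq1, hq2, -⟩ := q.2
      have h1 := congrArg Prod.fst h
      have h2 := congrArg Prod.snd h
      refine Prod.ext h (Prod.ext ?_ ?_) <;> omega
  · rintro (_ | p) -
    · rw [Module.End.mem_eigenspace_iff]
      simp [a, hu, bigradedWeight_zero]
    · rw [Module.End.mem_eigenspace_iff]
      have := map_mem_eigenspace (f := ΓX) (g := (LinearMap.id : Y →ₗ[k] Y)) (b := 1)
        (hmem p.1.1.1 p.1.1.2) (j := jY p.1.2.1 p.1.2.2) (fun x => by simp) (x p)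
      rwa [mul_one] at this
  · rw [Finset.sum_insert (by simp), Finset.sum_map]
    simp only [a, Option.elim_none, Function.Embedding.some_apply, Option.elim_some, ← hy]
    simp

theorem excPieceIncl_mem_eigenspace
    (hrX : ∀ t s, LinearMap.range (jX t s) = ΓX.eigenspace (bigradedWeight k (t, s)))
    (hrY : ∀ t s, LinearMap.range (jY t s) = ΓY.eigenspace (bigradedWeight k (t, s)))
    (hu : ΓX u = u) (t s : ℕ) :
    LinearMap.range (excPieceIncl jX jY u t s) ≤
      (quotientGrading ΓX ΓY hu).eigenspace (bigradedWeight k (t, s)) := by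
  classical
  have hmemX : ∀ t s x, ΓX (jX t s x) = bigradedWeight k (t, s) • jX t s x := fun t s x =>
    Module.End.mem_eigenspace_iff.1 (hrX t s ▸ ⟨x, rfl⟩)
  have hmemY : ∀ t s x, ΓY (jY t s x) = bigradedWeight k (t, s) • jY t s x := fun t s x =>
    Module.End.mem_eigenspace_iff.1 (hrY t s ▸ ⟨x, rfl⟩)
  rintro _ ⟨x, rfl⟩
  induction x using DirectSum.induction_on with
  | zero => simp
  | add x y hx hy => rw [map_add]; exact Submodule.add_mem _ hx hy
  | of p x =>
    rw [Module.End.mem_eigenspace_iff, ← DirectSum.lof_eq_of k, excPieceIncl,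
      DirectSum.toModule_lof, LinearMap.comp_apply, quotientGrading, Submodule.mkQ_apply,
      Submodule.mapQ_apply, map_mem_eigenspace (hmemX _ _) (hmemY _ _), bigradedWeight_mul]
    have : (p.1.1.1, p.1.1.2) + (p.1.2.1, p.1.2.2) = (t, s) := Prod.ext p.2.1 p.2.2.1
    rw [this]
    rfl

/-- Tensors of homogeneous elements span. Those omitted from the index set have first factor of
bidegree (0, 0), hence a multiple of u, and vanish in the quotient. -/
theorem iSup_range_excPieceIncl
    (htX : ⨆ i : ℕ × ℕ, LinearMap.range (jX i.1 i.2) = ⊤)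
    (htY : ⨆ i : ℕ × ℕ, LinearMap.range (jY i.1 i.2) = ⊤)
    (h0 : LinearMap.range (jX 0 0) ≤ Submodule.span k {u}) :
    ⨆ i : ℕ × ℕ, LinearMap.range (excPieceIncl jX jY u i.1 i.2) = ⊤ := by
  classical
  rw [eq_top_iff]
  rintro c -
  obtain ⟨x, rfl⟩ := Submodule.mkQ_surjective _ c
  have hx : x ∈ Submodule.map₂ (TensorProduct.mk k X Y) ⊤ ⊤ :=
    TensorProduct.map₂_mk_top_top_eq_top (R := k) (M := X) (N := Y) ▸ Submodule.mem_top
  rw [← htX, ← htY, Submodule.map₂_iSup_left] at hx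
  simp_rw [Submodule.map₂_iSup_right] at hx
  revert x
  suffices ⨆ (i : ℕ × ℕ) (j : ℕ × ℕ), Submodule.map₂ (TensorProduct.mk k X Y)
      (LinearMap.range (jX i.1 i.2)) (LinearMap.range (jY j.1 j.2)) ≤
        (⨆ i : ℕ × ℕ, LinearMap.range (excPieceIncl jX jY u i.1 i.2)).comap
          (leftMultiples k Y u).mkQ from fun x hx => this hx
  refine iSup₂_le fun i j => Submodule.map₂_le.2 ?_
  rintro _ ⟨a, rfl⟩ _ ⟨b, rfl⟩
  rw [Submodule.mem_comap]
  by_cases hi : 0 < i.1 + i.2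
  · refine Submodule.mem_iSup_of_mem (i + j)
      ⟨DirectSum.lof k _ (fun p : ExcIndex (i.1 + j.1) (i.2 + j.2) =>
        X' p.1.1.1 p.1.1.2 ⊗[k] Y' p.1.2.1 p.1.2.2) ⟨(i, j), rfl, rfl, hi⟩ (a ⊗ₜ b), ?_⟩
    change excPieceIncl jX jY u (i.1 + j.1) (i.2 + j.2) _ = _
    rw [excPieceIncl, DirectSum.toModule_lof]
    rfl
  · obtain ⟨i1, i2⟩ := i
    obtain ⟨rfl, rfl⟩ : i1 = 0 ∧ i2 = 0 := by simp only at hi; omega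
    obtain ⟨r, hr⟩ := Submodule.mem_span_singleton.1 (h0 ⟨a, rfl⟩)
    have : (leftMultiples k Y u).mkQ (TensorProduct.mk k X Y (jX 0 0 a) (jY j.1 j.2 b)) = 0 := by
      rw [Submodule.mkQ_apply, Submodule.Quotient.mk_eq_zero]
      exact ⟨r • jY j.1 j.2 b, by simp [← hr]⟩
    rw [this]
    exact Submodule.zero_mem _

end TensorPieces

/-! ### Exactness in the middle -/

/-- Exactness of Mayer–Vietoris at the middle term: classes on W and V' with the same image in W'
come from one class on V. Only the W-component of this conclusion is needed. -/
theorem DiffHomology.exists_map_eq_of_map_eq {k : Type*} [Field k]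
    {V V' W W' : Type*} [AddCommGroup V] [Module k V] [AddCommGroup V'] [Module k V']
    [AddCommGroup W] [Module k W] [AddCommGroup W'] [Module k W']
    {d : Module.End k V} {e : Module.End k W} {d' : Module.End k V'}
    {e' : Module.End k W'} (he : e ∘ₗ e = 0)
    (f : V →ₗ[k] W) (p : V →ₗ[k] V') (q : W →ₗ[k] W') (f' : V' →ₗ[k] W')
    (hf : ∀ v, e (f v) = f (d v)) (hp : ∀ v, d' (p v) = p (d v)) (hq : ∀ v, e' (q v) = q (e v))
    (hf' : ∀ v, e' (f' v) = f' (d' v)) (hsq : ∀ v, q (f v) = f' (p v))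
    (hps : Function.Surjective p) (hqs : Function.Surjective q)
    (hinj : ∀ v, p v = 0 → f v = 0 → v = 0) (hsurj : ∀ w, q w = 0 → ∃ v, p v = 0 ∧ f v = w)
    {a : DiffHomology e} {b : DiffHomology d'}
    (h : map q (.of_comm hq) a = map f' (.of_comm hf') b) :
    ∃ c, map f (.of_comm hf) c = a := by
  obtain ⟨⟨a, ha⟩, rfl⟩ := mk_surjective _ a
  obtain ⟨⟨b, hb⟩, rfl⟩ := mk_surjective _ b
  rw [LinearMap.mem_ker] at ha hb
  rw [map_mk, map_mk, mk_eq_mk] at h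
  obtain ⟨u, hu⟩ := h
  obtain ⟨u, rfl⟩ := hqs u
  obtain ⟨v, rfl⟩ := hps b
  simp only at hu
  -- Correcting by the boundary e u puts a - f v into ker q, hence into f (ker p); then v + w is the
  -- cycle sought.
  obtain ⟨w, hw1, hw2⟩ := hsurj (a - f v - e u) (by
    rw [map_sub, map_sub, ← hq, hu, hsq, sub_self])
  have hee : e (e u) = 0 := LinearMap.congr_fun he u
  refine ⟨mk _ ⟨v + w, hinj _ ?_ ?_⟩, mk_eq_mk.2 ⟨- u, ?_⟩⟩
  · rw [← hp, map_add, hw1, add_zero, hb]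
  · rw [← hf, map_add, hw2, map_add, map_sub, map_sub, ha, hee]
    abel
  · change e (- u) = f (v + w) - a
    simp only [map_add, map_neg, hw2]
    abel

end

noncomputable section

/-! ### The Künneth formula for Koszul homology -/

/-- The isomorphism on homology which is induced by an isomorphism of differential modules. -/
theorem DiffHomology.map_bijective_of_equiv {k V W : Type*} [Field k] [AddCommGroup V] [Module k V]
    [AddCommGroup W] [Module k W] {d : Module.End k V} {d' : Module.End k W} (e : V ≃ₗ[k] W)
    (h : ∀ v, d' (e v) = e (d v)) :
    Function.Bijective (map (d := d) (d' := d') e.toLinearMap (.of_comm h)) := by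
  constructor
  · rw [injective_iff_map_eq_zero]
    intro c hc
    obtain ⟨z, rfl⟩ := mk_surjective _ c
    rw [map_mk, mk_eq_zero] at hc
    obtain ⟨u, hu⟩ := hc
    refine mk_eq_zero.2 ⟨e.symm u, e.injective ?_⟩
    rw [← h, e.apply_symm_apply, hu]
    rfl
  · intro c
    obtain ⟨⟨z, hz⟩, rfl⟩ := mk_surjective _ c
    refine ⟨mk _ ⟨e.symm z, e.injective ?_⟩, ?_⟩
    · rw [← h, e.apply_symm_apply, hz, map_zero]
    · rw [map_mk]
      congr 1
      exact Subtype.ext (e.apply_symm_apply z)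

section KoszulKuenneth

variable {k : Type*} [Field k] {L L' A B : Type*} [AddCommGroup L] [Module k L]
  [AddCommGroup L'] [Module k L'] [AddCommGroup A] [Module k A] [AddCommGroup B] [Module k B]
  {A' : Type*} [AddCommGroup A'] [Module k A']

/-- The map on the homology of total Koszul complexes which is induced by an equivariant map. -/
def koszulMap (μ : L →ₗ[k] Module.End k A) (ν : L →ₗ[k] Module.End k A') (f : A →ₗ[k] A')
    (h : ∀ v a, ν v (f a) = f (μ v a)) :
    DiffHomology (koszulTotalD μ) →ₗ[k] DiffHomology (koszulTotalD ν) :=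
  DiffHomology.map (LinearMap.rTensor _ f) (.of_comm (koszulTotalD_rTensor μ f ν h))

/-- The class of `a ⊗ 1` in the homology of the total Koszul complex. -/
def koszulUnit (μ : L →ₗ[k] Module.End k A) (a : A) : DiffHomology (koszulTotalD μ) :=
  DiffHomology.mk _ ⟨a ⊗ₜ 1, koszulTotalD_one μ a⟩

theorem koszulMap_mk (μ : L →ₗ[k] Module.End k A) (ν : L →ₗ[k] Module.End k A') (f : A →ₗ[k] A')
    (h : ∀ v a, ν v (f a) = f (μ v a)) (z : LinearMap.ker (koszulTotalD μ)) :
    koszulMap μ ν f h (DiffHomology.mk _ z) = DiffHomology.mk _ ⟨LinearMap.rTensor _ f z.1,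
      (DiffHomology.Preserves.of_comm (koszulTotalD_rTensor μ f ν h)).cycle _ z.2⟩ := rfl

theorem homologyGrading_mk {μ : L →ₗ[k] Module.End k A} {γ : Module.End k A} [CharZero k]
    (h : ∀ v a, γ (μ v a) = (3 : k) • μ v (γ a)) (z : LinearMap.ker (koszulTotalD μ)) :
    homologyGrading h (DiffHomology.mk _ z) = DiffHomology.mk _ ⟨koszulGrading L γ z.1,
      (koszulGrading_preserves h).cycle _ z.2⟩ := rfl

/-- A functional that kills every v a maps the Koszul complex to one with zero differential, so it
detects classes of elements a ⊗ 1. -/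
theorem koszulUnit_ne_zero (μ : L →ₗ[k] Module.End k A) (φ : A →ₗ[k] k)
    (hφ : ∀ v a, φ (μ v a) = 0) {a : A} (ha : φ a ≠ 0) : koszulUnit μ a ≠ 0 := by
  intro h
  obtain ⟨u, hu⟩ := DiffHomology.mk_eq_zero.1 h
  -- The zero action is written as a scalar multiple so that the scaling rule for the differential
  -- shows that its differential is zero.
  have h1 := koszulTotalD_rTensor μ φ ((0 : k) • (0 : L →ₗ[k] Module.End k k))
    (fun v a => by simp [hφ]) u
  rw [hu, koszulTotalD_smul, zero_smul, LinearMap.zero_apply, LinearMap.rTensor_tmul] at h1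
  have h2 := congrArg (TensorProduct.lid k _) h1
  rw [map_zero, TensorProduct.lid_tmul] at h2
  exact ha ((smul_eq_zero.1 h2.symm).resolve_right one_ne_zero)

theorem exteriorScale_exteriorProd (c : k) (x : ExteriorAlgebra k L) (y : ExteriorAlgebra k L') :
    exteriorScale (L × L') c (exteriorProd L L' (x ⊗ₜ y)) =
      exteriorProd L L' (exteriorScale L c x ⊗ₜ exteriorScale L' c y) := by
  simp only [exteriorProd_tmul, exteriorScale, AlgHom.toLinearMap_apply, map_mul]
  simp only [← AlgHom.comp_apply, ExteriorAlgebra.map_comp_map]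
  have h1 : (c • LinearMap.id : L × L' →ₗ[k] L × L') ∘ₗ LinearMap.inl k L L' =
      LinearMap.inl k L L' ∘ₗ (c • LinearMap.id) := by ext <;> simp
  have h2 : (c • LinearMap.id : L × L' →ₗ[k] L × L') ∘ₗ LinearMap.inr k L L' =
      LinearMap.inr k L L' ∘ₗ (c • LinearMap.id) := by ext <;> simp
  rw [h1, h2]

theorem koszulGrading_koszulProd (γA : Module.End k A) (γB : Module.End k B)
    (y : A ⊗[k] ExteriorAlgebra k L) (z : B ⊗[k] ExteriorAlgebra k L') :
    koszulGrading (L × L') (TensorProduct.map γA γB) (koszulProd A B L L' (y ⊗ₜ z)) =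
      koszulProd A B L L' (koszulGrading L γA y ⊗ₜ koszulGrading L' γB z) := by
  induction y with
  | zero => simp
  | add x y hx hy => simp only [map_add, TensorProduct.add_tmul, hx, hy]
  | tmul a x =>
    induction z with
    | zero => simp
    | add x y hx hy => simp only [map_add, TensorProduct.tmul_add, hx, hy]
    | tmul b y =>
      simp only [koszulGrading, koszulProd_tmul, TensorProduct.map_tmul,
        exteriorScale_exteriorProd]

theorem rTensor_koszulProd (f : A →ₗ[k] A') (y : A ⊗[k] ExteriorAlgebra k L)
    (z : B ⊗[k] ExteriorAlgebra k L') :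
    LinearMap.rTensor _ (LinearMap.rTensor B f) (koszulProd A B L L' (y ⊗ₜ z)) =
      koszulProd A' B L L' (LinearMap.rTensor _ f y ⊗ₜ z) := by
  induction y with
  | zero => simp
  | add x y hx hy => simp only [map_add, TensorProduct.add_tmul, hx, hy]
  | tmul a x =>
    induction z with
    | zero => simp
    | add x y hx hy => simp only [map_add, TensorProduct.tmul_add, hx, hy]
    | tmul b y => simp only [koszulProd_tmul, LinearMap.rTensor_tmul]

variable {μ : L →ₗ[k] Module.End k A} {ν : L' →ₗ[k] Module.End k B}

theorem map_prodAction {γA : Module.End k A} {γB : Module.End k B}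
    (hA : ∀ v a, γA (μ v a) = (3 : k) • μ v (γA a)) (hB : ∀ v b, γB (ν v b) = (3 : k) • ν v (γB b))
    (v : L × L') (a : A ⊗[k] B) : TensorProduct.map γA γB (prodAction μ ν v a) =
      (3 : k) • prodAction μ ν v (TensorProduct.map γA γB a) := by
  induction a with
  | zero => simp
  | add x y hx hy => simp only [map_add, hx, hy, smul_add]
  | tmul a b => simp [hA, hB, TensorProduct.smul_tmul']

variable [CharZero k]

/-- The general Künneth isomorphism transported along A ⊗ ⋀L ⊗ B ⊗ ⋀L' ≅ (A ⊗ B) ⊗ ⋀(L × L'). Its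
value on pairs of cycles is recorded because compatibility with gradings and with maps is checked
there. -/
theorem exists_koszul_kuenneth (hμ : ∀ v w a, μ v (μ w a) = μ w (μ v a))
    (hν : ∀ v w a, ν v (ν w a) = ν w (ν v a)) :
    ∃ Ψ : (DiffHomology (koszulTotalD μ) ⊗[k] DiffHomology (koszulTotalD ν)) ≃ₗ[k]
        DiffHomology (koszulTotalD (prodAction μ ν)),
      ∀ (z : LinearMap.ker (koszulTotalD μ)) (y : LinearMap.ker (koszulTotalD ν)),
        ∃ h, Ψ (DiffHomology.mk _ z ⊗ₜ DiffHomology.mk _ y) =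
          DiffHomology.mk _ ⟨koszulProd A B L L' (z.1 ⊗ₜ y.1), h⟩ := by
  obtain ⟨K, hK⟩ := DiffHomology.exists_kuenneth (two_ne_zero : (2 : k) ≠ 0)
    (koszulTotalD_koszulTotalD μ hμ) (koszulTotalD_koszulTotalD ν hν)
    (koszulSign_koszulSign (A := A) (L := L)) (koszulTotalD_koszulSign μ)
  refine ⟨K ≪≫ₗ LinearEquiv.ofBijective _ (DiffHomology.map_bijective_of_equiv
    (koszulProd A B L L') (koszulTotalD_koszulProd μ ν)), fun z y => ?_⟩
  obtain ⟨h, hzy⟩ := hK z y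
  refine ⟨?_, ?_⟩
  · have h' := h
    rw [LinearMap.mem_ker] at h' ⊢
    rw [koszulTotalD_koszulProd, h', map_zero]
  · rw [LinearEquiv.trans_apply, hzy]
    rfl

omit [CharZero k] in
theorem DiffHomology.tensor_induction {V W : Type*} [AddCommGroup V] [Module k V] [AddCommGroup W]
    [Module k W] {d : Module.End k V} {e : Module.End k W}
    {p : DiffHomology d ⊗[k] DiffHomology e → Prop} (zero : p 0)
    (add : ∀ x y, p x → p y → p (x + y)) (tmul : ∀ z y, p (mk d z ⊗ₜ mk e y))
    (x : DiffHomology d ⊗[k] DiffHomology e) : p x := by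
  induction x with
  | zero => exact zero
  | add x y hx hy => exact add x y hx hy
  | tmul x y =>
    obtain ⟨z, rfl⟩ := mk_surjective _ x
    obtain ⟨y, rfl⟩ := mk_surjective _ y
    exact tmul z y

theorem koszul_kuenneth_grading
    {Ψ : (DiffHomology (koszulTotalD μ) ⊗[k] DiffHomology (koszulTotalD ν)) ≃ₗ[k]
        DiffHomology (koszulTotalD (prodAction μ ν))}
    (hΨ : ∀ (z : LinearMap.ker (koszulTotalD μ)) (y : LinearMap.ker (koszulTotalD ν)),
        ∃ h, Ψ (DiffHomology.mk _ z ⊗ₜ DiffHomology.mk _ y) =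
          DiffHomology.mk _ ⟨koszulProd A B L L' (z.1 ⊗ₜ y.1), h⟩)
    {γA : Module.End k A} {γB : Module.End k B}
    (hA : ∀ v a, γA (μ v a) = (3 : k) • μ v (γA a)) (hB : ∀ v b, γB (ν v b) = (3 : k) • ν v (γB b))
    (x : DiffHomology (koszulTotalD μ) ⊗[k] DiffHomology (koszulTotalD ν)) :
    homologyGrading (map_prodAction hA hB) (Ψ x) =
      Ψ (TensorProduct.map (homologyGrading hA) (homologyGrading hB) x) := by
  induction x using DiffHomology.tensor_induction with
  | zero => simp
  | add x y hx hy => simp only [map_add, hx, hy]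
  | tmul z y =>
    obtain ⟨h, hzy⟩ := hΨ z y
    rw [hzy, TensorProduct.map_tmul, homologyGrading_mk, homologyGrading_mk, homologyGrading_mk]
    obtain ⟨h', hzy'⟩ := hΨ ⟨koszulGrading L γA z.1, (koszulGrading_preserves hA).cycle _ z.2⟩
      ⟨koszulGrading L' γB y.1, (koszulGrading_preserves hB).cycle _ y.2⟩
    rw [hzy']
    congr 1
    exact Subtype.ext (koszulGrading_koszulProd γA γB z.1 y.1)

omit [CharZero k] in
theorem koszul_kuenneth_map {μ' : L →ₗ[k] Module.End k A'}
    {Ψ : (DiffHomology (koszulTotalD μ) ⊗[k] DiffHomology (koszulTotalD ν)) ≃ₗ[k]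
        DiffHomology (koszulTotalD (prodAction μ ν))}
    (hΨ : ∀ (z : LinearMap.ker (koszulTotalD μ)) (y : LinearMap.ker (koszulTotalD ν)),
        ∃ h, Ψ (DiffHomology.mk _ z ⊗ₜ DiffHomology.mk _ y) =
          DiffHomology.mk _ ⟨koszulProd A B L L' (z.1 ⊗ₜ y.1), h⟩)
    {Ψ' : (DiffHomology (koszulTotalD μ') ⊗[k] DiffHomology (koszulTotalD ν)) ≃ₗ[k]
        DiffHomology (koszulTotalD (prodAction μ' ν))}
    (hΨ' : ∀ (z : LinearMap.ker (koszulTotalD μ')) (y : LinearMap.ker (koszulTotalD ν)),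
        ∃ h, Ψ' (DiffHomology.mk _ z ⊗ₜ DiffHomology.mk _ y) =
          DiffHomology.mk _ ⟨koszulProd A' B L L' (z.1 ⊗ₜ y.1), h⟩)
    (f : A →ₗ[k] A') (hf : ∀ v a, μ' v (f a) = f (μ v a))
    (hf' : ∀ v a, prodAction μ' ν v (LinearMap.rTensor B f a) =
      LinearMap.rTensor B f (prodAction μ ν v a))
    (x : DiffHomology (koszulTotalD μ) ⊗[k] DiffHomology (koszulTotalD ν)) :
    koszulMap _ _ (LinearMap.rTensor B f) hf' (Ψ x) =
      Ψ' (LinearMap.rTensor _ (koszulMap μ μ' f hf) x) := by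
  induction x using DiffHomology.tensor_induction with
  | zero => simp
  | add x y hx hy => simp only [map_add, hx, hy]
  | tmul z y =>
    obtain ⟨h, hzy⟩ := hΨ z y
    rw [hzy, LinearMap.rTensor_tmul, koszulMap_mk, koszulMap_mk]
    obtain ⟨h', hzy'⟩ := hΨ' ⟨LinearMap.rTensor _ f z.1,
      (DiffHomology.Preserves.of_comm (koszulTotalD_rTensor μ f μ' hf)).cycle _ z.2⟩ y
    rw [hzy']
    congr 1
    exact Subtype.ext (rTensor_koszulProd f z.1 y.1)

omit [CharZero k] in
theorem prodAction_rTensor {μ' : L →ₗ[k] Module.End k A'} (f : A →ₗ[k] A')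
    (hf : ∀ v a, μ' v (f a) = f (μ v a)) (v : L × L') (a : A ⊗[k] B) :
    prodAction μ' ν v (LinearMap.rTensor B f a) =
      LinearMap.rTensor B f (prodAction μ ν v a) := by
  induction a with
  | zero => simp
  | add x y hx hy => simp only [map_add, hx, hy]
  | tmul a b => simp [hf]

omit [CharZero k] in
theorem mk_injective_of_ne_zero {X Y : Type*} [AddCommGroup X] [Module k X] [AddCommGroup Y]
    [Module k Y] {u : X} (hu : u ≠ 0) : Function.Injective (TensorProduct.mk k X Y u) := by
  obtain ⟨φ, hφ⟩ := Module.Projective.exists_dual_ne_zero k hu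
  intro y y' h
  have h' := congrArg (fun x => TensorProduct.lid k Y (LinearMap.rTensor Y φ x)) h
  simpa [hφ] using h'

end KoszulKuenneth

/-! ### The homology of the stars of a flip -/

section StarHomology

variable {k : Type*} [Field k] [CharZero k] {L L₁ L₂ B₁ B₂ S K Q : Type*}
  [AddCommGroup L] [Module k L] [AddCommGroup L₁] [Module k L₁] [AddCommGroup L₂] [Module k L₂]
  [AddCommGroup B₁] [Module k B₁] [AddCommGroup B₂] [Module k B₂] [AddCommGroup S] [Module k S]
  [AddCommGroup K] [Module k K] [AddCommGroup Q] [Module k Q]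
  {μ₁ : L →ₗ[k] Module.End k B₁} {μ₂ : L →ₗ[k] Module.End k B₂} {μS : L₁ →ₗ[k] Module.End k S}
  {μK : L₁ →ₗ[k] Module.End k K} {μQ : L₂ →ₗ[k] Module.End k Q}

omit [CharZero k] in
theorem map_rTensor_comm {f : B₁ →ₗ[k] B₂} {ψ₁ : B₁ →ₗ[k] S ⊗[k] Q} {ψ₂ : B₂ →ₗ[k] K ⊗[k] Q}
    {κ : S →ₗ[k] K} (hsq : ∀ b, ψ₂ (f b) = LinearMap.rTensor Q κ (ψ₁ b)) {Λ Λ' : Type*}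
    [AddCommGroup Λ] [Module k Λ] [AddCommGroup Λ'] [Module k Λ'] (g : Λ →ₗ[k] Λ')
    (y : B₁ ⊗[k] Λ) :
    TensorProduct.map ψ₂ g (LinearMap.rTensor _ f y) =
      LinearMap.rTensor _ (LinearMap.rTensor Q κ) (TensorProduct.map ψ₁ g y) := by
  induction y with
  | zero => simp
  | add x y hx hy => simp only [map_add, hx, hy]
  | tmul b x => simp only [LinearMap.rTensor_tmul, TensorProduct.map_tmul, hsq]

omit [CharZero k] in
theorem map_koszulGrading {B C : Type*} [AddCommGroup B] [Module k B] [AddCommGroup C] [Module k C]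
    {ψ : B →ₗ[k] C} {γ : Module.End k B} {γ' : Module.End k C} (h : ∀ b, ψ (γ b) = γ' (ψ b))
    (p : L →ₗ[k] L₁) (y : B ⊗[k] ExteriorAlgebra k L) :
    TensorProduct.map ψ (ExteriorAlgebra.map p).toLinearMap (koszulGrading L γ y) =
      koszulGrading L₁ γ' (TensorProduct.map ψ (ExteriorAlgebra.map p).toLinearMap y) := by
  induction y with
  | zero => simp
  | add x y hx hy => simp only [map_add, hx, hy]
  | tmul b x =>
    simp only [koszulGrading, TensorProduct.map_tmul, h, exteriorScale, AlgHom.toLinearMap_apply]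
    congr 1
    simp only [← AlgHom.comp_apply, ExteriorAlgebra.map_comp_map]
    congr 2
    ext v
    simp

omit [CharZero k] in
-- The homology of S is spanned by the class of s₀, so every tensor is that class times one element.
theorem exists_eq_koszulUnit_tmul {s₀ : S} (hS : ∀ y, koszulTotalD μS y = 0 →
      ∃ (r : k) (u : _), y = r • s₀ ⊗ₜ 1 + koszulTotalD μS u)
    (x : DiffHomology (koszulTotalD μS) ⊗[k] Q) : ∃ y, x = koszulUnit μS s₀ ⊗ₜ y := by
  induction x with
  | zero => exact ⟨0, by simp⟩
  | add x x' hx hx' =>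
    obtain ⟨y, rfl⟩ := hx
    obtain ⟨y', rfl⟩ := hx'
    exact ⟨y + y', (TensorProduct.tmul_add _ _ _).symm⟩
  | tmul x y =>
    obtain ⟨⟨z, hz⟩, rfl⟩ := DiffHomology.mk_surjective _ x
    obtain ⟨r, u, hr⟩ := hS z hz
    refine ⟨r • y, ?_⟩
    rw [← TensorProduct.smul_tmul, koszulUnit, ← map_smul]
    congr 1
    refine DiffHomology.mk_eq_mk.2 ⟨u, ?_⟩
    change _ = z - r • (s₀ ⊗ₜ 1)
    rw [hr]
    abel

omit [CharZero k] in
-- Every source element is u ⊗ y and goes to h u ⊗ y, and tensoring with a non-zero vector is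
-- injective over a field.
theorem injective_and_range_of_tensor {X X' Y V V' : Type*} [AddCommGroup X] [Module k X]
    [AddCommGroup X'] [Module k X'] [AddCommGroup Y] [Module k Y] [AddCommGroup V] [Module k V]
    [AddCommGroup V'] [Module k V'] (E : (X ⊗[k] Y) ≃ₗ[k] V) (E' : (X' ⊗[k] Y) ≃ₗ[k] V')
    {F : V →ₗ[k] V'} {h : X →ₗ[k] X'} (hF : ∀ x, F (E x) = E' (LinearMap.rTensor Y h x))
    {u : X} (hX : ∀ x : X ⊗[k] Y, ∃ y, x = u ⊗ₜ y) (hu : h u ≠ 0) :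
    Function.Injective F ∧ ∀ c, (∃ b, F b = c) ↔ E'.symm c ∈ leftMultiples k Y (h u) := by
  constructor
  · rw [injective_iff_map_eq_zero]
    intro b hb
    obtain ⟨x, rfl⟩ := E.surjective b
    obtain ⟨y, rfl⟩ := hX x
    rw [hF, LinearMap.rTensor_tmul, LinearEquiv.map_eq_zero_iff] at hb
    have hy : y = 0 := mk_injective_of_ne_zero hu (hb.trans (map_zero _).symm)
    rw [hy, TensorProduct.tmul_zero, map_zero]
  · intro c
    constructor
    · rintro ⟨b, rfl⟩
      obtain ⟨x, rfl⟩ := E.surjective b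
      obtain ⟨y, rfl⟩ := hX x
      refine ⟨y, ?_⟩
      rw [hF, LinearEquiv.symm_apply_apply, LinearMap.rTensor_tmul]
      rfl
    · rintro ⟨y, hy⟩
      refine ⟨E (u ⊗ₜ y), ?_⟩
      rw [hF, LinearMap.rTensor_tmul, ← LinearEquiv.eq_symm_apply]
      exact hy

omit [CharZero k] in
theorem exists_koszul_kill {B C : Type*} [AddCommGroup B] [Module k B] [AddCommGroup C] [Module k C]
    (μ : L →ₗ[k] Module.End k B) (ν : L₁ →ₗ[k] Module.End k C)
    (hμ : ∀ v w a, μ v (μ w a) = μ w (μ v a))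
    (i : L₁ →ₗ[k] L) (p : L →ₗ[k] L₁) (ε : L →ₗ[k] k) (ℓ : L)
    (hpi : p ∘ₗ i = LinearMap.id) (hpℓ : p ℓ = 0) (hεℓ : ε ℓ = 1) (hεi : ∀ v, ε (i v) = 0)
    (hdec : ∀ v, v = i (p v) + ε v • ℓ)
    (π : B →ₗ[k] C) (hπ : Function.Surjective π) (hinj : Function.Injective (μ ℓ))
    (hker : Function.Exact (μ ℓ) π) (h : ∀ v a, ν (p v) (π a) = π (μ v a)) :
    ∃ N : DiffHomology (koszulTotalD μ) ≃ₗ[k] DiffHomology (koszulTotalD ν),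
      ∀ z : LinearMap.ker (koszulTotalD μ), N (DiffHomology.mk _ z) = DiffHomology.mk _
        ⟨TensorProduct.map π (ExteriorAlgebra.map p).toLinearMap z.1,
          (DiffHomology.Preserves.of_comm (koszulTotalD_map μ ν π p h)).cycle _ z.2⟩ :=
  ⟨LinearEquiv.ofBijective _
    (koszulTotal_kill μ ν hμ i p ε ℓ hpi hpℓ hεℓ hεi hdec π hπ hinj hker h), fun _ => rfl⟩

/-- Killing ℓ on both sides and applying Künneth turns the map H(B₁) → H(B₂) into H(κ) ⊗ 1 from H(S)
⊗ H(Q) to H(K) ⊗ H(Q). As H(S) is spanned by the class of s₀, whose image in H(K) is non-zero, the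
map is injective and its image consists of the tensors with that first factor. -/
theorem exists_star_homology
    (hμ₁ : ∀ v w a, μ₁ v (μ₁ w a) = μ₁ w (μ₁ v a)) (hμ₂ : ∀ v w a, μ₂ v (μ₂ w a) = μ₂ w (μ₂ v a))
    (hμS : ∀ v w a, μS v (μS w a) = μS w (μS v a)) (hμK : ∀ v w a, μK v (μK w a) = μK w (μK v a))
    (hμQ : ∀ v w a, μQ v (μQ w a) = μQ w (μQ v a))
    (f : B₁ →ₗ[k] B₂) (hf : ∀ v b, μ₂ v (f b) = f (μ₁ v b))
    (i : L₁ × L₂ →ₗ[k] L) (p : L →ₗ[k] L₁ × L₂) (ε : L →ₗ[k] k) (ℓ : L)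
    (hpi : p ∘ₗ i = LinearMap.id) (hpℓ : p ℓ = 0) (hεℓ : ε ℓ = 1) (hεi : ∀ v, ε (i v) = 0)
    (hdec : ∀ v, v = i (p v) + ε v • ℓ)
    (ψ₁ : B₁ →ₗ[k] S ⊗[k] Q) (hψ₁ : Function.Surjective ψ₁) (hinj₁ : Function.Injective (μ₁ ℓ))
    (hker₁ : Function.Exact (μ₁ ℓ) ψ₁) (h₁ : ∀ v b, prodAction μS μQ (p v) (ψ₁ b) = ψ₁ (μ₁ v b))
    (ψ₂ : B₂ →ₗ[k] K ⊗[k] Q) (hψ₂ : Function.Surjective ψ₂) (hinj₂ : Function.Injective (μ₂ ℓ))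
    (hker₂ : Function.Exact (μ₂ ℓ) ψ₂) (h₂ : ∀ v b, prodAction μK μQ (p v) (ψ₂ b) = ψ₂ (μ₂ v b))
    (κ : S →ₗ[k] K) (hκ : ∀ v a, μK v (κ a) = κ (μS v a))
    (hsq : ∀ b, ψ₂ (f b) = LinearMap.rTensor Q κ (ψ₁ b))
    (s₀ : S) (hS : ∀ y, koszulTotalD μS y = 0 → ∃ (r : k) (u : _),
      y = r • s₀ ⊗ₜ 1 + koszulTotalD μS u)
    (hu : koszulUnit μK (κ s₀) ≠ 0)
    {γ₂ : Module.End k B₂} {γK : Module.End k K} {γQ : Module.End k Q}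
    (hγ₂ : ∀ v a, γ₂ (μ₂ v a) = (3 : k) • μ₂ v (γ₂ a))
    (hγK : ∀ v a, γK (μK v a) = (3 : k) • μK v (γK a))
    (hγQ : ∀ v a, γQ (μQ v a) = (3 : k) • μQ v (γQ a))
    (hγψ : ∀ b, ψ₂ (γ₂ b) = TensorProduct.map γK γQ (ψ₂ b)) :
    ∃ N : DiffHomology (koszulTotalD μ₂) ≃ₗ[k]
        DiffHomology (koszulTotalD μK) ⊗[k] DiffHomology (koszulTotalD μQ),
      Function.Injective (koszulMap μ₁ μ₂ f hf) ∧
      (∀ c, (∃ b, koszulMap μ₁ μ₂ f hf b = c) ↔ N c ∈ leftMultiples k _ (koszulUnit μK (κ s₀))) ∧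
      ∀ c, N (homologyGrading hγ₂ c) =
        TensorProduct.map (homologyGrading hγK) (homologyGrading hγQ) (N c) := by
  obtain ⟨N₁, hN₁⟩ := exists_koszul_kill μ₁ (prodAction μS μQ) hμ₁ i p ε ℓ hpi hpℓ hεℓ hεi hdec ψ₁
    hψ₁ hinj₁ hker₁ h₁
  obtain ⟨N₂, hN₂⟩ := exists_koszul_kill μ₂ (prodAction μK μQ) hμ₂ i p ε ℓ hpi hpℓ hεℓ hεi hdec ψ₂
    hψ₂ hinj₂ hker₂ h₂
  obtain ⟨ΨS, hΨS⟩ := exists_koszul_kuenneth hμS hμQ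
  obtain ⟨ΨK, hΨK⟩ := exists_koszul_kuenneth hμK hμQ
  have hNf : ∀ c, N₂ (koszulMap μ₁ μ₂ f hf c) =
      koszulMap (prodAction μS μQ) (prodAction μK μQ) (LinearMap.rTensor Q κ)
        (by exact prodAction_rTensor κ hκ) (N₁ c) := by
    intro c
    obtain ⟨z, rfl⟩ := DiffHomology.mk_surjective _ c
    rw [koszulMap_mk, hN₁, hN₂, koszulMap_mk]
    congr 1
    exact Subtype.ext (map_rTensor_comm hsq _ z.1)
  have hNγ : ∀ c, N₂ (homologyGrading hγ₂ c) =
      homologyGrading (map_prodAction hγK hγQ) (N₂ c) := by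
    intro c
    obtain ⟨z, rfl⟩ := DiffHomology.mk_surjective _ c
    rw [homologyGrading_mk, hN₂, hN₂, homologyGrading_mk]
    congr 1
    exact Subtype.ext (map_koszulGrading hγψ p z.1)
  have hF : ∀ x, koszulMap μ₁ μ₂ f hf ((ΨS ≪≫ₗ N₁.symm) x) =
      (ΨK ≪≫ₗ N₂.symm) (LinearMap.rTensor _ (koszulMap μS μK κ hκ) x) := fun x => by
    rw [LinearEquiv.trans_apply, LinearEquiv.trans_apply, LinearEquiv.eq_symm_apply, hNf,
      LinearEquiv.apply_symm_apply]
    exact koszul_kuenneth_map hΨS hΨK κ hκ _ x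
  obtain ⟨h1, h2⟩ := injective_and_range_of_tensor _ _ hF (exists_eq_koszulUnit_tmul hS) hu
  refine ⟨N₂ ≪≫ₗ ΨK.symm, h1, h2, fun c => ?_⟩
  rw [LinearEquiv.trans_apply, LinearEquiv.trans_apply, LinearEquiv.symm_apply_eq,
    ← koszul_kuenneth_grading hΨK hγK hγQ, LinearEquiv.apply_symm_apply, hNγ]

end StarHomology

end

noncomputable section

/-! ### The exact triangle of a square of Koszul complexes -/

section Triangle

variable {k : Type*} [Field k]

/-- The pair (f, g) is an injection of vector spaces, hence split, and a splitting survives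
tensoring. -/
theorem rTensor_eq_zero_of_pair {A B C Λ : Type*} [AddCommGroup A] [Module k A] [AddCommGroup B]
    [Module k B] [AddCommGroup C] [Module k C] [AddCommGroup Λ] [Module k Λ] {f : A →ₗ[k] B}
    {g : A →ₗ[k] C} (h : ∀ a, f a = 0 → g a = 0 → a = 0) {y : A ⊗[k] Λ}
    (hf : LinearMap.rTensor Λ f y = 0) (hg : LinearMap.rTensor Λ g y = 0) : y = 0 := by
  obtain ⟨r, hr⟩ := LinearMap.exists_leftInverse_of_injective (f.prod g)
    (LinearMap.ker_eq_bot'.2 fun a ha => h a (congrArg Prod.fst ha) (congrArg Prod.snd ha))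
  have hid : (r ∘ₗ LinearMap.inl k B C) ∘ₗ f + (r ∘ₗ LinearMap.inr k B C) ∘ₗ g =
      LinearMap.id := by
    rw [← hr]
    ext a
    simp [← map_add]
  have hy := LinearMap.congr_fun (LinearMap.rTensor_id Λ A) y
  rw [← hid, LinearMap.rTensor_add, LinearMap.add_apply,
    LinearMap.rTensor_comp_apply Λ _ f, LinearMap.rTensor_comp_apply Λ _ g, hf, hg, map_zero,
    map_zero, add_zero] at hy
  exact hy.symm

theorem exists_rTensor_eq_of_ker {A B C D Λ : Type*} [AddCommGroup A] [Module k A] [AddCommGroup B]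
    [Module k B] [AddCommGroup C] [Module k C] [AddCommGroup D] [Module k D] [AddCommGroup Λ]
    [Module k Λ] {f : A →ₗ[k] B} {p : A →ₗ[k] C} {q : B →ₗ[k] D} (hq : Function.Surjective q)
    (h0 : ∀ a, p a = 0 → q (f a) = 0) (h : ∀ b, q b = 0 → ∃ a, p a = 0 ∧ f a = b) {y : B ⊗[k] Λ}
    (hy : LinearMap.rTensor Λ q y = 0) :
    ∃ x : A ⊗[k] Λ, LinearMap.rTensor Λ p x = 0 ∧ LinearMap.rTensor Λ f x = y := by
  obtain ⟨σ, hσ⟩ := LinearMap.exists_rightInverse_of_surjective q (LinearMap.range_eq_top.2 hq)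
  let F : LinearMap.ker p →ₗ[k] LinearMap.ker q := f.restrict h0
  obtain ⟨τ, hτ⟩ := LinearMap.exists_rightInverse_of_surjective F (LinearMap.range_eq_top.2 (by
    rintro ⟨b, hb⟩
    obtain ⟨a, ha, hab⟩ := h b hb
    exact ⟨⟨a, ha⟩, Subtype.ext hab⟩))
  -- A linear map with p s = 0 and f s = 1 - σ q; tensored with Λ, it lifts every element of the
  -- kernel of q ⊗ 1.
  let s : B →ₗ[k] A := (LinearMap.ker p).subtype ∘ₗ τ ∘ₗ
    (LinearMap.id - σ ∘ₗ q).codRestrict (LinearMap.ker q) fun b => by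
      have := LinearMap.congr_fun hσ (q b)
      simp only [LinearMap.comp_apply, LinearMap.id_apply] at this
      simp [this]
  have hps : p ∘ₗ s = 0 := by
    ext b
    exact (τ _).2
  have hfs : f ∘ₗ s = LinearMap.id - σ ∘ₗ q := by
    ext b
    exact congrArg Subtype.val (LinearMap.congr_fun hτ _)
  refine ⟨LinearMap.rTensor Λ s y, ?_, ?_⟩
  · rw [← LinearMap.rTensor_comp_apply, hps, LinearMap.rTensor_zero, LinearMap.zero_apply]
  · rw [← LinearMap.rTensor_comp_apply, hfs, LinearMap.rTensor_sub, LinearMap.sub_apply,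
      LinearMap.rTensor_id, LinearMap.rTensor_comp_apply, hy, map_zero, sub_zero,
      LinearMap.id_apply]

theorem koszulGrading_rTensor {L A B : Type*} [AddCommGroup L] [Module k L] [AddCommGroup A]
    [Module k A] [AddCommGroup B] [Module k B] {f : A →ₗ[k] B} {γ : Module.End k A}
    {γ' : Module.End k B} (h : ∀ a, f (γ a) = γ' (f a)) (y : A ⊗[k] ExteriorAlgebra k L) :
    LinearMap.rTensor _ f (koszulGrading L γ y) = koszulGrading L γ' (LinearMap.rTensor _ f y) := by
  induction y with
  | zero => simp
  | add x y hx hy => simp only [map_add, hx, hy]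
  | tmul a x => simp only [koszulGrading, TensorProduct.map_tmul, LinearMap.rTensor_tmul, h]

theorem koszulMap_koszulMap {L A B C : Type*} [AddCommGroup L] [Module k L] [AddCommGroup A]
    [Module k A] [AddCommGroup B] [Module k B] [AddCommGroup C] [Module k C]
    {μ : L →ₗ[k] Module.End k A} {ν : L →ₗ[k] Module.End k B} {ξ : L →ₗ[k] Module.End k C}
    {f : A →ₗ[k] B} {g : B →ₗ[k] C} (hf : ∀ v a, ν v (f a) = f (μ v a))
    (hg : ∀ v a, ξ v (g a) = g (ν v a)) {h : A →ₗ[k] C} (hh : ∀ v a, ξ v (h a) = h (μ v a))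
    (hgf : ∀ a, g (f a) = h a) (x : DiffHomology (koszulTotalD μ)) :
    koszulMap ν ξ g hg (koszulMap μ ν f hf x) = koszulMap μ ξ h hh x := by
  obtain ⟨z, rfl⟩ := DiffHomology.mk_surjective _ x
  have hgf' : g ∘ₗ f = h := LinearMap.ext hgf
  subst hgf'
  rw [koszulMap_mk, koszulMap_mk, koszulMap_mk]
  congr 1
  exact Subtype.ext (LinearMap.rTensor_comp_apply _ g f z.1).symm

variable [CharZero k] {L A₁ A₂ B₁ B₂ : Type*} [AddCommGroup L] [Module k L]
  [AddCommGroup A₁] [Module k A₁] [AddCommGroup A₂] [Module k A₂]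
  [AddCommGroup B₁] [Module k B₁] [AddCommGroup B₂] [Module k B₂]
  {μ₁ : L →ₗ[k] Module.End k A₁} {μ₂ : L →ₗ[k] Module.End k A₂}
  {ν₁ : L →ₗ[k] Module.End k B₁} {ν₂ : L →ₗ[k] Module.End k B₂}

theorem koszulMap_homologyGrading {f : A₁ →ₗ[k] A₂} (hf : ∀ v a, μ₂ v (f a) = f (μ₁ v a))
    {γ₁ : Module.End k A₁} {γ₂ : Module.End k A₂} (hγ₁ : ∀ v a, γ₁ (μ₁ v a) = (3 : k) • μ₁ v (γ₁ a))
    (hγ₂ : ∀ v a, γ₂ (μ₂ v a) = (3 : k) • μ₂ v (γ₂ a)) (h : ∀ a, f (γ₁ a) = γ₂ (f a))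
    (x : DiffHomology (koszulTotalD μ₁)) :
    koszulMap μ₁ μ₂ f hf (homologyGrading hγ₁ x) =
      homologyGrading hγ₂ (koszulMap μ₁ μ₂ f hf x) := by
  obtain ⟨z, rfl⟩ := DiffHomology.mk_surjective _ x
  rw [homologyGrading_mk, koszulMap_mk, koszulMap_mk, homologyGrading_mk]
  congr 1
  exact Subtype.ext (koszulGrading_rTensor h z.1)

/-- The Mayer–Vietoris triangle for the coefficient square tensored with ⋀L. The bidegree of Δ
follows from its description on chains, since all maps of the square respect the gradings. -/
theorem exists_koszul_connecting (hμ₂ : ∀ v w a, μ₂ v (μ₂ w a) = μ₂ w (μ₂ v a))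
    {f : A₁ →ₗ[k] A₂} (hf : ∀ v a, μ₂ v (f a) = f (μ₁ v a))
    {p : A₁ →ₗ[k] B₁} (hp : ∀ v a, ν₁ v (p a) = p (μ₁ v a))
    {q : A₂ →ₗ[k] B₂} (hq : ∀ v a, ν₂ v (q a) = q (μ₂ v a))
    {f' : B₁ →ₗ[k] B₂} (hf' : ∀ v a, ν₂ v (f' a) = f' (ν₁ v a))
    (hsq : ∀ a, q (f a) = f' (p a)) (hps : Function.Surjective p) (hqs : Function.Surjective q)
    (hinj : ∀ a, p a = 0 → f a = 0 → a = 0) (hsurj : ∀ b, q b = 0 → ∃ a, p a = 0 ∧ f a = b)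
    (hHf' : Function.Injective (koszulMap ν₁ ν₂ f' hf'))
    {γ₁ : Module.End k A₁} {γ₂ : Module.End k A₂} {γ' : Module.End k B₂} {γ'' : Module.End k B₁}
    (hγ₁ : ∀ v a, γ₁ (μ₁ v a) = (3 : k) • μ₁ v (γ₁ a))
    (hγ₂ : ∀ v a, γ₂ (μ₂ v a) = (3 : k) • μ₂ v (γ₂ a))
    (hγ' : ∀ v a, γ' (ν₂ v a) = (3 : k) • ν₂ v (γ' a)) (hfγ : ∀ a, f (γ₁ a) = γ₂ (f a))
    (hpγ : ∀ a, p (γ₁ a) = γ'' (p a)) (hqγ : ∀ a, q (γ₂ a) = γ' (q a)) :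
    ∃ Δ : DiffHomology (koszulTotalD ν₂) →ₗ[k] DiffHomology (koszulTotalD μ₁),
      (∀ c, Δ c = 0 ↔ ∃ a b, koszulMap μ₂ ν₂ q hq a + koszulMap ν₁ ν₂ f' hf' b = c) ∧
      (∀ a, koszulMap μ₁ μ₂ f hf a = 0 ↔ ∃ c, Δ c = a) ∧
      (∀ a b, koszulMap μ₂ ν₂ q hq a = koszulMap ν₁ ν₂ f' hf' b →
        ∃ c, koszulMap μ₁ μ₂ f hf c = a) ∧
      ∀ c, homologyGrading hγ₁ (Δ c) = (2⁻¹ * 3 : k) • Δ (homologyGrading hγ' c) := by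
  have he : koszulTotalD μ₂ ∘ₗ koszulTotalD μ₂ = 0 :=
    LinearMap.ext (koszulTotalD_koszulTotalD μ₂ hμ₂)
  have hF := koszulTotalD_rTensor μ₁ f μ₂ hf
  have hP := koszulTotalD_rTensor μ₁ p ν₁ hp
  have hQ := koszulTotalD_rTensor μ₂ q ν₂ hq
  have hF' := koszulTotalD_rTensor ν₁ f' ν₂ hf'
  have hSQ : ∀ y : A₁ ⊗[k] ExteriorAlgebra k L, LinearMap.rTensor _ q (LinearMap.rTensor _ f y) =
      LinearMap.rTensor _ f' (LinearMap.rTensor _ p y) := fun y => by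
    rw [← LinearMap.rTensor_comp_apply, ← LinearMap.rTensor_comp_apply]
    congr 2
    exact LinearMap.ext hsq
  have hPs := LinearMap.rTensor_surjective (ExteriorAlgebra k L) hps
  have hQs := LinearMap.rTensor_surjective (ExteriorAlgebra k L) hqs
  have hINJ : ∀ y : A₁ ⊗[k] ExteriorAlgebra k L, LinearMap.rTensor _ p y = 0 →
      LinearMap.rTensor _ f y = 0 → y = 0 := fun y => rTensor_eq_zero_of_pair hinj
  have hSURJ : ∀ y : A₂ ⊗[k] ExteriorAlgebra k L, LinearMap.rTensor _ q y = 0 →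
      ∃ x, LinearMap.rTensor _ p x = 0 ∧ LinearMap.rTensor _ f x = y := fun y =>
    exists_rTensor_eq_of_ker hqs (fun a ha => by rw [hsq, ha, map_zero]) hsurj
  obtain ⟨Δ, h1, h2, h3⟩ := DiffHomology.exists_connecting he _ _ _ _ hF hP hQ hF' hSQ hPs hQs hINJ
    hSURJ hHf'
  refine ⟨Δ, h1, h2, fun a b hab => DiffHomology.exists_map_eq_of_map_eq he _ _ _ _ hF hP hQ hF'
    hSQ hPs hQs hINJ hSURJ hab, fun c => ?_⟩
  obtain ⟨z, rfl⟩ := DiffHomology.mk_surjective _ c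
  obtain ⟨b, hb⟩ := hQs z.1
  obtain ⟨a, ha, hab⟩ := hSURJ (koszulTotalD μ₂ b) (by rw [← hQ, hb, z.2])
  have haD : koszulTotalD μ₁ a = 0 := hINJ _ (by rw [← hP, ha, map_zero])
    (by rw [← hF, hab, koszulTotalD_koszulTotalD μ₂ hμ₂])
  rw [h3 z b ⟨a, LinearMap.mem_ker.2 haD⟩ hb hab.symm ha, homologyGrading_mk, homologyGrading_mk,
    ← map_smul, ← map_smul]
  -- If b lifts z and has differential f a, then the graded image of b, multiplied by 3/2, has the
  -- graded image of f a as its differential. The scalar compensates for the failure of the grading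
  -- to commute with the differential.
  refine (h3 _ ((2⁻¹ * 3 : k) • koszulGrading L γ₂ b) _ ?_ ?_ ?_).symm
  · rw [map_smul, koszulGrading_rTensor hqγ, hb]
    rfl
  · rw [map_smul, ← koszulGrading_koszulTotalD hγ₂, ← hab]
    exact (koszulGrading_rTensor hfγ a).symm
  · exact (koszulGrading_rTensor hpγ a).trans (by rw [ha, map_zero])

omit [CharZero k] in
/-- The exact triangle which is obtained by identifying the cokernel of a map with the quotient of a
tensor product. -/
theorem exists_exact_triangle {H₁ H₂ V₁ V₂ X Y : Type*} [AddCommGroup H₁] [Module k H₁]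
    [AddCommGroup H₂] [Module k H₂] [AddCommGroup V₁] [Module k V₁] [AddCommGroup V₂] [Module k V₂]
    [AddCommGroup X] [Module k X] [AddCommGroup Y] [Module k Y] (F : H₁ →ₗ[k] H₂)
    (P : H₁ →ₗ[k] V₁) (Q : H₂ →ₗ[k] V₂) (F' : V₁ →ₗ[k] V₂) (hsq : ∀ a, Q (F a) = F' (P a))
    (Δ : V₂ →ₗ[k] H₁) (h1 : ∀ c, Δ c = 0 ↔ ∃ a b, Q a + F' b = c)
    (h2 : ∀ a, F a = 0 ↔ ∃ c, Δ c = a) (h3 : ∀ a b, Q a = F' b → ∃ c, F c = a)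
    (N : V₂ ≃ₗ[k] X ⊗[k] Y) {u : X} (hN : ∀ c, (∃ b, F' b = c) ↔ N c ∈ leftMultiples k Y u)
    {Γ₁ : Module.End k H₁} {Γ₂ : Module.End k H₂} {Γ : Module.End k V₂} {ΓX : Module.End k X}
    {ΓY : Module.End k Y} (hu : ΓX u = u) (hQΓ : ∀ a, Q (Γ₂ a) = Γ (Q a))
    (hΔΓ : ∀ c, Γ₁ (Δ c) = (2⁻¹ * 3 : k) • Δ (Γ c))
    (hNΓ : ∀ c, N (Γ c) = TensorProduct.map ΓX ΓY (N c)) :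
    ∃ (G : H₂ →ₗ[k] (X ⊗[k] Y) ⧸ leftMultiples k Y u)
      (D : (X ⊗[k] Y) ⧸ leftMultiples k Y u →ₗ[k] H₁),
      (∀ v, quotientGrading ΓX ΓY hu (G v) = G (Γ₂ v)) ∧
      (∀ v, Γ₁ (D v) = (2⁻¹ * 3 : k) • D (quotientGrading ΓX ΓY hu v)) ∧
      Function.Exact F G ∧ Function.Exact G D ∧ Function.Exact D F := by
  -- Δ kills the image of F', which N identifies with the multiples of u, so Δ descends to the
  -- quotient.
  have hle : leftMultiples k Y u ≤ LinearMap.ker (Δ ∘ₗ N.symm.toLinearMap) := fun x hx => by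
    obtain ⟨b, hb⟩ := (hN (N.symm x)).2 (by rwa [LinearEquiv.apply_symm_apply])
    exact (h1 _).2 ⟨0, b, by rw [map_zero, zero_add, hb]; rfl⟩
  let G : H₂ →ₗ[k] (X ⊗[k] Y) ⧸ leftMultiples k Y u :=
    (leftMultiples k Y u).mkQ ∘ₗ N.toLinearMap ∘ₗ Q
  let D : (X ⊗[k] Y) ⧸ leftMultiples k Y u →ₗ[k] H₁ :=
    (leftMultiples k Y u).liftQ (Δ ∘ₗ N.symm.toLinearMap) hle
  let π : V₂ → (X ⊗[k] Y) ⧸ leftMultiples k Y u := fun c => (leftMultiples k Y u).mkQ (N c)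
  have hπ : Function.Surjective π := (Submodule.mkQ_surjective _).comp N.surjective
  have hG : ∀ a, G a = π (Q a) := fun a => rfl
  have hD : ∀ c, D (π c) = Δ c := fun c => congrArg Δ (N.symm_apply_apply c)
  have hπΓ : ∀ c, quotientGrading ΓX ΓY hu (π c) = π (Γ c) := fun c =>
    congrArg (leftMultiples k Y u).mkQ (hNΓ c).symm
  have hπ0 : ∀ c, π c = 0 ↔ ∃ b, F' b = c := fun c =>
    (Submodule.Quotient.mk_eq_zero _).trans (hN c).symm
  have hπ1 : ∀ c c', π c = π c' ↔ ∃ b, F' b = c - c' := fun c c' => by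
    rw [← hπ0, ← sub_eq_zero]
    simp only [π, map_sub]
  refine ⟨G, D, fun v => ?_, fun v => ?_, fun a => ?_, fun x => ?_, fun a => ?_⟩
  · rw [hG, hG, hπΓ, hQΓ]
  · obtain ⟨c, rfl⟩ := hπ v
    rw [hD, hπΓ, hD, hΔΓ]
  · rw [hG, hπ0]
    constructor
    · rintro ⟨b, hb⟩
      exact h3 a b hb.symm
    · rintro ⟨c, rfl⟩
      exact ⟨P c, (hsq c).symm⟩
  · obtain ⟨c, rfl⟩ := hπ x
    rw [hD, h1]
    constructor
    · rintro ⟨a, b, hab⟩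
      refine ⟨a, ?_⟩
      rw [hG, hπ1]
      exact ⟨-b, by rw [map_neg, ← hab]; abel⟩
    · rintro ⟨a, ha⟩
      rw [hG, hπ1] at ha
      obtain ⟨b, hb⟩ := ha
      exact ⟨a, -b, by rw [map_neg, hb]; abel⟩
  · rw [h2]
    constructor
    · rintro ⟨c, rfl⟩
      exact ⟨π c, hD c⟩
    · rintro ⟨x, rfl⟩
      obtain ⟨c, rfl⟩ := hπ x
      exact ⟨c, (hD c).symm⟩

end Triangle

end

noncomputable section

/-! ### Linear forms and their actions -/

section LinearForms

open MvPolynomial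

variable {α : Type*} {N N' : Matroid α} {e : α}

theorem X_sub_X_mem_linearForms {i j : α} (hi : i ∈ N.E) (hj : j ∈ N.E) :
    (X i - X j : MvPolynomial α ℂ) ∈ linearForms (sCirc N) :=
  ⟨Algebra.subset_adjoin ⟨i, hi, j, hj, rfl⟩,
    (isHomogeneous_X ℂ i).sub (isHomogeneous_X ℂ j)⟩

theorem linearForms_mono (h : N.E ⊆ N'.E) :
    linearForms (sCirc N) ≤ linearForms (sCirc N') :=
  inf_le_inf_right _ (Algebra.adjoin_mono fun _ ⟨i, hi, j, hj, hp⟩ => ⟨i, h hi, j, h hj, hp⟩)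

open Classical in
/-- The linear form `x_i - x_e` for `i` in the ground set, and `0` otherwise. -/
def baseDiff (he : e ∈ N.E) (i : α) : linearForms (sCirc N) :=
  if hi : i ∈ N.E then ⟨X i - X e, X_sub_X_mem_linearForms hi he⟩ else 0

theorem baseDiff_coe (he : e ∈ N.E) {i : α} (hi : i ∈ N.E) :
    (baseDiff he i : MvPolynomial α ℂ) = X i - X e := by
  rw [baseDiff, dif_pos hi]

theorem baseDiff_of_notMem (he : e ∈ N.E) {i : α} (hi : i ∉ N.E) : baseDiff he i = 0 := dif_neg hi

theorem baseDiff_self (he : e ∈ N.E) : baseDiff he e = 0 :=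
  Subtype.ext (by rw [baseDiff_coe he he, sub_self]; rfl)

/-- The coefficient of `x_i`. -/
def linearCoeff (i : α) : MvPolynomial α ℂ →ₗ[ℂ] ℂ := MvPolynomial.lcoeff ℂ (Finsupp.single i 1)

open Classical in
theorem linearCoeff_X (i j : α) : linearCoeff i (X j) = if j = i then 1 else 0 := by
  simp [linearCoeff, coeff_X, Finsupp.single_left_inj]

variable [Fintype α]

/-- The linear map `x_i ↦ x_i - x_e`, and `x_i ↦ 0` outside the ground set. -/
def linearProj (he : e ∈ N.E) : MvPolynomial α ℂ →ₗ[ℂ] linearForms (sCirc N) :=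
  ∑ i, (linearCoeff i).smulRight (baseDiff he i)

theorem linearProj_apply (he : e ∈ N.E) (p : MvPolynomial α ℂ) :
    linearProj he p = ∑ i, linearCoeff i p • baseDiff he i := by
  simp [linearProj]

theorem linearProj_X (he : e ∈ N.E) (i : α) : linearProj he (X i) = baseDiff he i := by
  classical
  simp [linearProj_apply, linearCoeff_X]

theorem eq_sum_linearCoeff {p : MvPolynomial α ℂ} (hp : p.IsHomogeneous 1) :
    p = ∑ i, linearCoeff i p • X i := by
  classical
  rw [← mem_homogeneousSubmodule, homogeneousSubmodule_one_eq_span_X] at hp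
  induction hp using Submodule.span_induction with
  | mem x hx =>
    obtain ⟨j, rfl⟩ := hx
    simp [linearCoeff_X]
  | zero => simp
  | add x y _ _ hx hy =>
    conv_lhs => rw [hx, hy]
    simp only [map_add, add_smul, Finset.sum_add_distrib]
  | smul c x _ hx =>
    conv_lhs => rw [hx]
    simp only [map_smul, smul_assoc, Finset.smul_sum]

/-- The substitution x_i ↦ x_i - x_e fixes every difference, hence the whole subring they generate.
On a degree one element this says that it is a combination of the forms x_i - x_e, without
describing the degree one part of the subring beforehand. -/
theorem linearProj_coe (he : e ∈ N.E) (v : linearForms (sCirc N)) :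
    linearProj he (v : MvPolynomial α ℂ) = v := by
  classical
  let T : MvPolynomial α ℂ →ₐ[ℂ] MvPolynomial α ℂ := aeval fun i => (baseDiff he i).1
  have hT : ∀ p ∈ sCirc N, T p = p := fun p hp => by
    refine (Algebra.adjoin_le ?_ : sCirc N ≤ AlgHom.equalizer T (AlgHom.id ℂ _)) hp
    rintro _ ⟨i, hi, j, hj, rfl⟩
    change T _ = _
    simp [T, baseDiff_coe he hi, baseDiff_coe he hj]
  refine Subtype.ext ?_
  conv_rhs => rw [← hT _ v.2.1, eq_sum_linearCoeff (p := v.1) v.2.2]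
  rw [linearProj_apply]
  simp [T]

theorem linearForms_hom_ext (he : e ∈ N.E) {W : Type*} [AddCommGroup W] [Module ℂ W]
    {f g : linearForms (sCirc N) →ₗ[ℂ] W} (h : ∀ i ∈ N.E, f (baseDiff he i) = g (baseDiff he i)) :
    f = g := by
  ext v
  rw [← linearProj_coe he v, linearProj_apply, map_sum, map_sum]
  refine Finset.sum_congr rfl fun i _ => ?_
  rw [map_smul, map_smul]
  by_cases hi : i ∈ N.E
  · rw [h i hi]
  · rw [baseDiff_of_notMem he hi, map_zero, map_zero]

/-! #### Actions through homomorphisms from the polynomial ring -/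

/-- The action of the linear forms through a homomorphism from the polynomial ring. -/
def formsAction (N : Matroid α) {A : Type*} [CommRing A] [Algebra ℂ A]
    (φ : MvPolynomial α ℂ →ₐ[ℂ] A) : linearForms (sCirc N) →ₗ[ℂ] Module.End ℂ A :=
  linearFormsAction (sCirc N) (φ.comp (sCirc N).val)

section Action

variable {A B : Type*} [CommRing A] [Algebra ℂ A] [CommRing B] [Algebra ℂ B]
  {φ : MvPolynomial α ℂ →ₐ[ℂ] A} {ψ : MvPolynomial α ℂ →ₐ[ℂ] B}

omit [Fintype α] in
theorem formsAction_apply (v : linearForms (sCirc N)) (a : A) : formsAction N φ v a = φ v * a := rfl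

omit [Fintype α] in
theorem formsAction_comm (v w : linearForms (sCirc N)) (a : A) :
    formsAction N φ v (formsAction N φ w a) = formsAction N φ w (formsAction N φ v a) :=
  mul_left_comm _ _ _

theorem map_linearForms_eq (he : e ∈ N.E) {f : A →ₗ[ℂ] B}
    (h : ∀ i ∈ N.E, f (φ (X i - X e)) = ψ (X i - X e)) (v : linearForms (sCirc N)) :
    f (φ v) = ψ v := by
  refine LinearMap.congr_fun (f := f ∘ₗ φ.toLinearMap ∘ₗ (linearForms (sCirc N)).subtype)
    (g := ψ.toLinearMap ∘ₗ (linearForms (sCirc N)).subtype)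
    (linearForms_hom_ext he fun i hi => ?_) v
  have := h i hi
  rw [← baseDiff_coe he hi] at this
  exact this

theorem formsAction_algHom (he : e ∈ N.E) {f : A →ₐ[ℂ] B}
    (h : ∀ i ∈ N.E, f (φ (X i - X e)) = ψ (X i - X e)) (v : linearForms (sCirc N)) (a : A) :
    formsAction N ψ v (f a) = f (formsAction N φ v a) := by
  rw [formsAction_apply, formsAction_apply, map_mul]
  congr 1
  exact (map_linearForms_eq he (f := f.toLinearMap) h v).symm

theorem formsAction_scale (he : e ∈ N.E) {γ : A →ₐ[ℂ] A}
    (h : ∀ i ∈ N.E, γ (φ (X i)) = (3 : ℂ) • φ (X i)) (v : linearForms (sCirc N)) (a : A) :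
    γ (formsAction N φ v a) = (3 : ℂ) • formsAction N φ v (γ a) := by
  rw [formsAction_apply, formsAction_apply, map_mul, ← smul_mul_assoc]
  congr 1
  rw [← map_smul]
  refine LinearMap.congr_fun
    (f := γ.toLinearMap ∘ₗ φ.toLinearMap ∘ₗ (linearForms (sCirc N)).subtype)
    (g := φ.toLinearMap ∘ₗ ((3 : ℂ) • LinearMap.id) ∘ₗ (linearForms (sCirc N)).subtype)
    (linearForms_hom_ext he fun i hi => ?_) v
  simp [baseDiff_coe he hi, h i hi, h e he, smul_sub]

theorem koszulUnit_formsAction_ne_zero (he : e ∈ N.E) (ε : A →ₐ[ℂ] ℂ)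
    (h : ∀ i ∈ N.E, ε (φ (X i)) = 0) : koszulUnit (formsAction N φ) (1 : A) ≠ 0 := by
  refine koszulUnit_ne_zero _ ε.toLinearMap (fun v a => ?_) (by simp)
  have hv : ε (φ v) = 0 := LinearMap.congr_fun
    (f := ε.toLinearMap ∘ₗ φ.toLinearMap ∘ₗ (linearForms (sCirc N)).subtype) (g := 0)
    (linearForms_hom_ext he fun i hi => by simp [baseDiff_coe he hi, h i hi, h e he]) v
  simp [formsAction_apply, hv]

omit [Fintype α] in
theorem prodAction_formsAction (v : linearForms (sCirc N)) (w : linearForms (sCirc N'))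
    (t : A ⊗[ℂ] B) : prodAction (formsAction N φ) (formsAction N' ψ) (v, w) t =
      (φ v ⊗ₜ 1 + 1 ⊗ₜ ψ w) * t := by
  induction t with
  | zero => simp
  | add x y hx hy => rw [map_add, hx, hy, mul_add]
  | tmul a b => simp [formsAction_apply, add_mul]

end Action

end LinearForms

end

noncomputable section

/-! ### The decomposition of the linear forms at the center of a flip -/

section Decomposition

open MvPolynomial StanleyReisner

variable {α : Type*} [Fintype α] {M N N' : Matroid α} {i₀ j₀ : α}

/-- The projections of the linear forms to those of two matroids on complementary ground sets. -/
def formsProj (M : Matroid α) (hi₀ : i₀ ∈ N.E) (hj₀ : j₀ ∈ N'.E) :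
    linearForms (sCirc M) →ₗ[ℂ] linearForms (sCirc N) × linearForms (sCirc N') :=
  ((linearProj hi₀).prod (linearProj hj₀)) ∘ₗ (linearForms (sCirc M)).subtype

/-- The inclusion of the linear forms of two matroids on complementary ground sets. -/
def formsIncl (h : N.E ⊆ M.E) (h' : N'.E ⊆ M.E) :
    linearForms (sCirc N) × linearForms (sCirc N') →ₗ[ℂ] linearForms (sCirc M) :=
  (Submodule.inclusion (linearForms_mono h)).coprod (Submodule.inclusion (linearForms_mono h'))

open Classical in
/-- The sum of the coefficients at the elements of a set. -/
def formsSum (M : Matroid α) (Z : Set α) : linearForms (sCirc M) →ₗ[ℂ] ℂ :=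
  (∑ i, if i ∈ Z then linearCoeff i else 0) ∘ₗ (linearForms (sCirc M)).subtype

open Classical in
theorem formsSum_of_coe {Z : Set α} {v : linearForms (sCirc M)} {i j : α} (h : v.1 = X i - X j) :
    formsSum M Z v = (if i ∈ Z then 1 else 0) - if j ∈ Z then 1 else 0 := by
  have hX : ∀ i, (∑ i, if i ∈ Z then linearCoeff i else 0) (X i : MvPolynomial α ℂ) =
      if i ∈ Z then 1 else 0 := fun i => by
    rw [LinearMap.sum_apply, Finset.sum_eq_single i]
    · split_ifs <;> simp [linearCoeff_X]
    · intro j _ hj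
      split_ifs
      · rw [linearCoeff_X, if_neg hj.symm]
      · rfl
    · simp
  rw [formsSum, LinearMap.comp_apply, Submodule.subtype_apply, h, map_sub, hX, hX]

omit [Fintype α] in
theorem formsIncl_inl_coe (h : N.E ⊆ M.E) (h' : N'.E ⊆ M.E) (v : linearForms (sCirc N)) :
    (formsIncl h h' (v, 0)).1 = v.1 := by
  rw [formsIncl, LinearMap.coprod_apply, map_zero, add_zero, Submodule.coe_inclusion]

omit [Fintype α] in
theorem formsIncl_inr_coe (h : N.E ⊆ M.E) (h' : N'.E ⊆ M.E) (v : linearForms (sCirc N')) :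
    (formsIncl h h' (0, v)).1 = v.1 := by
  rw [formsIncl, LinearMap.coprod_apply, map_zero, zero_add, Submodule.coe_inclusion]

theorem formsProj_of_coe (hi₀ : i₀ ∈ N.E) (hj₀ : j₀ ∈ N'.E) {v : linearForms (sCirc M)} {i j : α}
    (h : v.1 = X i - X j) : formsProj M hi₀ hj₀ v =
      (baseDiff hi₀ i - baseDiff hi₀ j, baseDiff hj₀ i - baseDiff hj₀ j) := by
  have h1 : formsProj M hi₀ hj₀ v = (linearProj hi₀ v.1, linearProj hj₀ v.1) := rfl
  rw [h1, h, map_sub, map_sub, linearProj_X, linearProj_X, linearProj_X, linearProj_X]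

variable (h : N.E ⊆ M.E) (h' : N'.E ⊆ M.E) (hd : Disjoint N.E N'.E) (hi₀ : i₀ ∈ N.E)
  (hj₀ : j₀ ∈ N'.E)

include hd in
theorem formsProj_formsIncl : formsProj M hi₀ hj₀ ∘ₗ formsIncl h h' = LinearMap.id := by
  refine LinearMap.prod_ext (linearForms_hom_ext hi₀ fun i hi => ?_)
    (linearForms_hom_ext hj₀ fun i hi => ?_)
  · change formsProj M hi₀ hj₀ (formsIncl h h' (baseDiff hi₀ i, 0)) = (baseDiff hi₀ i, 0)
    rw [formsProj_of_coe hi₀ hj₀ ((formsIncl_inl_coe h h' _).trans (baseDiff_coe hi₀ hi)),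
      baseDiff_self, sub_zero, baseDiff_of_notMem hj₀ (Set.disjoint_left.1 hd hi),
      baseDiff_of_notMem hj₀ (Set.disjoint_left.1 hd hi₀), sub_zero]
  · change formsProj M hi₀ hj₀ (formsIncl h h' (0, baseDiff hj₀ i)) = (0, baseDiff hj₀ i)
    rw [formsProj_of_coe hi₀ hj₀ ((formsIncl_inr_coe h h' _).trans (baseDiff_coe hj₀ hi)),
      baseDiff_self, sub_zero, baseDiff_of_notMem hi₀ (Set.disjoint_right.1 hd hi),
      baseDiff_of_notMem hi₀ (Set.disjoint_right.1 hd hj₀), sub_zero]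

include hd hi₀ hj₀ in
theorem formsSum_formsIncl (v : linearForms (sCirc N) × linearForms (sCirc N')) :
    formsSum M N.E (formsIncl h h' v) = 0 := by
  refine LinearMap.congr_fun (f := formsSum M N.E ∘ₗ formsIncl h h') (g := 0)
    (LinearMap.prod_ext (linearForms_hom_ext hi₀ fun i hi => ?_)
      (linearForms_hom_ext hj₀ fun i hi => ?_)) v
  · change formsSum M N.E (formsIncl h h' (baseDiff hi₀ i, 0)) = 0
    rw [formsSum_of_coe ((formsIncl_inl_coe h h' _).trans (baseDiff_coe hi₀ hi)), if_pos hi,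
      if_pos hi₀, sub_self]
  · change formsSum M N.E (formsIncl h h' (0, baseDiff hj₀ i)) = 0
    rw [formsSum_of_coe ((formsIncl_inr_coe h h' _).trans (baseDiff_coe hj₀ hi)),
      if_neg (Set.disjoint_right.1 hd hi), if_neg (Set.disjoint_right.1 hd hj₀), sub_self]

include h hd in
theorem formsProj_baseDiff_of_mem {i : α} (hi : i ∈ N.E) :
    formsProj M hi₀ hj₀ (baseDiff (h' hj₀) i) = (baseDiff hi₀ i, 0) := by
  rw [formsProj_of_coe hi₀ hj₀ (baseDiff_coe (h' hj₀) (h hi)), baseDiff_self hj₀,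
    baseDiff_of_notMem hj₀ (Set.disjoint_left.1 hd hi),
    baseDiff_of_notMem hi₀ (Set.disjoint_right.1 hd hj₀), sub_zero, sub_zero]

include hd in
theorem formsProj_baseDiff_of_mem_right {i : α} (hi : i ∈ N'.E) :
    formsProj M hi₀ hj₀ (baseDiff (h' hj₀) i) = (0, baseDiff hj₀ i) := by
  rw [formsProj_of_coe hi₀ hj₀ (baseDiff_coe (h' hj₀) (h' hi)), baseDiff_self hj₀,
    baseDiff_of_notMem hi₀ (Set.disjoint_right.1 hd hi),
    baseDiff_of_notMem hi₀ (Set.disjoint_right.1 hd hj₀), sub_zero, sub_zero]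

include h hd hj₀ in
theorem formsSum_baseDiff_of_mem {i : α} (hi : i ∈ N.E) :
    formsSum M N.E (baseDiff (h' hj₀) i) = 1 := by
  rw [formsSum_of_coe (baseDiff_coe (h' hj₀) (h hi)), if_pos hi,
    if_neg (Set.disjoint_right.1 hd hj₀), sub_zero]

include hd in
-- The splitting L_M = L_N ⊕ L_{N'} ⊕ ℂ (x_{i₀} - x_{j₀}). On the spanning forms it reads x_i -
-- x_{j₀} = (x_i - x_{i₀}) + (x_{i₀} - x_{j₀}) for i in N, and the third coordinate is the sum of
-- the coefficients over N.
theorem eq_formsIncl_add (hE : M.E ⊆ N.E ∪ N'.E) (v : linearForms (sCirc M)) :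
    v = formsIncl h h' (formsProj M hi₀ hj₀ v) + formsSum M N.E v • baseDiff (h' hj₀) i₀ := by
  refine LinearMap.congr_fun (f := LinearMap.id) (g := formsIncl h h' ∘ₗ formsProj M hi₀ hj₀ +
    (formsSum M N.E).smulRight (baseDiff (h' hj₀) i₀))
    (linearForms_hom_ext (h' hj₀) fun i hi => Subtype.ext ?_) v
  have hv := baseDiff_coe (h' hj₀) hi
  rw [LinearMap.id_apply, LinearMap.add_apply, LinearMap.comp_apply, LinearMap.smulRight_apply,
    Submodule.coe_add, Submodule.coe_smul]
  rcases hE hi with hi1 | hi1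
  · rw [formsProj_baseDiff_of_mem h h' hd hi₀ hj₀ hi1, formsIncl_inl_coe,
      formsSum_baseDiff_of_mem h h' hd hj₀ hi1, one_smul, baseDiff_coe hi₀ hi1, hv,
      baseDiff_coe (h' hj₀) (h hi₀), sub_add_sub_cancel]
  · rw [formsProj_baseDiff_of_mem_right h' hd hi₀ hj₀ hi1, formsIncl_inr_coe,
      formsSum_of_coe hv, if_neg (Set.disjoint_right.1 hd hi1),
      if_neg (Set.disjoint_right.1 hd hj₀), sub_self, zero_smul, add_zero, hv,
      baseDiff_coe hj₀ hi1]

end Decomposition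

section FreeAcyclic

open MvPolynomial

variable {α : Type*} [Fintype α] {N : Matroid α} {Z : Set α} {i₀ : α}

/-- The homomorphism `x_i ↦ x_i`, `x_{i₀} ↦ 0`. -/
def freeMap (Z : Set α) (i₀ : α) : MvPolynomial α ℂ →ₐ[ℂ] FreeVarRing Z i₀ := aeval (freeElt Z i₀)

omit [Fintype α] in
theorem freeMap_X (i : α) : freeMap Z i₀ (X i) = freeElt Z i₀ i := aeval_X _ _

theorem pderiv_freeMap (he : i₀ ∈ N.E) (j : {i // i ∈ N.E ∧ i ≠ i₀})
    (v : linearForms (sCirc N)) :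
    pderiv j (freeMap N.E i₀ v) = algebraMap ℂ _ (linearCoeff j.1 v.1) := by
  classical
  refine LinearMap.congr_fun (f := (pderiv j).toLinearMap ∘ₗ (freeMap N.E i₀).toLinearMap ∘ₗ
      (linearForms (sCirc N)).subtype)
    (g := (Algebra.linearMap ℂ (FreeVarRing N.E i₀)) ∘ₗ linearCoeff j.1 ∘ₗ
      (linearForms (sCirc N)).subtype)
    (linearForms_hom_ext he fun i hi => ?_) v
  by_cases hii : i = i₀
  · rw [hii, baseDiff_self, map_zero, map_zero]
  · have hX : freeElt N.E i₀ i = X ⟨i, hi, hii⟩ := dif_pos ⟨hi, hii⟩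
    have h1 : linearCoeff j.1 (X i - X i₀ : MvPolynomial α ℂ) = if i = j.1 then 1 else 0 := by
      rw [map_sub, linearCoeff_X, linearCoeff_X, if_neg j.2.2.symm, sub_zero]
    have h2 : freeMap N.E i₀ (X i - X i₀) = X ⟨i, hi, hii⟩ := by
      rw [map_sub, freeMap_X, freeMap_X, freeElt_self, sub_zero, hX]
    change pderiv j (freeMap N.E i₀ (baseDiff he i).1) =
      algebraMap ℂ _ (linearCoeff j.1 (baseDiff he i).1)
    rw [baseDiff_coe he hi, h1, h2]
    by_cases hij : i = j.1
    · have hij' : (⟨i, hi, hii⟩ : {i // i ∈ N.E ∧ i ≠ i₀}) = j := Subtype.ext hij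
      rw [if_pos hij, hij', pderiv_X_self, map_one]
    · rw [if_neg hij, pderiv_X_of_ne fun h => hij (congrArg Subtype.val h), map_zero]

open Classical in
theorem sum_linearCoeff_smul_baseDiff (he : i₀ ∈ N.E) (v : linearForms (sCirc N)) :
    ∑ j : {i // i ∈ N.E ∧ i ≠ i₀}, linearCoeff j.1 v.1 • baseDiff he j.1 = v := by
  conv_rhs => rw [← linearProj_coe he v, linearProj_apply]
  rw [← Finset.sum_subtype (Finset.univ.filter fun i => i ∈ N.E ∧ i ≠ i₀) (by simp)
    fun i => linearCoeff i v.1 • baseDiff he i]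
  refine Finset.sum_filter_of_ne fun i _ hne => ?_
  by_contra hi
  refine hne ?_
  rw [not_and_or, not_not] at hi
  rcases hi with hi | rfl
  · rw [baseDiff_of_notMem he hi, smul_zero]
  · rw [baseDiff_self, smul_zero]

/-- The forms x_i - x_{i₀} with i ≠ i₀ act as the indeterminates, so this is the Koszul complex of a
polynomial ring over itself; the partial derivatives give its contraction. -/
theorem freeMap_acyclic (hN : N.E = Z) (hi₀ : i₀ ∈ Z)
    (y : FreeVarRing Z i₀ ⊗[ℂ] ExteriorAlgebra ℂ (linearForms (sCirc N)))
    (hy : koszulTotalD (formsAction N (freeMap Z i₀)) y = 0) :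
    ∃ (r : ℂ) (u : _), y = r • (1 : FreeVarRing Z i₀) ⊗ₜ 1 +
      koszulTotalD (formsAction N (freeMap Z i₀)) u := by
  classical
  subst hN
  have he : i₀ ∈ N.E := hi₀
  refine koszulTotal_acyclic (J := {i // i ∈ N.E ∧ i ≠ i₀}) _
    (fun v w a => formsAction_comm v w a)
    (fun j => baseDiff he j.1) (fun j => linearCoeff j.1 ∘ₗ (linearForms (sCirc N)).subtype)
    (fun j => (pderiv j).toLinearMap) (fun j v a => ?_) (sum_linearCoeff_smul_baseDiff he)
    (fun s => homogeneousSubmodule _ ℂ s) ?_ (fun s a ha => ?_) 1 (fun p hp => ?_)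
    (fun j => (pderiv j).map_one_eq_zero) y hy
  · change pderiv j (freeMap N.E i₀ v * a) =
      freeMap N.E i₀ v * pderiv j a + linearCoeff j.1 v.1 • a
    rw [Derivation.leibniz, pderiv_freeMap he, smul_eq_mul, smul_eq_mul, Algebra.smul_def,
      mul_comm a]
  · rw [eq_top_iff]
    rintro p -
    rw [← p.sum_homogeneousComponent]
    exact Submodule.sum_mem _ fun s _ => Submodule.mem_iSup_of_mem s
      (homogeneousComponent_mem s p)
  · rw [Nat.cast_smul_eq_nsmul, ← IsHomogeneous.sum_X_mul_pderiv ha]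
    refine Finset.sum_congr rfl fun j _ => ?_
    rw [formsAction_apply, baseDiff_coe he j.2.1, map_sub, freeMap_X, freeMap_X, freeElt_coe,
      freeElt_self, sub_zero]
    rfl
  · rw [mem_homogeneousSubmodule, ← totalDegree_zero_iff_isHomogeneous,
      totalDegree_eq_zero_iff_eq_C] at hp
    rw [hp]
    exact Submodule.mem_span_singleton.2 ⟨p.coeff 0, by rw [smul_eq_C_mul, mul_one]⟩

end FreeAcyclic

end

noncomputable section

/-! ### Evaluation homomorphisms on the rings of the two stars -/

section StarEval

open MvPolynomial StanleyReisner

variable {α : Type*} [Fintype α] {M N N' : Matroid α} {i₀ j₀ : α}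
  {R Q B : Type*} [CommRing R] [Algebra ℂ R] [CommRing Q] [Algebra ℂ Q] [CommRing B] [Algebra ℂ B]

open Classical in
/-- The structure of a polynomial ring over a tensor product on an algebra with linear forms. -/
structure IsStarRing (N N' : Matroid α) (θ : B ≃ₐ[ℂ] PolyTensor R Q)
    (φ : MvPolynomial α ℂ →ₐ[ℂ] B) (ρ : MvPolynomial α ℂ →ₐ[ℂ] R) (σ : MvPolynomial α ℂ →ₐ[ℂ] Q)
    (a : α → Q) : Prop where
  map_X : ∀ i, θ (φ (X i)) = polyLeft R Q (ρ (X i)) + (if i ∈ N.E then Polynomial.X else 0) +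
    polyRight R Q (a i)
  left_eq_zero : ∀ i, i ∉ N.E → ρ (X i) = 0
  right_eq : ∀ i ∈ N'.E, a i = σ (X i)
  const : ∀ i ∈ N.E, ∀ j ∈ N.E, a i = a j

/-- The value of the indeterminate at which the difference of two coordinates vanishes. -/
def starPoint (i₀ j₀ : α) (ρ : MvPolynomial α ℂ →ₐ[ℂ] R) (a : α → Q) : R ⊗[ℂ] Q :=
  -(ρ (X i₀) ⊗ₜ 1) - 1 ⊗ₜ (a i₀ - a j₀)

namespace IsStarRing

variable {θ : B ≃ₐ[ℂ] PolyTensor R Q} {φ : MvPolynomial α ℂ →ₐ[ℂ] B} {ρ : MvPolynomial α ℂ →ₐ[ℂ] R}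
  {σ : MvPolynomial α ℂ →ₐ[ℂ] Q} {a : α → Q} (hs : IsStarRing N N' θ φ ρ σ a)
  (h : N.E ⊆ M.E) (h' : N'.E ⊆ M.E) (hd : Disjoint N.E N'.E) (hE : M.E ⊆ N.E ∪ N'.E)
  (hi₀ : i₀ ∈ N.E) (hj₀ : j₀ ∈ N'.E)
include hs

omit [Fintype α] in
include hd hi₀ hj₀ in
theorem map_center : θ (φ (X i₀ - X j₀)) = Polynomial.X - Polynomial.C (starPoint i₀ j₀ ρ a) := by
  rw [map_sub, map_sub, hs.map_X, hs.map_X, if_pos hi₀, if_neg (Set.disjoint_right.1 hd hj₀),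
    hs.left_eq_zero j₀ (Set.disjoint_right.1 hd hj₀), map_zero, starPoint, polyLeft_apply,
    polyRight_apply, polyRight_apply, TensorProduct.tmul_sub]
  simp only [map_sub, map_neg]
  ring

omit [Fintype α] in
include hd hi₀ hj₀ in
theorem eval_of_mem {i : α} (hi : i ∈ N.E) : evalAt θ (starPoint i₀ j₀ ρ a) (φ (X i - X j₀)) =
    ρ (X i - X i₀) ⊗ₜ 1 := by
  rw [evalAt_apply, map_sub, map_sub, hs.map_X, hs.map_X, if_pos hi,
    if_neg (Set.disjoint_right.1 hd hj₀), hs.left_eq_zero j₀ (Set.disjoint_right.1 hd hj₀),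
    map_zero, polyLeft_apply, polyRight_apply, polyRight_apply, hs.const i hi i₀ hi₀]
  simp only [Polynomial.eval_sub, Polynomial.eval_add, Polynomial.eval_C, Polynomial.eval_X,
    Polynomial.eval_zero, starPoint, TensorProduct.tmul_sub, map_sub, TensorProduct.sub_tmul]
  ring

omit [Fintype α] in
include hd hj₀ in
theorem eval_of_mem_right {i : α} (hi : i ∈ N'.E) :
    evalAt θ (starPoint i₀ j₀ ρ a) (φ (X i - X j₀)) = 1 ⊗ₜ σ (X i - X j₀) := by
  rw [evalAt_apply, map_sub, map_sub, hs.map_X, hs.map_X, if_neg (Set.disjoint_right.1 hd hi),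
    if_neg (Set.disjoint_right.1 hd hj₀), hs.left_eq_zero j₀ (Set.disjoint_right.1 hd hj₀),
    hs.left_eq_zero i (Set.disjoint_right.1 hd hi), map_zero, polyRight_apply, polyRight_apply,
    hs.right_eq i hi, hs.right_eq j₀ hj₀]
  simp only [Polynomial.eval_sub, Polynomial.eval_add, Polynomial.eval_C, Polynomial.eval_zero,
    TensorProduct.tmul_sub, map_sub]
  ring

include h h' hd hE in
-- After x_{i₀} - x_{j₀} is set to zero, x_i - x_{j₀} becomes ρ(x_i - x_{i₀}) ⊗ 1 for i in N,
-- because a is constant on N, and 1 ⊗ σ(x_i - x_{j₀}) for i in N'. So the two groups of forms act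
-- on separate tensor factors.
theorem prodAction_formsProj (v : linearForms (sCirc M)) (b : B) :
    prodAction (formsAction N ρ) (formsAction N' σ) (formsProj M hi₀ hj₀ v)
      (evalAt θ (starPoint i₀ j₀ ρ a) b) =
      evalAt θ (starPoint i₀ j₀ ρ a) (formsAction M φ v b) := by
  rw [formsAction_apply, map_mul]
  change prodAction _ _ ((formsProj M hi₀ hj₀ v).1, (formsProj M hi₀ hj₀ v).2) _ = _
  rw [prodAction_formsAction]
  congr 1
  let f : linearForms (sCirc N) →ₗ[ℂ] R ⊗[ℂ] Q := (TensorProduct.mk ℂ R Q).flip 1 ∘ₗ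
    ρ.toLinearMap ∘ₗ (linearForms (sCirc N)).subtype
  let g : linearForms (sCirc N') →ₗ[ℂ] R ⊗[ℂ] Q := TensorProduct.mk ℂ R Q 1 ∘ₗ
    σ.toLinearMap ∘ₗ (linearForms (sCirc N')).subtype
  let e : linearForms (sCirc M) →ₗ[ℂ] R ⊗[ℂ] Q := (evalAt θ (starPoint i₀ j₀ ρ a)).toLinearMap ∘ₗ
    φ.toLinearMap ∘ₗ (linearForms (sCirc M)).subtype
  have hf : ∀ v, f v = ρ v ⊗ₜ 1 := fun v => rfl
  have hg : ∀ v, g v = 1 ⊗ₜ σ v := fun v => rfl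
  have he : ∀ v, e v = evalAt θ (starPoint i₀ j₀ ρ a) (φ v) := fun v => rfl
  rw [← hf, ← hg, ← he, ← LinearMap.coprod_apply, ← LinearMap.comp_apply]
  refine LinearMap.congr_fun (linearForms_hom_ext (h' hj₀) fun i hi => ?_) v
  rw [LinearMap.comp_apply, he, baseDiff_coe (h' hj₀) hi]
  rcases hE hi with hi1 | hi1
  · rw [formsProj_baseDiff_of_mem h h' hd hi₀ hj₀ hi1, hs.eval_of_mem hd hi₀ hj₀ hi1,
      LinearMap.coprod_apply, map_zero, add_zero, hf, baseDiff_coe hi₀ hi1]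
  · rw [formsProj_baseDiff_of_mem_right h' hd hi₀ hj₀ hi1, hs.eval_of_mem_right hd hj₀ hi1,
      LinearMap.coprod_apply, map_zero, zero_add, hg, baseDiff_coe hj₀ hi1]

omit [Fintype α] in
include h hd hi₀ in
theorem formsAction_injective :
    Function.Injective (formsAction M φ (baseDiff (h' hj₀) i₀)) := by
  have h1 := mul_injective_of_polynomial θ (hs.map_center hd hi₀ hj₀)
  rwa [← baseDiff_coe (h' hj₀) (h hi₀)] at h1

omit [Fintype α] in
include h hd hi₀ in
theorem formsAction_exact : Function.Exact (formsAction M φ (baseDiff (h' hj₀) i₀))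
    (evalAt θ (starPoint i₀ j₀ ρ a)) := by
  have h1 := exact_mul_evalAt θ (hs.map_center hd hi₀ hj₀)
  rwa [← baseDiff_coe (h' hj₀) (h hi₀)] at h1

end IsStarRing

end StarEval

end

noncomputable section

/-! ### The structure maps of the stars of a flip -/

section StarStructure

open MvPolynomial StanleyReisner

variable {α : Type*} [Fintype α] {M : Matroid α} {Pm Pp : Set (Set α)} {Z : Set α} {i₀ j₀ : α}

open Classical in
/-- The sum of the classes `x_{F ∖ Z}` for the proper flats `F` which contain `Z` strictly and also
contain `i`. -/
def aboveSum (M : Matroid α) (Z : Set α) (i : α) : ContractRing M Z :=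
  ∑ F with i ∈ F, aboveElt M Z F

/-- Every flat that contributes contains all of Z. -/
theorem aboveSum_eq_of_mem {i j : α} (hi : i ∈ Z) (hj : j ∈ Z) :
    aboveSum M Z i = aboveSum M Z j := by
  classical
  have h : ∀ i ∈ Z, aboveSum M Z i = ∑ F, aboveElt M Z F := fun i hi =>
    Finset.sum_filter_of_ne fun F _ hF => by
      by_contra h
      exact hF (aboveElt_of_notMem fun h' => h (h'.2.1 hi))
  rw [h i hi, h j hj]

theorem structureMap_restrict (M : Matroid α) (Z : Set α) (i : α) :
    structureMap (M.restrict Z) ∅ (X i) = x _ (Sum.inl i) := by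
  simp [structureMap]

theorem structureMap_contract [M.Loopless] (hZ : Z ∈ properFlats M) {i : α} (hi : i ∉ Z) :
    structureMap (M.contract Z) (properFlats (M.contract Z)) (X i) = aboveSum M Z i := by
  classical
  rw [structureMap, aeval_X, contractRing_x_inl hZ, zero_add, aboveSum]
  have h1 : ∑ F : Set α with i ∈ F, aboveElt M Z F =
      ∑ F : Set α with F ∈ flatsAbove M Z ∧ i ∈ F, aboveElt M Z F := by
    rw [Finset.sum_filter, Finset.sum_filter]
    refine Finset.sum_congr rfl fun F _ => ?_
    by_cases hF : F ∈ flatsAbove M Z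
    · simp [hF]
    · simp [hF, aboveElt_of_notMem hF]
  rw [h1]
  refine Finset.sum_bij' (fun G _ => G ∪ Z) (fun F _ => F \ Z) ?_ ?_ ?_ ?_ ?_
  · intro G hG
    rw [Finset.mem_filter] at hG ⊢
    exact ⟨Finset.mem_univ _, ((mem_properFlats_contract_iff hZ).1 hG.2.1).2, Or.inl hG.2.2⟩
  · intro F hF
    rw [Finset.mem_filter] at hF ⊢
    exact ⟨Finset.mem_univ _, sdiff_mem_properFlats_contract hZ hF.2.1, hF.2.2, hi⟩
  · intro G hG
    rw [Finset.mem_filter] at hG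
    exact Set.union_sdiff_cancel_right
      (Set.disjoint_iff.1 ((mem_properFlats_contract_iff hZ).1 hG.2.1).1)
  · intro F hF
    rw [Finset.mem_filter] at hF
    exact Set.sdiff_union_of_subset hF.2.1.2.1
  · intro G hG
    rw [Finset.mem_filter] at hG
    exact (aboveElt_union hZ hG.2.1).symm

theorem upperToPoly_x_inr (hZ : M.IsFlat Z) (F : Set α) [Decidable (F = Z)] :
    upperToPoly hZ (x _ (Sum.inr F)) =
      (if F = Z then Polynomial.X else 0) + polyRight _ _ (aboveElt M Z F) := by
  split_ifs with hF
  · rw [hF, upperToPoly_center, aboveElt_self, map_zero, add_zero]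
  · rw [upperToPoly_inr hZ hF, zero_add]

theorem sum_aboveElt_of_flatsAbove_subset {P : Set (Set α)} (h : flatsAbove M Z ⊆ P) (i : α)
    [DecidablePred fun F => F ∈ P ∧ i ∈ F] :
    ∑ F : Set α with F ∈ P ∧ i ∈ F, aboveElt M Z F = aboveSum M Z i := by
  classical
  rw [aboveSum, Finset.sum_filter, Finset.sum_filter]
  refine Finset.sum_congr rfl fun F _ => ?_
  by_cases hF : F ∈ P
  · simp [hF]
  · simp [hF, aboveElt_of_notMem fun h' => hF (h h')]

/-! ### Structure maps of the star rings of a flip in polynomial coordinates. -/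

section Flip

variable (hflip : IsMatroidalFlip M Pm Pp Z)
include hflip

/-- The structure map of the ring of the upper star. -/
def IsMatroidalFlip.upperStructureMap : MvPolynomial α ℂ →ₐ[ℂ] StanleyReisner (upperStar M Z) :=
  (restrict hflip.upperStar_subset).comp (structureMap M Pp)

/-- The structure map of the ring of the lower star. -/
def IsMatroidalFlip.lowerStructureMap : MvPolynomial α ℂ →ₐ[ℂ] StanleyReisner (lowerStar M Z) :=
  (restrict hflip.lowerStar_subset).comp (structureMap M Pm)

theorem IsMatroidalFlip.starHom_lowerStructureMap (p : MvPolynomial α ℂ) :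
    starHom M Z (hflip.lowerStructureMap p) = hflip.upperStructureMap p := by
  rw [lowerStructureMap, AlgHom.comp_apply, ← hflip.restrict_hom, hflip.hom_structureMap]
  rfl

open Classical in
theorem IsMatroidalFlip.upperToPoly_structureMap (i : α) :
    upperToPoly hflip.isFlat (hflip.upperStructureMap (X i)) = polyLeft _ _ (x _ (Sum.inl i)) +
      (if i ∈ Z then Polynomial.X else 0) + polyRight _ _ (aboveSum M Z i) := by
  rw [upperStructureMap, AlgHom.comp_apply, structureMap, aeval_X, map_add, map_add, map_sum,
    map_sum, restrict_x, upperToPoly_inl, add_assoc]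
  congr 1
  simp only [restrict_x, upperToPoly_x_inr, Finset.sum_add_distrib]
  rw [← map_sum, sum_aboveElt_of_flatsAbove_subset
    (hflip.flatsAbove_subset.trans hflip.subset), Finset.sum_ite_eq']
  congr 1
  simp [hflip.mem]

open Classical in
theorem IsMatroidalFlip.lowerToPoly_structureMap (i : α) :
    lowerToPoly M Z i₀ (hflip.lowerStructureMap (X i)) = polyLeft _ _ (freeElt Z i₀ i) +
      (if i ∈ Z then Polynomial.X else 0) + polyRight _ _ (aboveSum M Z i) := by
  rw [lowerStructureMap, AlgHom.comp_apply, structureMap, aeval_X, map_add, map_add, map_sum,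
    map_sum, restrict_x, lowerToPoly_inl]
  congr 1
  simp only [restrict_x, lowerToPoly_inr]
  rw [← map_sum, sum_aboveElt_of_flatsAbove_subset hflip.flatsAbove_subset]

variable [M.Loopless]

theorem IsMatroidalFlip.isStarRing_upper : IsStarRing (M.restrict Z) (M.contract Z)
    (upperEquiv hflip.mem_properFlats) hflip.upperStructureMap (structureMap (M.restrict Z) ∅)
    (structureMap (M.contract Z) (properFlats (M.contract Z))) (aboveSum M Z) where
  map_X i := by
    rw [structureMap_restrict]
    exact hflip.upperToPoly_structureMap i
  left_eq_zero i hi := by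
    rw [structureMap_restrict, restrictRing_x_inl hflip.isFlat hi]
  right_eq i hi := (structureMap_contract hflip.mem_properFlats (hi : i ∈ M.E \ Z).2).symm
  const i hi j hj := aboveSum_eq_of_mem hi hj

theorem IsMatroidalFlip.isStarRing_lower (hi₀ : i₀ ∈ Z) :
    IsStarRing (M.restrict Z) (M.contract Z) (lowerEquiv hflip.mem_properFlats hi₀)
      hflip.lowerStructureMap (freeMap Z i₀)
      (structureMap (M.contract Z) (properFlats (M.contract Z))) (aboveSum M Z) where
  map_X i := by
    rw [freeMap_X]
    exact hflip.lowerToPoly_structureMap i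
  left_eq_zero i hi := by
    rw [freeMap_X]
    exact freeElt_of_notMem hi
  right_eq i hi := (structureMap_contract hflip.mem_properFlats (hi : i ∈ M.E \ Z).2).symm
  const i hi j hj := aboveSum_eq_of_mem hi hj

end Flip

/-! #### Compatibility with the homomorphism of the stars and with the grading -/

variable [M.Loopless] (hZ : Z ∈ properFlats M)

/-- The evaluation on the ring of the upper star. -/
def upperEval (i₀ j₀ : α) :
    StanleyReisner (upperStar M Z) →ₐ[ℂ] RestrictRing M Z ⊗[ℂ] ContractRing M Z :=
  evalAt (upperEquiv hZ) (starPoint i₀ j₀ (structureMap (M.restrict Z) ∅) (aboveSum M Z))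

/-- The evaluation on the ring of the lower star. -/
def lowerEval (hi₀ : i₀ ∈ Z) (j₀ : α) :
    StanleyReisner (lowerStar M Z) →ₐ[ℂ] FreeVarRing Z i₀ ⊗[ℂ] ContractRing M Z :=
  evalAt (lowerEquiv hZ hi₀) (starPoint i₀ j₀ (freeMap Z i₀) (aboveSum M Z))

theorem starPoint_upper (M : Matroid α) (Z : Set α) (i₀ j₀ : α) :
    starPoint i₀ j₀ (structureMap (M.restrict Z) ∅) (aboveSum M Z) =
      -(x _ (Sum.inl i₀) ⊗ₜ 1) - 1 ⊗ₜ (aboveSum M Z i₀ - aboveSum M Z j₀) := by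
  rw [starPoint, structureMap_restrict]

theorem starPoint_lower (M : Matroid α) (Z : Set α) (i₀ j₀ : α) :
    starPoint i₀ j₀ (freeMap Z i₀) (aboveSum M Z) =
      -(1 ⊗ₜ (aboveSum M Z i₀ - aboveSum M Z j₀)) := by
  rw [starPoint, freeMap_X, freeElt_self, TensorProduct.zero_tmul, neg_zero, zero_sub]

theorem upperEquiv_apply (b : StanleyReisner (upperStar M Z)) :
    upperEquiv hZ b = upperToPoly hZ.1 b := rfl

theorem lowerEquiv_apply (hi₀ : i₀ ∈ Z) (b : StanleyReisner (lowerStar M Z)) :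
    lowerEquiv hZ hi₀ b = lowerToPoly M Z i₀ b := rfl

theorem upperEval_inl (i₀ j₀ i : α) :
    upperEval hZ i₀ j₀ (x _ (Sum.inl i)) = x _ (Sum.inl i) ⊗ₜ 1 := by
  rw [upperEval, evalAt_apply, upperEquiv_apply, upperToPoly_inl, polyLeft_apply, Polynomial.eval_C]

open Classical in
theorem upperEval_inr (i₀ j₀ : α) (F : Set α) : upperEval hZ i₀ j₀ (x _ (Sum.inr F)) =
    (if F = Z then starPoint i₀ j₀ (structureMap (M.restrict Z) ∅) (aboveSum M Z) else 0) +
      1 ⊗ₜ aboveElt M Z F := by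
  rw [upperEval, evalAt_apply, upperEquiv_apply, upperToPoly_x_inr, polyRight_apply,
    Polynomial.eval_add, Polynomial.eval_C]
  split_ifs
  · rw [Polynomial.eval_X]
  · rw [Polynomial.eval_zero]

open Classical in
theorem lowerEval_inl (hi₀ : i₀ ∈ Z) (j₀ i : α) : lowerEval hZ hi₀ j₀ (x _ (Sum.inl i)) =
    freeElt Z i₀ i ⊗ₜ 1 +
      if i ∈ Z then starPoint i₀ j₀ (freeMap Z i₀) (aboveSum M Z) else 0 := by
  rw [lowerEval, evalAt_apply, lowerEquiv_apply, lowerToPoly_inl, polyLeft_apply,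
    Polynomial.eval_add, Polynomial.eval_C]
  split_ifs
  · rw [Polynomial.eval_X]
  · rw [Polynomial.eval_zero]

theorem lowerEval_inr (hi₀ : i₀ ∈ Z) (j₀ : α) (F : Set α) :
    lowerEval hZ hi₀ j₀ (x _ (Sum.inr F)) = 1 ⊗ₜ aboveElt M Z F := by
  rw [lowerEval, evalAt_apply, lowerEquiv_apply, lowerToPoly_inr, polyRight_apply,
    Polynomial.eval_C]

/-- The homomorphism `x_i ↦ x_i - x_{i₀}`. -/
def freeToRestrict (M : Matroid α) (Z : Set α) (i₀ : α) : FreeVarRing Z i₀ →ₐ[ℂ] RestrictRing M Z :=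
  aeval fun i => x _ (Sum.inl i.1) - x _ (Sum.inl i₀)

omit [Fintype α] [M.Loopless] in
theorem freeToRestrict_freeElt {i : α} (hi : i ∈ Z) : freeToRestrict M Z i₀ (freeElt Z i₀ i) =
    x _ (Sum.inl i) - x _ (Sum.inl i₀) := by
  by_cases hii : i = i₀
  · rw [hii, freeElt_self, map_zero, sub_self]
  · have h : freeElt Z i₀ i = X ⟨i, hi, hii⟩ := dif_pos ⟨hi, hii⟩
    rw [h, freeToRestrict, aeval_X]

/-- With c = a_{i₀} - a_{j₀}, a denoting `aboveSum`, the evaluation sends y to -c below and x_Z to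
-x_{i₀} - c above. Hence x_i + x_Z evaluates to (x_i - x_{i₀}) - c, which is the image of the lower
value of x_i. -/
theorem upperEval_starHom (hi₀ : i₀ ∈ Z) (j₀ : α) (b : StanleyReisner (lowerStar M Z)) :
    upperEval hZ i₀ j₀ (starHom M Z b) =
      Algebra.TensorProduct.map (freeToRestrict M Z i₀) (AlgHom.id ℂ _)
        (lowerEval hZ hi₀ j₀ b) := by
  classical
  refine DFunLike.congr_fun (f := (upperEval hZ i₀ j₀).comp (starHom M Z))
    (g := (Algebra.TensorProduct.map (freeToRestrict M Z i₀) (AlgHom.id ℂ _)).comp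
      (lowerEval hZ hi₀ j₀)) (StanleyReisner.algHom_ext fun v => ?_) b
  rw [AlgHom.comp_apply, AlgHom.comp_apply, ← proj_X, starHom_proj, proj_X]
  rcases v with i | F
  · by_cases hi : i ∈ Z
    · rw [flipSubst_inl, if_pos hi, map_add, proj_X, proj_X, map_add, upperEval_inl,
        upperEval_inr, if_pos rfl, aboveElt_self, TensorProduct.tmul_zero, add_zero, lowerEval_inl,
        if_pos hi, map_add, Algebra.TensorProduct.map_tmul, freeToRestrict_freeElt hi,
        starPoint_upper, starPoint_lower, map_neg, Algebra.TensorProduct.map_tmul, map_one, map_one,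
        AlgHom.id_apply, TensorProduct.sub_tmul]
      abel
    · have h0 : x (lowerStar M Z) (Sum.inl i) = 0 := x_eq_zero fun h => hi (h.1 i (by simp))
      rw [flipSubst_inl_of_notMem hi, proj_X, upperEval_inl, restrictRing_x_inl hZ.1 hi, h0,
        map_zero, map_zero, TensorProduct.zero_tmul]
  · by_cases hF : F = Z
    · have h0 : x (lowerStar M Z) (Sum.inr F) = 0 := x_eq_zero fun h =>
        (h.2.1 F (by simp)).2.ne hF.symm
      rw [h0, hF, flipSubst_inr_self, map_zero, map_zero, map_zero, map_zero]
    · rw [flipSubst_inr_of_ne hF, proj_X, upperEval_inr, if_neg hF, zero_add, lowerEval_inr,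
        Algebra.TensorProduct.map_tmul, map_one, AlgHom.id_apply]

omit [Fintype α] [M.Loopless] in
theorem scale_aboveElt (F : Set α) : scale _ (aboveElt M Z F) = (3 : ℂ) • aboveElt M Z F := by
  by_cases hF : F ∈ flatsAbove M Z
  · rw [aboveElt_of_mem hF, scale_x]
  · rw [aboveElt_of_notMem hF, map_zero, smul_zero]

omit [M.Loopless] in
theorem scale_aboveSum (i : α) : scale _ (aboveSum M Z i) = (3 : ℂ) • aboveSum M Z i := by
  rw [aboveSum, map_sum, Finset.smul_sum]
  exact Finset.sum_congr rfl fun F _ => scale_aboveElt F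

/-- The evaluation point is homogeneous of degree one, so the evaluation respects degrees. -/
theorem upperEval_scale (i₀ j₀ : α) (b : StanleyReisner (upperStar M Z)) :
    upperEval hZ i₀ j₀ (scale _ b) =
      Algebra.TensorProduct.map (scale _) (scale _) (upperEval hZ i₀ j₀ b) := by
  classical
  refine DFunLike.congr_fun (f := (upperEval hZ i₀ j₀).comp (scale _))
    (g := (Algebra.TensorProduct.map (scale _) (scale _)).comp (upperEval hZ i₀ j₀))
    (StanleyReisner.algHom_ext fun v => ?_) b
  rw [AlgHom.comp_apply, AlgHom.comp_apply, scale_x, map_smul]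
  have h3 : Algebra.TensorProduct.map (scale _) (scale _)
      (starPoint i₀ j₀ (structureMap (M.restrict Z) ∅) (aboveSum M Z)) =
      (3 : ℂ) • starPoint i₀ j₀ (structureMap (M.restrict Z) ∅) (aboveSum M Z) := by
    rw [starPoint_upper, map_sub, map_neg, Algebra.TensorProduct.map_tmul,
      Algebra.TensorProduct.map_tmul, map_sub, map_one, map_one, scale_x, scale_aboveSum,
      scale_aboveSum, ← smul_sub, ← TensorProduct.smul_tmul', TensorProduct.tmul_smul,
      smul_sub (3 : ℂ) (-_), smul_neg]
  rcases v with i | F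
  · rw [upperEval_inl, Algebra.TensorProduct.map_tmul, scale_x, map_one,
      TensorProduct.smul_tmul']
  · rw [upperEval_inr, map_add, Algebra.TensorProduct.map_tmul, map_one, scale_aboveElt, smul_add,
      TensorProduct.tmul_smul]
    congr 1
    split_ifs
    · exact h3.symm
    · rw [map_zero, smul_zero]

end StarStructure

end

noncomputable section

/-! ### The exact triangle of a matroidal flip -/

section FlipTriangle

open MvPolynomial StanleyReisner

variable {α : Type*} [Fintype α] {M : Matroid α} {P Pm Pp : Set (Set α)} {Z : Set α} {i₀ j₀ : α}

theorem bergmanAction_comm (M : Matroid α) (P : Set (Set α)) (v w : linearForms (sCirc M))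
    (a : StanleyReisner (bergmanFan M P)) : bergmanAction M P v (bergmanAction M P w a) =
      bergmanAction M P w (bergmanAction M P v a) :=
  mul_left_comm _ _ _

theorem scale_structureMap (M : Matroid α) (P : Set (Set α)) (i : α) :
    scale _ (structureMap M P (X i)) = (3 : ℂ) • structureMap M P (X i) := by
  simp [structureMap, Finset.smul_sum]

theorem bergmanAction_scale {e : α} (he : e ∈ M.E) (P : Set (Set α)) (v : linearForms (sCirc M))
    (a : StanleyReisner (bergmanFan M P)) : scale _ (bergmanAction M P v a) =
      (3 : ℂ) • bergmanAction M P v (scale _ a) :=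
  formsAction_scale he (fun i _ => scale_structureMap M P i) v a

omit [Fintype α] in
theorem StanleyReisner.restrict_scale {V : Type*} {Δ T : Set (Finset V)} (h : T ⊆ Δ)
    (a : StanleyReisner Δ) : restrict h (scale Δ a) = scale T (restrict h a) :=
  DFunLike.congr_fun (f := (restrict h).comp (scale Δ)) (g := (scale T).comp (restrict h))
    (StanleyReisner.algHom_ext fun v => by simp) a

theorem koszulUnit_restrict_ne_zero [M.Loopless] (hZ : Z ∈ properFlats M) (hi₀ : i₀ ∈ Z) :
    koszulUnit (bergmanAction (M.restrict Z) ∅) 1 ≠ 0 := by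
  refine koszulUnit_formsAction_ne_zero (N := M.restrict Z) hi₀
    (augmentation (empty_mem_bergmanFan_restrict hZ)) fun i _ => ?_
  rw [structureMap_restrict, augmentation_x]

theorem freeToRestrict_freeMap : ∀ i ∈ (M.restrict Z).E,
    freeToRestrict M Z i₀ (freeMap Z i₀ (X i - X i₀)) =
      structureMap (M.restrict Z) ∅ (X i - X i₀) := fun i hi => by
  rw [map_sub, map_sub, freeMap_X, freeMap_X, freeElt_self, map_zero, sub_zero, map_sub,
    structureMap_restrict, structureMap_restrict, freeToRestrict_freeElt (show i ∈ Z from hi)]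

variable (hflip : IsMatroidalFlip M Pm Pp Z)
include hflip

theorem IsMatroidalFlip.hom_scale (a : StanleyReisner (bergmanFan M Pm)) :
    hflip.hom (scale _ a) = scale _ (hflip.hom a) := by
  classical
  refine DFunLike.congr_fun (f := hflip.hom.comp (scale _)) (g := (scale _).comp hflip.hom)
    (StanleyReisner.algHom_ext fun v => ?_) a
  rw [AlgHom.comp_apply, AlgHom.comp_apply, scale_x, map_smul]
  rcases v with i | F
  · rw [hflip.hom_inl]
    split_ifs <;> simp
  · by_cases hF : F ∈ Pm
    · rw [hflip.hom_inr hF, scale_x]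
    · rw [bergmanFan_x_inr_eq_zero hflip.1.1 hF, map_zero, map_zero, smul_zero]

theorem IsMatroidalFlip.scale_upperStructureMap (i : α) :
    scale _ (hflip.upperStructureMap (X i)) = (3 : ℂ) • hflip.upperStructureMap (X i) := by
  rw [upperStructureMap, AlgHom.comp_apply, ← StanleyReisner.restrict_scale, scale_structureMap,
    map_smul]

theorem IsMatroidalFlip.hom_bergmanAction (v : linearForms (sCirc M))
    (a : StanleyReisner (bergmanFan M Pm)) : bergmanAction M Pp v (hflip.hom a) =
      hflip.hom (bergmanAction M Pm v a) := by
  change structureMap M Pp v * hflip.hom a = hflip.hom (structureMap M Pm v * a)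
  rw [map_mul, hflip.hom_structureMap]

theorem IsMatroidalFlip.restrict_lower_bergmanAction (v : linearForms (sCirc M))
    (a : StanleyReisner (bergmanFan M Pm)) :
    formsAction M hflip.lowerStructureMap v (restrict hflip.lowerStar_subset a) =
      restrict hflip.lowerStar_subset (bergmanAction M Pm v a) :=
  (map_mul _ _ _).symm

theorem IsMatroidalFlip.restrict_upper_bergmanAction (v : linearForms (sCirc M))
    (a : StanleyReisner (bergmanFan M Pp)) :
    formsAction M hflip.upperStructureMap v (restrict hflip.upperStar_subset a) =
      restrict hflip.upperStar_subset (bergmanAction M Pp v a) :=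
  (map_mul _ _ _).symm

theorem IsMatroidalFlip.starHom_formsAction (v : linearForms (sCirc M))
    (a : StanleyReisner (lowerStar M Z)) :
    formsAction M hflip.upperStructureMap v (starHom M Z a) =
      starHom M Z (formsAction M hflip.lowerStructureMap v a) := by
  rw [formsAction_apply, formsAction_apply, map_mul, hflip.starHom_lowerStructureMap]

theorem IsMatroidalFlip.upper_scale (hj₀ : j₀ ∈ M.E) (v : linearForms (sCirc M))
    (a : StanleyReisner (upperStar M Z)) :
    scale _ (formsAction M hflip.upperStructureMap v a) =
      (3 : ℂ) • formsAction M hflip.upperStructureMap v (scale _ a) :=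
  formsAction_scale hj₀ (fun i _ => hflip.scale_upperStructureMap i) v a

theorem IsMatroidalFlip.exists_star_homology [M.Loopless] (hi₀ : i₀ ∈ Z) (hj₀ : j₀ ∈ M.E)
    (hj₀' : j₀ ∉ Z) :
    ∃ N : DiffHomology (koszulTotalD (formsAction M hflip.upperStructureMap)) ≃ₗ[ℂ]
        DiffHomology (koszulTotalD (bergmanAction (M.restrict Z) ∅)) ⊗[ℂ]
          DiffHomology (koszulTotalD
            (bergmanAction (M.contract Z) (properFlats (M.contract Z)))),
      Function.Injective (koszulMap _ _ (starHom M Z).toLinearMap hflip.starHom_formsAction) ∧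
      (∀ c, (∃ b, koszulMap _ _ (starHom M Z).toLinearMap hflip.starHom_formsAction b = c) ↔
        N c ∈ leftMultiples ℂ _ (koszulUnit (bergmanAction (M.restrict Z) ∅) 1)) ∧
      ∀ c, N (homologyGrading (γ := (scale _).toLinearMap) (hflip.upper_scale hj₀) c) =
        TensorProduct.map
          (homologyGrading (γ := (scale _).toLinearMap)
            (bergmanAction_scale (M := M.restrict Z) hi₀ ∅))
          (homologyGrading (γ := (scale _).toLinearMap)
            (bergmanAction_scale (M := M.contract Z) (show j₀ ∈ M.E \ Z from ⟨hj₀, hj₀'⟩)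
              (properFlats (M.contract Z)))) (N c) := by
  have hi : i₀ ∈ (M.restrict Z).E := hi₀
  have hj : j₀ ∈ (M.contract Z).E := ⟨hj₀, hj₀'⟩
  have hZ := hflip.mem_properFlats
  have h : (M.restrict Z).E ⊆ M.E := hZ.1.subset_ground
  have h' : (M.contract Z).E ⊆ M.E := Set.sdiff_subset
  have hd : Disjoint (M.restrict Z).E (M.contract Z).E := Set.disjoint_sdiff_right
  have hE : M.E ⊆ (M.restrict Z).E ∪ (M.contract Z).E := fun a ha => by
    by_cases haZ : a ∈ Z
    · exact Or.inl haZ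
    · exact Or.inr ⟨ha, haZ⟩
  have hu := hflip.isStarRing_upper
  have hl := hflip.isStarRing_lower hi₀
  have hone : (freeToRestrict M Z i₀).toLinearMap 1 = 1 := map_one (freeToRestrict M Z i₀)
  -- The form to be killed is ℓ = x_{i₀} - x_{j₀}, and the chosen generator of the homology of the
  -- free side is the class of 1.
  have key := _root_.exists_star_homology (k := ℂ) (μ₁ := formsAction M hflip.lowerStructureMap)
    (μ₂ := formsAction M hflip.upperStructureMap)
    (μS := formsAction (M.restrict Z) (freeMap Z i₀))
    (μK := formsAction (M.restrict Z) (structureMap (M.restrict Z) ∅))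
    (μQ := formsAction (M.contract Z) (structureMap (M.contract Z) (properFlats (M.contract Z))))
    formsAction_comm formsAction_comm formsAction_comm formsAction_comm formsAction_comm
    (starHom M Z).toLinearMap hflip.starHom_formsAction
    (formsIncl h h') (formsProj M hi hj) (formsSum M (M.restrict Z).E) (baseDiff (h' hj) i₀)
    (formsProj_formsIncl h h' hd hi hj)
    (by rw [formsProj_baseDiff_of_mem h h' hd hi hj hi, baseDiff_self]; rfl)
    (formsSum_baseDiff_of_mem h h' hd hj hi) (formsSum_formsIncl h h' hd hi hj)
    (eq_formsIncl_add h h' hd hi hj hE)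
    (lowerEval hZ hi₀ j₀).toLinearMap (evalAt_surjective _)
    (hl.formsAction_injective h h' hd hi hj) (hl.formsAction_exact h h' hd hi hj)
    (hl.prodAction_formsProj h h' hd hE hi hj)
    (upperEval hZ i₀ j₀).toLinearMap (evalAt_surjective _)
    (hu.formsAction_injective h h' hd hi hj) (hu.formsAction_exact h h' hd hi hj)
    (hu.prodAction_formsProj h h' hd hE hi hj)
    (freeToRestrict M Z i₀).toLinearMap
    (formsAction_algHom (N := M.restrict Z) hi₀ freeToRestrict_freeMap)
    (upperEval_starHom hZ hi₀ j₀)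
    1 (freeMap_acyclic (N := M.restrict Z) rfl hi₀)
    (by rw [hone]; exact koszulUnit_restrict_ne_zero hZ hi₀)
    (γ₂ := (scale _).toLinearMap) (γK := (scale _).toLinearMap) (γQ := (scale _).toLinearMap)
    (hflip.upper_scale hj₀) (bergmanAction_scale (M := M.restrict Z) hi₀ ∅)
    (bergmanAction_scale (M := M.contract Z) hj _) (upperEval_scale hZ i₀ j₀)
  obtain ⟨N, h1, h2, h3⟩ := key
  rw [hone] at h2
  exact ⟨N, h1, h2, h3⟩

end FlipTriangle

end

noncomputable section

/-! ### The long exact sequence of a matroidal flip -/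

section KoszulPieces

variable {k : Type*} [Field k] {L A B : Type*} [AddCommGroup L] [Module k L]
  [AddCommGroup A] [Module k A] [AddCommGroup B] [Module k B]

theorem koszulIncl_mem_span {𝒜 : ℕ → Submodule k A} {a : A} (ha : 𝒜 0 ≤ Submodule.span k {a})
    {μ : L →ₗ[k] Module.End k A} {y : A ⊗[k] (⋀[k]^0 L)} (hy : y ∈ koszulDegree μ 𝒜 0 0) :
    koszulIncl A L 0 y ∈ Submodule.span k {a ⊗ₜ[k] (1 : ExteriorAlgebra k L)} := by
  obtain ⟨x, rfl⟩ := hy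
  induction x with
  | zero => simp
  | add x y hx hy => rw [map_add, map_add]; exact Submodule.add_mem _ hx hy
  | tmul b x =>
    rw [LinearMap.rTensor_tmul, koszulIncl, LinearMap.lTensor_tmul]
    obtain ⟨r, hr⟩ := Submodule.mem_span_singleton.1 (ha b.2)
    obtain ⟨c, hc⟩ : ∃ c, algebraMap k (ExteriorAlgebra k L) c = x.1 := by
      have hx : x.1 ∈ LinearMap.range (ExteriorAlgebra.ι k (M := L)) ^ 0 := x.2
      rwa [pow_zero, Submodule.mem_one] at hx
    rw [Submodule.subtype_apply, Submodule.subtype_apply, ← hr, ← hc,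
      Algebra.algebraMap_eq_smul_one, TensorProduct.smul_tmul_smul]
    exact Submodule.smul_mem _ _ (Submodule.mem_span_singleton_self _)

/-- For a Stanley–Reisner ring 𝒜 0 is spanned by 1, so Tor_0 in degree 0 is spanned by the unit
class. Together with the condition t₁ + s₁ > 0 this matches the excluded summands with the multiples
of u. -/
theorem range_koszulPieceIncl_zero_le [CharZero k] {𝒜 : ℕ → Submodule k A} {a : A}
    (ha : 𝒜 0 ≤ Submodule.span k {a}) (μ : L →ₗ[k] Module.End k A) :
    LinearMap.range (koszulPieceIncl μ 𝒜 0 0) ≤ Submodule.span k {koszulUnit μ a} := by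
  rintro _ ⟨⟨_, ⟨z, hz, rfl⟩⟩, rfl⟩
  obtain ⟨r, hr⟩ := Submodule.mem_span_singleton.1 (koszulIncl_mem_span ha hz)
  refine Submodule.mem_span_singleton.2 ⟨r, ?_⟩
  change r • koszulUnit μ a = koszulHomologyIncl μ 0 (KoszulHomology.mk μ 0 z)
  rw [koszulHomologyIncl_mk, koszulUnit, ← map_smul]
  congr 1
  exact Subtype.ext hr

theorem koszulIncl_rTensor (f : A →ₗ[k] B) (t : ℕ) (y : A ⊗[k] (⋀[k]^t L)) :
    koszulIncl B L t (LinearMap.rTensor _ f y) = LinearMap.rTensor _ f (koszulIncl A L t y) := by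
  rw [koszulIncl, koszulIncl, ← LinearMap.comp_apply, ← LinearMap.comp_apply,
    LinearMap.lTensor_comp_rTensor, LinearMap.rTensor_comp_lTensor]

theorem rTensor_mem_koszulCycles {μ : L →ₗ[k] Module.End k A} {ν : L →ₗ[k] Module.End k B}
    {f : A →ₗ[k] B} (h : ∀ v a, ν v (f a) = f (μ v a)) {t : ℕ} (z : koszulCycles μ t) :
    LinearMap.rTensor _ f z.1 ∈ koszulCycles ν t := by
  rw [mem_koszulCycles_iff, koszulIncl_rTensor, koszulTotalD_rTensor μ f ν h,
    (mem_koszulCycles_iff μ t z.1).1 z.2, map_zero]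

theorem koszulMap_koszulHomologyIncl_mk {μ : L →ₗ[k] Module.End k A} {ν : L →ₗ[k] Module.End k B}
    {f : A →ₗ[k] B} (h : ∀ v a, ν v (f a) = f (μ v a)) {t : ℕ} (z : koszulCycles μ t) :
    koszulMap μ ν f h (koszulHomologyIncl μ t (KoszulHomology.mk μ t z)) =
      koszulHomologyIncl ν t (KoszulHomology.mk ν t ⟨_, rTensor_mem_koszulCycles h z⟩) := by
  rw [koszulHomologyIncl_mk, koszulHomologyIncl_mk, koszulMap_mk]
  congr 1
  exact Subtype.ext (koszulIncl_rTensor f t z.1).symm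

theorem homologyGrading_koszulUnit [CharZero k] {μ : L →ₗ[k] Module.End k A} {γ : Module.End k A}
    (h : ∀ v a, γ (μ v a) = (3 : k) • μ v (γ a)) {a : A} (ha : γ a = a) :
    homologyGrading h (koszulUnit μ a) = koszulUnit μ a := by
  rw [koszulUnit, homologyGrading_mk]
  congr 1
  apply Subtype.ext
  change koszulGrading L γ (a ⊗ₜ 1) = a ⊗ₜ 1
  rw [koszulGrading, TensorProduct.map_tmul, exteriorScale_one, ha]

/-- Mayer–Vietoris combined with the computation of the lower edge: since f' is injective on
homology with image the multiples of u, the cokernel of f' takes the place of the third vertex. -/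
theorem exists_koszul_triangle [CharZero k] {A₁ A₂ B₁ B₂ X Y : Type*}
    [AddCommGroup A₁] [Module k A₁] [AddCommGroup A₂] [Module k A₂]
    [AddCommGroup B₁] [Module k B₁] [AddCommGroup B₂] [Module k B₂]
    [AddCommGroup X] [Module k X] [AddCommGroup Y] [Module k Y]
    {μ₁ : L →ₗ[k] Module.End k A₁} {μ₂ : L →ₗ[k] Module.End k A₂}
    {ν₁ : L →ₗ[k] Module.End k B₁} {ν₂ : L →ₗ[k] Module.End k B₂}
    (hμ₂ : ∀ v w a, μ₂ v (μ₂ w a) = μ₂ w (μ₂ v a))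
    {f : A₁ →ₗ[k] A₂} (hf : ∀ v a, μ₂ v (f a) = f (μ₁ v a))
    {p : A₁ →ₗ[k] B₁} (hp : ∀ v a, ν₁ v (p a) = p (μ₁ v a))
    {q : A₂ →ₗ[k] B₂} (hq : ∀ v a, ν₂ v (q a) = q (μ₂ v a))
    {f' : B₁ →ₗ[k] B₂} (hf' : ∀ v a, ν₂ v (f' a) = f' (ν₁ v a))
    (hsq : ∀ a, q (f a) = f' (p a)) (hps : Function.Surjective p) (hqs : Function.Surjective q)
    (hinj : ∀ a, p a = 0 → f a = 0 → a = 0) (hsurj : ∀ b, q b = 0 → ∃ a, p a = 0 ∧ f a = b)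
    {γ₁ : Module.End k A₁} {γ₂ : Module.End k A₂} {γ' : Module.End k B₂} {γ'' : Module.End k B₁}
    (hγ₁ : ∀ v a, γ₁ (μ₁ v a) = (3 : k) • μ₁ v (γ₁ a))
    (hγ₂ : ∀ v a, γ₂ (μ₂ v a) = (3 : k) • μ₂ v (γ₂ a))
    (hγ' : ∀ v a, γ' (ν₂ v a) = (3 : k) • ν₂ v (γ' a)) (hfγ : ∀ a, f (γ₁ a) = γ₂ (f a))
    (hpγ : ∀ a, p (γ₁ a) = γ'' (p a)) (hqγ : ∀ a, q (γ₂ a) = γ' (q a))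
    {u : X} {ΓX : Module.End k X} {ΓY : Module.End k Y} (hu : ΓX u = u)
    (hN : ∃ N : DiffHomology (koszulTotalD ν₂) ≃ₗ[k] X ⊗[k] Y,
      Function.Injective (koszulMap ν₁ ν₂ f' hf') ∧
      (∀ c, (∃ b, koszulMap ν₁ ν₂ f' hf' b = c) ↔ N c ∈ leftMultiples k Y u) ∧
      ∀ c, N (homologyGrading hγ' c) = TensorProduct.map ΓX ΓY (N c)) :
    ∃ (G : DiffHomology (koszulTotalD μ₂) →ₗ[k] (X ⊗[k] Y) ⧸ leftMultiples k Y u)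
      (D : (X ⊗[k] Y) ⧸ leftMultiples k Y u →ₗ[k] DiffHomology (koszulTotalD μ₁)),
      (∀ v, quotientGrading ΓX ΓY hu (G v) = G (homologyGrading hγ₂ v)) ∧
      (∀ v, homologyGrading hγ₁ (D v) = (2⁻¹ * 3 : k) • D (quotientGrading ΓX ΓY hu v)) ∧
      Function.Exact (koszulMap μ₁ μ₂ f hf) G ∧ Function.Exact G D ∧
      Function.Exact D (koszulMap μ₁ μ₂ f hf) := by
  obtain ⟨N, hHf', hN, hNΓ⟩ := hN
  obtain ⟨Δ, h1, h2, h3, h4⟩ := exists_koszul_connecting hμ₂ hf hp hq hf' hsq hps hqs hinj hsurj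
    hHf' hγ₁ hγ₂ hγ' hfγ hpγ hqγ
  have hc : ∀ v a, ν₂ v ((q ∘ₗ f) a) = (q ∘ₗ f) (μ₁ v a) := fun v a => by
    rw [LinearMap.comp_apply, LinearMap.comp_apply, hq, hf]
  exact exists_exact_triangle _ (koszulMap μ₁ ν₁ p hp) _ _
    (fun a => (koszulMap_koszulMap hf hq hc (fun _ => rfl) a).trans
      (koszulMap_koszulMap hp hf' hc (fun a => (hsq a).symm) a).symm) Δ h1 h2 h3 N hN hu
    (koszulMap_homologyGrading hq hγ₂ hγ' hqγ) h4 hNΓ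

end KoszulPieces

/-! ### The bigraded pieces of the triangle of a flip. -/

section FlipSequence

open MvPolynomial StanleyReisner

variable {α : Type*} [Fintype α] {M : Matroid α} {Pm Pp : Set (Set α)} {Z : Set α} {i₀ j₀ : α}

theorem homologyGrading_koszulUnit_one {e : α} (he : e ∈ M.E) (P : Set (Set α)) :
    homologyGrading (γ := (scale _).toLinearMap) (bergmanAction_scale he P)
      (koszulUnit (bergmanAction M P) 1) = koszulUnit (bergmanAction M P) 1 :=
  homologyGrading_koszulUnit _ (map_one (scale (bergmanFan M P)))

theorem iSup_range_bergmanTor {e : α} (he : e ∈ M.E) (P : Set (Set α)) :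
    ⨆ i : ℕ × ℕ, LinearMap.range (koszulPieceIncl (bergmanAction M P) (degree (bergmanFan M P))
      i.1 i.2) = ⊤ :=
  iSup_range_koszulPieceIncl (γ := (scale _).toLinearMap) (bergmanAction_scale he P) iSup_degree
    fun _ _ => scale_of_mem_degree

theorem range_bergmanTor {e : α} (he : e ∈ M.E) (P : Set (Set α)) (t s : ℕ) :
    LinearMap.range (koszulPieceIncl (bergmanAction M P) (degree (bergmanFan M P)) t s) =
      (homologyGrading (γ := (scale _).toLinearMap) (bergmanAction_scale he P)).eigenspace
        (bigradedWeight ℂ (t, s)) :=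
  range_koszulPieceIncl _ iSup_degree (fun _ _ => scale_of_mem_degree) (t, s)

theorem iSup_eigenspace_bergmanTor {e : α} (he : e ∈ M.E) (P : Set (Set α)) :
    ⨆ i, (homologyGrading (γ := (scale _).toLinearMap) (bergmanAction_scale he P)).eigenspace
      (bigradedWeight ℂ i) = ⊤ :=
  iSup_eigenspace_homologyGrading _ iSup_degree fun _ _ => scale_of_mem_degree

/-- Identifies the summand E^Z_{t,s} with the eigenspace for 2^t 3^s of the third vertex of the
triangle. -/
theorem range_excPieceIncl_bergmanTor {N K : Matroid α} {P Q : Set (Set α)} (hi₀ : i₀ ∈ N.E)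
    (hj₀ : j₀ ∈ K.E) (t s : ℕ) :
    LinearMap.range (excPieceIncl
      (koszulPieceIncl (bergmanAction N P) (degree (bergmanFan N P)))
      (koszulPieceIncl (bergmanAction K Q) (degree (bergmanFan K Q)))
      (koszulUnit (bergmanAction N P) 1) t s) =
    (quotientGrading _ (homologyGrading (γ := (scale _).toLinearMap) (bergmanAction_scale hj₀ Q))
      (homologyGrading_koszulUnit_one hi₀ P)).eigenspace (bigradedWeight ℂ (t, s)) :=
  eq_eigenspace_of_le bigradedWeight_injective
    (fun i => excPieceIncl_mem_eigenspace (range_bergmanTor hi₀ P) (range_bergmanTor hj₀ Q) _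
      i.1 i.2)
    (iSup_range_excPieceIncl (iSup_range_bergmanTor hi₀ P) (iSup_range_bergmanTor hj₀ Q)
      (range_koszulPieceIncl_zero_le degree_zero_le _)) (t, s)

theorem iSup_eigenspace_quotientGrading_bergmanTor {N K : Matroid α} {P Q : Set (Set α)}
    (hi₀ : i₀ ∈ N.E) (hj₀ : j₀ ∈ K.E) :
    ⨆ i, (quotientGrading _
      (homologyGrading (γ := (scale _).toLinearMap) (bergmanAction_scale hj₀ Q))
      (homologyGrading_koszulUnit_one hi₀ P)).eigenspace (bigradedWeight ℂ i) = ⊤ := by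
  simp_rw [← range_excPieceIncl_bergmanTor hi₀ hj₀]
  exact iSup_range_excPieceIncl (iSup_range_bergmanTor hi₀ P) (iSup_range_bergmanTor hj₀ Q)
    (range_koszulPieceIncl_zero_le degree_zero_le _)

variable (hflip : IsMatroidalFlip M Pm Pp Z)
include hflip

theorem IsMatroidalFlip.exists_triangle [M.Loopless] (hi₀ : i₀ ∈ (M.restrict Z).E)
    (hj₀ : j₀ ∈ (M.contract Z).E) (hj : j₀ ∈ M.E) :
    ∃ (G : DiffHomology (koszulTotalD (bergmanAction M Pp)) →ₗ[ℂ]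
        (DiffHomology (koszulTotalD (bergmanAction (M.restrict Z) ∅)) ⊗[ℂ]
          DiffHomology (koszulTotalD
            (bergmanAction (M.contract Z) (properFlats (M.contract Z))))) ⧸
          leftMultiples ℂ _ (koszulUnit (bergmanAction (M.restrict Z) ∅) 1))
      (D : (DiffHomology (koszulTotalD (bergmanAction (M.restrict Z) ∅)) ⊗[ℂ]
          DiffHomology (koszulTotalD
            (bergmanAction (M.contract Z) (properFlats (M.contract Z))))) ⧸
          leftMultiples ℂ _ (koszulUnit (bergmanAction (M.restrict Z) ∅) 1) →ₗ[ℂ]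
        DiffHomology (koszulTotalD (bergmanAction M Pm))),
      (∀ v, quotientGrading _ (homologyGrading (γ := (scale _).toLinearMap)
          (bergmanAction_scale hj₀ (properFlats (M.contract Z))))
          (homologyGrading_koszulUnit_one hi₀ ∅) (G v) =
        G (homologyGrading (γ := (scale _).toLinearMap) (bergmanAction_scale hj Pp) v)) ∧
      (∀ v, homologyGrading (γ := (scale _).toLinearMap) (bergmanAction_scale hj Pm) (D v) =
        (2⁻¹ * 3 : ℂ) • D (quotientGrading _ (homologyGrading (γ := (scale _).toLinearMap)
          (bergmanAction_scale hj₀ (properFlats (M.contract Z))))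
          (homologyGrading_koszulUnit_one hi₀ ∅) v)) ∧
      Function.Exact (koszulMap _ _ hflip.hom.toLinearMap hflip.hom_bergmanAction) G ∧
      Function.Exact G D ∧
      Function.Exact D (koszulMap _ _ hflip.hom.toLinearMap hflip.hom_bergmanAction) := by
  have hi : i₀ ∈ Z := hi₀
  have hj' : j₀ ∉ Z := hj₀.2
  exact exists_koszul_triangle (bergmanAction_comm M Pp)
    (f := hflip.hom.toLinearMap) hflip.hom_bergmanAction
    (p := (restrict hflip.lowerStar_subset).toLinearMap) hflip.restrict_lower_bergmanAction
    (q := (restrict hflip.upperStar_subset).toLinearMap) hflip.restrict_upper_bergmanAction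
    (f' := (starHom M Z).toLinearMap) hflip.starHom_formsAction hflip.restrict_hom
    (restrict_surjective hflip.lowerStar_subset) (restrict_surjective hflip.upperStar_subset)
    (fun _ => hflip.eq_zero_of_hom_eq_zero)
    (fun _ => hflip.exists_hom_eq) (γ₁ := (scale _).toLinearMap)
    (γ₂ := (scale _).toLinearMap) (γ' := (scale _).toLinearMap) (γ'' := (scale _).toLinearMap)
    (bergmanAction_scale hj Pm) (bergmanAction_scale hj Pp) (hflip.upper_scale hj)
    hflip.hom_scale (StanleyReisner.restrict_scale hflip.lowerStar_subset)
    (StanleyReisner.restrict_scale hflip.upperStar_subset)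
    (homologyGrading_koszulUnit_one hi₀ ∅) (hflip.exists_star_homology hi hj hj')

theorem IsMatroidalFlip.exists_sequence [M.Loopless] :
    ∃ (f : ∀ t s : ℕ, bergmanTor M Pm t s →ₗ[ℂ] bergmanTor M Pp t s)
      (g : ∀ t s : ℕ, bergmanTor M Pp t s →ₗ[ℂ] excTerm M Z t s)
      (δ : ∀ t s : ℕ, excTerm M Z (t + 1) s →ₗ[ℂ] bergmanTor M Pm t (s + 1)),
      (∀ t s x, koszulHomologyIncl (bergmanAction M Pp) t (f t s x).1 =
        koszulMap _ _ hflip.hom.toLinearMap hflip.hom_bergmanAction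
          (koszulHomologyIncl (bergmanAction M Pm) t x.1)) ∧
      (∀ t s : ℕ, Function.Exact (f t s) (g t s)) ∧
      (∀ t s : ℕ, Function.Exact (g (t + 1) s) (δ t s)) ∧
      (∀ t s : ℕ, Function.Exact (δ t s) (f t (s + 1))) ∧
      (∀ t : ℕ, Function.Injective (f t 0)) ∧
      (∀ s : ℕ, Function.Surjective (g 0 s)) := by
  have hZ := hflip.mem_properFlats
  -- Base points exist on both sides because Z is non-empty and different from the ground set.
  obtain ⟨i₀, hi⟩ := hZ.2.1
  have hi₀ : i₀ ∈ (M.restrict Z).E := hi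
  obtain ⟨j₀, hj⟩ := Set.exists_of_ssubset (hZ.1.subset_ground.ssubset_of_ne hZ.2.2)
  have hj₀ : j₀ ∈ (M.contract Z).E := hj
  obtain ⟨G, D, hG, hD, h1, h2, h3⟩ := hflip.exists_triangle hi₀ hj₀ hj.1
  exact exists_long_exact_sequence (iSup_eigenspace_bergmanTor hj.1 Pm)
    (iSup_eigenspace_bergmanTor hj.1 Pp) (iSup_eigenspace_quotientGrading_bergmanTor hi₀ hj₀)
    (koszulMap _ _ hflip.hom.toLinearMap hflip.hom_bergmanAction) G D
    (fun v => (koszulMap_homologyGrading _ _ _ hflip.hom_scale v).symm) hG hD h1 h2 h3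
    (koszulPieceIncl (bergmanAction M Pm) (degree (bergmanFan M Pm)))
    (koszulPieceIncl (bergmanAction M Pp) (degree (bergmanFan M Pp)))
    (excPieceIncl (koszulPieceIncl (bergmanAction (M.restrict Z) ∅) (degree _))
      (koszulPieceIncl (bergmanAction (M.contract Z) (properFlats (M.contract Z))) (degree _))
      (koszulUnit (bergmanAction (M.restrict Z) ∅) 1))
    (koszulPieceIncl_injective _ _) (koszulPieceIncl_injective _ _)
    (excPieceIncl_injective (koszulPieceIncl_injective _ _) (koszulPieceIncl_injective _ _)
      (range_bergmanTor hi₀ ∅) (homologyGrading_koszulUnit_one hi₀ ∅))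
    (range_bergmanTor hj.1 Pm) (range_bergmanTor hj.1 Pp)
    (range_excPieceIncl_bergmanTor hi₀ hj₀)

end FlipSequence

end

/-! ### The theorem. -/

open Classical in
theorem theorem5p5 {α : Type*} [Fintype α] (M : Matroid α) [M.Loopless]
    (Pm Pp : Set (Set α)) (Z : Set α) (hflip : IsMatroidalFlip M Pm Pp Z) :
    ∃ ι : StanleyReisner (bergmanFan M Pm) →ₐ[ℂ] StanleyReisner (bergmanFan M Pp),
      -- `ι` is the homomorphism of `S_M`-algebras with `ι(x_i) = δ_i x_i + x_Z` for `i ∈ Z` and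
      -- `ι(x) = x` for the other indeterminates
      (∀ i ∈ M.E, ι (StanleyReisner.x _ (Sum.inl i)) =
        StanleyReisner.x _ (Sum.inl i) +
          if i ∈ Z then StanleyReisner.x _ (Sum.inr Z) else 0) ∧
      (∀ F ∈ Pm, ι (StanleyReisner.x _ (Sum.inr F)) = StanleyReisner.x _ (Sum.inr F)) ∧
      (∀ p, ι (structureMap M Pm p) = structureMap M Pp p) ∧
      ∃ (f : ∀ t s : ℕ, bergmanTor M Pm t s →ₗ[ℂ] bergmanTor M Pp t s)
        (g : ∀ t s : ℕ, bergmanTor M Pp t s →ₗ[ℂ] excTerm M Z t s)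
        (δ : ∀ t s : ℕ, excTerm M Z (t + 1) s →ₗ[ℂ] bergmanTor M Pm t (s + 1)),
        -- `f` is the map on `Tor` induced by `ι`
        (∀ (t s : ℕ) (z : koszulCycles (bergmanAction M Pm) t)
            (hz : KoszulHomology.mk (bergmanAction M Pm) t z ∈ bergmanTor M Pm t s),
          ∃ hz' : LinearMap.rTensor (⋀[ℂ]^t (linearForms (sCirc M))) ι.toLinearMap z.1 ∈
              koszulCycles (bergmanAction M Pp) t,
            (f t s ⟨KoszulHomology.mk (bergmanAction M Pm) t z, hz⟩).1 =
              KoszulHomology.mk (bergmanAction M Pp) t ⟨_, hz'⟩) ∧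
        -- exactness everywhere, including the two ends of the sequence
        (∀ t s : ℕ, Function.Exact (f t s) (g t s)) ∧
        (∀ t s : ℕ, Function.Exact (g (t + 1) s) (δ t s)) ∧
        (∀ t s : ℕ, Function.Exact (δ t s) (f t (s + 1))) ∧
        (∀ t : ℕ, Function.Injective (f t 0)) ∧
        (∀ s : ℕ, Function.Surjective (g 0 s)) := by
  obtain ⟨f, g, δ, hf, h⟩ := hflip.exists_sequence
  refine ⟨hflip.hom, fun i _ => hflip.hom_inl i, fun F hF => hflip.hom_inr hF,
    hflip.hom_structureMap, f, g, δ, fun t s z hz =>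
      ⟨rTensor_mem_koszulCycles hflip.hom_bergmanAction z, ?_⟩, h⟩
  -- The map f is characterized only after inclusion into the total homology; injectivity of the
  -- inclusion brings the description back to classes of cycles in exterior degree t.
  exact koszulHomologyIncl_injective _ t
    ((hf t s _).trans (koszulMap_koszulHomologyIncl_mk hflip.hom_bergmanAction z))
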